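/- **Setting.** Let $n\ge 2$, $N\ge 1$, $p\in(1,\infty)$, $p'=p/(p-1)$, $p_{\mathrm c}=2n/(n+2)$, $T\in(0,\infty)$, let $\Omega\subset\mathbb R^n$ be a bounded Lipschitz domain, and $\Omega_T=\Omega\times(0,T)$. Let $V=W^{1,p}(\Omega)$, $V_0=W^{1,p}_0(\Omega)$ with $\|\varphi\|_{V_0}=\|\nabla\varphi\|_{L^p(\Omega)}$ if $p>p_{\mathrm c}$, and $V=W^{1,p}(\Omega)\cap L^2(\Omega)$, $V_0=W_0^{1,p}(\Omega)\cap L^2(\Omega)$ with $\|\varphi\|_{V_0}=\|\nabla\varphi\|_{L^p(\Omega)}+\|\varphi\|_{L^2(\Omega)}$ if $p\le p_{\mathrm c}$; here $W^{1,p}_0(\Omega)$ is the closure of $C^1_{\mathrm c}(\Omega)$ in $W^{1,p}(\Omega)$. For $\mathbb R^N$-valued functions the same formula is used for the norm of $V_0^N$, with the Euclidean norms of $\mathbb R^N$ and $\mathbb R^{Nn}$. $V_0'$ is the dual space of $V_0$ with the dual norm (in the vector-valued case $(V_0^N)'$ with its dual norm), and $L^2\subset V_0'$ through the $L^2$-pairing.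 Let $X^p$ (respectively $X^p_0$) be the space of all $u\in L^p(0,T;V)$ (respectively $L^p(0,T;V_0)$) with $\partial_t u\in L^{p'}(0,T;V_0')$, and $L^{2,1}(\Omega_T)=L^1(0,T;L^2(\Omega))$. $\mathbf D\mathbf u=(\partial_{x_\alpha}u^j)_{\alpha,j}$ is the spatial gradient. Let $\gamma_0\in(0,1)$, $\kappa_0\in(0,\infty)$, $\Gamma_0\in(1,\infty)$. Let $\boldsymbol\gamma=(\gamma_{\alpha\beta})$ be a measurable symmetric $n\times n$ matrix function with $\gamma_0|\zeta|^2\le\gamma_{\alpha\beta}(x,t)\zeta_\alpha\zeta_\beta\le\gamma_0^{-1}|\zeta|^2$ for all $(x,t)\in\Omega_T$ and $\zeta\in\mathbb R^n$; let $a_1,a_p$ be measurable on $\Omega_T$ with $a_1\ge 0$, $a_p\ge\Gamma_0^{-1}$ and $a_1+a_p\le\Gamma_0$ a.e.; let $g_p\in C^1(0,\infty)$ be positive with $g_p(\sigma)+\sigma|g_p'(\sigma)|\le\Gamma_0\sigma^{p/2-1}$ for all $\sigma>0$ and $g_p(\varepsilon^2+\sigma)+2\sigma\min\{0,g_p'(\varepsilon^2+\sigma)\}\ge\kappa_0(\varepsilon^2+\sigma)^{p/2-1}$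 for all $\sigma\ge 0$, $\varepsilon\in(0,1)$. Write $\langle\boldsymbol\zeta\mid\boldsymbol\eta\rangle_{\boldsymbol\gamma}=\gamma_{\alpha\beta}\zeta^j_\alpha\eta^j_\beta$, $|\boldsymbol\zeta|_{\boldsymbol\gamma}=\langle\boldsymbol\zeta\mid\boldsymbol\zeta\rangle_{\boldsymbol\gamma}^{1/2}$ for $\boldsymbol\zeta,\boldsymbol\eta\in\mathbb R^{Nn}$, let $\partial_{\boldsymbol\gamma}|\cdot|_{\boldsymbol\gamma}(\boldsymbol\zeta)$ be the set of all $\mathbf Z\in\mathbb R^{Nn}$ with $|\boldsymbol\xi|_{\boldsymbol\gamma}\ge|\boldsymbol\zeta|_{\boldsymbol\gamma}+\langle\mathbf Z\mid\boldsymbol\xi-\boldsymbol\zeta\rangle_{\boldsymbol\gamma}$ for all $\boldsymbol\xi\in\mathbb R^{Nn}$, and put $$\mathbf A(x,t,\boldsymbol\zeta,\mathbf Z)=a_1(x,t)\mathbf Z+a_p(x,t)\,g_p(|\boldsymbol\zeta|_{\boldsymbol\gamma}^2)\,\boldsymbol\zeta ,$$ where $g_p(0)\cdot 0:=0$. **Weak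 solutions.** Let $\mathbf f\in L^{2,1}(\Omega_T)^N\cap L^{p'}(0,T;V_0')^N$ and $\mathbf v\in (X^p)^N\cap C([0,T];L^2(\Omega))^N$. A weak solution of the Dirichlet problem with force $\mathbf f$ and parabolic boundary datum $\mathbf v$ is a function $\mathbf u\in(X^p)^N\cap C([0,T];L^2(\Omega))^N$ with $\mathbf u-\mathbf v\in (X_0^p)^N$ and $\mathbf u(\cdot,0)=\mathbf v(\cdot,0)$, for which there is $\mathbf Z\in L^\infty(\Omega_T)^{Nn}$ with $\mathbf Z(x,t)\in\partial_{\boldsymbol\gamma(x,t)}|\cdot|_{\boldsymbol\gamma(x,t)}(\mathbf D\mathbf u(x,t))$ for a.e. $(x,t)\in\Omega_T$ and $$\int_0^T\langle\partial_t\mathbf u,\boldsymbol\varphi\rangle\,dt+\int_0^T\!\!\int_{\Omega}\langle\mathbf A(x,t,\mathbf D\mathbf u,\mathbf Z)\mid\mathbf D\boldsymbol\varphi\rangle_{\boldsymbol\gamma}\,dx\,dt=\int_0^T\!\!\int_\Omega\mathbf f\cdot\boldsymbol\varphi\,dx\,dt\quad\text{for all }\boldsymbol\varphi\in L^p(0,T;V_0)^N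 .$$ Given such $\mathbf Z$, write $\mathbf A(\mathbf D\mathbf u)=\mathbf A(x,t,\mathbf D\mathbf u,\mathbf Z)$. **Lemma 8.2.** There is a constant $C\in(0,\infty)$, depending only on $n,N,p,\gamma_0,\kappa_0,\Gamma_0,\Omega,T$, with the following properties. Let $\mathbf f_1,\mathbf f_2\in L^{2,1}(\Omega_T)^N\cap L^{p'}(0,T;V_0')^N$, $\mathbf v_1,\mathbf v_2\in (X^p)^N\cap C([0,T];L^2(\Omega))^N$, and let $\mathbf u_k$ be a weak solution of the Dirichlet problem with force $\mathbf f_k$ and datum $\mathbf v_k$, with corresponding $\mathbf Z_k$ ($k=1,2$). Then, for $k=1,2$, $$\sup_{0<\tau<T}\int_{\Omega}|\mathbf u_k-\mathbf v_k|^2(x,\tau)\,dx+\iint_{\Omega_T}|\mathbf D\mathbf u_k|^p\,dx\,dt\le C\Big[\|\partial_t\mathbf v_k\|_{L^{p'}(0,T;V_0')}^{p'}+\|\mathbf D\mathbf v_k\|_{L^p(\Omega_T)}^p+\|\mathbf f_k\|_{L^{2,1}(\Omega_T)}^2+1\Big]$$ and $$\begin{aligned}&\sup_{0<\tau<T}\int_{\Omega}|\mathbf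 u_1-\mathbf u_2|^2(x,\tau)\,dx+\iint_{\Omega_T}\langle\mathbf A(\mathbf D\mathbf u_1)-\mathbf A(\mathbf D\mathbf u_2)\mid\mathbf D\mathbf u_1-\mathbf D\mathbf u_2\rangle_{\boldsymbol\gamma}\,dx\,dt\\&\le C\|\mathbf f_1-\mathbf f_2\|_{L^{2,1}(\Omega_T)}^2+C\big(\|\mathbf A(\mathbf D\mathbf u_1)\|_{L^{p'}(\Omega_T)}+\|\mathbf A(\mathbf D\mathbf u_2)\|_{L^{p'}(\Omega_T)}\big)\|\mathbf D\mathbf v_1-\mathbf D\mathbf v_2\|_{L^p(\Omega_T)}\\&\quad+C\|\partial_t\mathbf v_1-\partial_t\mathbf v_2\|_{L^{p'}(0,T;V_0')}\big(\|\mathbf u_1-\mathbf u_2\|_{L^p(0,T;V_0)}+\|\mathbf v_1-\mathbf v_2\|_{L^p(0,T;V_0)}\big)+C\sup_{0<\tau<T}\int_{\Omega}|\mathbf v_1-\mathbf v_2|^2(x,\tau)\,dx ,\end{aligned}$$ where $\|\mathbf w\|_{L^p(0,T;V_0)}=\big(\int_0^T\|\mathbf w(t)\|_{V_0}^p\,dt\big)^{1/p}$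 denotes the expression given by the formula for $\|\cdot\|_{V_0}$, also for $\mathbf w$ that do not vanish on $\partial\Omega$. In particular, for given $\mathbf f$ and $\mathbf v$ as above, there is at most one weak solution of the Dirichlet problem. -/

import Mathlib

open MeasureTheory Set
open scoped ENNReal NNReal ContDiff

noncomputable section

namespace OnePLaplace

/-- The space `ℝⁿ` of points `x`, with its Euclidean structure. -/
abbrev Pt (n : ℕ) : Type := EuclideanSpace ℝ (Fin n)

/-- The space `ℝᴺ` of values of `u`, with its Euclidean structure. -/
abbrev Vec (N : ℕ) : Type := EuclideanSpace ℝ (Fin N)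

/-- The space `ℝᴺⁿ` of gradients; the entry `(j, α)` is `ζ_α^j`, and the norm is the Euclidean
(Frobenius) one. -/
abbrev Mat (N n : ℕ) : Type := EuclideanSpace ℝ (Fin N × Fin n)

/-- A bounded Lipschitz domain: bounded, open, connected, non-empty, and near each boundary point
it is the region on one side of the graph of a Lipschitz function. Here `ν` is the direction of the
graph and `g` is a Lipschitz function of the coordinates orthogonal to `ν`. -/
class IsBoundedLipschitzDomain {n : ℕ} (Ω : Set (Pt n)) : Prop where
  isOpen : IsOpen Ω
  isBounded : Bornology.IsBounded Ω
  isConnected : IsConnected Ω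
  graph : ∀ x ∈ frontier Ω, ∃ r : ℝ, 0 < r ∧ ∃ (ν : Pt n) (g : Pt n → ℝ) (K : ℝ≥0),
    ‖ν‖ = 1 ∧ LipschitzWith K g ∧ (∀ y : Pt n, ∀ s : ℝ, g (y + s • ν) = g y) ∧
      Ω ∩ Metric.ball x r = {y | g y < inner ℝ ν y} ∩ Metric.ball x r

/-- Lebesgue measure on `Ω`. -/
abbrev spaceMeas {n : ℕ} (Ω : Set (Pt n)) : Measure (Pt n) := volume.restrict Ω

/-- Lebesgue measure on `(0, T)`. -/
abbrev timeMeas (T : ℝ) : Measure ℝ := volume.restrict (Ioo 0 T)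

/-- Lebesgue measure on `Ω_T`; points are written as `(t, x)`. -/
abbrev cylMeas {n : ℕ} (Ω : Set (Pt n)) (T : ℝ) : Measure (ℝ × Pt n) :=
  (timeMeas T).prod (spaceMeas Ω)

/-- The critical exponent `p_c = 2n/(n+2)`. -/
def pCrit (n : ℕ) : ℝ := 2 * n / (n + 2)

/-- The Hölder conjugate exponent `p' = p/(p-1)`. -/
def pConj (p : ℝ) : ℝ := p / (p - 1)

instance fact_one_le_ofReal (p : ℝ) [h : Fact (1 < p)] : Fact (1 ≤ ENNReal.ofReal p) :=
  ⟨by simpa using ENNReal.ofReal_le_ofReal h.out.le⟩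

/-! ### Sobolev spaces -/

/-- The Jacobian matrix of a differentiable map. -/
def jac {n N : ℕ} (φ : Pt n → Vec N) (x : Pt n) : Mat N n :=
  WithLp.toLp 2 fun i => fderiv ℝ φ x (EuclideanSpace.single i.2 1) i.1

/-- `G` is the weak gradient of `u` in `Ω`. -/
def IsWeakGrad {n N : ℕ} (Ω : Set (Pt n)) (u : Pt n → Vec N) (G : Pt n → Mat N n) : Prop :=
  ∀ η : Pt n → ℝ, ContDiff ℝ ∞ η → HasCompactSupport η → tsupport η ⊆ Ω →
    ∀ (j : Fin N) (α : Fin n),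
      ∫ x, u x j * fderiv ℝ η x (EuclideanSpace.single α 1) ∂(spaceMeas Ω)
        = - ∫ x, G x (j, α) * η x ∂(spaceMeas Ω)

/-- Pairs (function, gradient field) in `L^p(Ω)`. Sobolev functions are represented as pairs
`(u, Du)`. -/
abbrev LpPair {n : ℕ} (N : ℕ) (p : ℝ) (Ω : Set (Pt n)) : Type :=
  Lp (Vec N) (ENNReal.ofReal p) (spaceMeas Ω) × Lp (Mat N n) (ENNReal.ofReal p) (spaceMeas Ω)

theorem integrable_coord_mul {n : ℕ} {ι : Type*} [Fintype ι] {p : ℝ} [Fact (1 < p)]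
    {Ω : Set (Pt n)} (u : Lp (EuclideanSpace ℝ ι) (ENNReal.ofReal p) (spaceMeas Ω)) (i : ι)
    {η : Pt n → ℝ} (hη : Continuous η) (hc : HasCompactSupport η) :
    Integrable (fun x => u x i * η x) (spaceMeas Ω) := by
  have h1 : LocallyIntegrable (fun x => u x) (spaceMeas Ω) :=
    (Lp.memLp u).locallyIntegrable (Fact.out)
  have h2 : Integrable (fun x => η x • u x) (spaceMeas Ω) :=
    h1.integrable_smul_left_of_hasCompactSupport hη hc
  have h3 := (EuclideanSpace.proj (𝕜 := ℝ) i).integrable_comp h2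
  refine h3.congr (Filter.Eventually.of_forall fun x => ?_)
  simp [mul_comm]

theorem integrable_coord_mul_deriv {n : ℕ} {ι : Type*} [Fintype ι] {p : ℝ} [Fact (1 < p)]
    {Ω : Set (Pt n)} (u : Lp (EuclideanSpace ℝ ι) (ENNReal.ofReal p) (spaceMeas Ω)) (i : ι)
    {η : Pt n → ℝ} (hη : ContDiff ℝ ∞ η) (hc : HasCompactSupport η) (v : Pt n) :
    Integrable (fun x => u x i * fderiv ℝ η x v) (spaceMeas Ω) :=
  integrable_coord_mul u i
    ((hη.continuous_fderiv (by simp)).clm_apply continuous_const) (hc.fderiv_apply (𝕜 := ℝ) v)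

/-- The Sobolev space `W^{1,p}(Ω)ᴺ`. -/
def W1p {n : ℕ} (N : ℕ) (p : ℝ) [Fact (1 < p)] (Ω : Set (Pt n)) :
    Submodule ℝ (LpPair N p Ω) where
  carrier := {w | IsWeakGrad Ω w.1 w.2}
  zero_mem' := by
    intro η _ _ _ j α
    have h1 := Lp.coeFn_zero (Vec N) (ENNReal.ofReal p) (spaceMeas Ω)
    have h2 := Lp.coeFn_zero (Mat N n) (ENNReal.ofReal p) (spaceMeas Ω)
    rw [integral_eq_zero_of_ae, integral_eq_zero_of_ae, neg_zero]
    · filter_upwards [h2] with x hx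
      exact (congrArg (fun y : Mat N n => y (j, α) * η x) hx).trans (by simp)
    · filter_upwards [h1] with x hx
      exact (congrArg (fun y : Vec N => y j * fderiv ℝ η x (EuclideanSpace.single α 1)) hx).trans
        (by simp)
  add_mem' := by
    intro a b ha hb η h1 h2 h3 j α
    have e1 : ∫ x, (a + b).1 x j * fderiv ℝ η x (EuclideanSpace.single α 1) ∂(spaceMeas Ω)
        = ∫ x, (a.1 x j * fderiv ℝ η x (EuclideanSpace.single α 1)
          + b.1 x j * fderiv ℝ η x (EuclideanSpace.single α 1)) ∂(spaceMeas Ω) := by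
      refine integral_congr_ae ?_
      filter_upwards [Lp.coeFn_add a.1 b.1] with x hx
      exact (congrArg (fun y : Vec N => y j * fderiv ℝ η x (EuclideanSpace.single α 1)) hx).trans
        (by simp [add_mul])
    have e2 : ∫ x, (a + b).2 x (j, α) * η x ∂(spaceMeas Ω)
        = ∫ x, (a.2 x (j, α) * η x + b.2 x (j, α) * η x) ∂(spaceMeas Ω) := by
      refine integral_congr_ae ?_
      filter_upwards [Lp.coeFn_add a.2 b.2] with x hx
      exact (congrArg (fun y : Mat N n => y (j, α) * η x) hx).trans (by simp [add_mul])
    rw [e1, e2, integral_add (integrable_coord_mul_deriv a.1 j h1 h2 _)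
      (integrable_coord_mul_deriv b.1 j h1 h2 _),
      integral_add (integrable_coord_mul a.2 (j, α) h1.continuous h2)
      (integrable_coord_mul b.2 (j, α) h1.continuous h2), ha η h1 h2 h3 j α, hb η h1 h2 h3 j α]
    ring
  smul_mem' := by
    intro c a ha η h1 h2 h3 j α
    have e1 : ∫ x, (c • a).1 x j * fderiv ℝ η x (EuclideanSpace.single α 1) ∂(spaceMeas Ω)
        = ∫ x, c * (a.1 x j * fderiv ℝ η x (EuclideanSpace.single α 1)) ∂(spaceMeas Ω) := by
      refine integral_congr_ae ?_
      filter_upwards [Lp.coeFn_smul c a.1] with x hx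
      simp [hx, mul_assoc]
    have e2 : ∫ x, (c • a).2 x (j, α) * η x ∂(spaceMeas Ω)
        = ∫ x, c * (a.2 x (j, α) * η x) ∂(spaceMeas Ω) := by
      refine integral_congr_ae ?_
      filter_upwards [Lp.coeFn_smul c a.2] with x hx
      simp [hx, mul_assoc]
    rw [e1, e2, integral_const_mul, integral_const_mul, ha η h1 h2 h3 j α]
    ring

theorem jac_add {n N : ℕ} {φ ψ : Pt n → Vec N} (h1 : ContDiff ℝ 1 φ) (h2 : ContDiff ℝ 1 ψ)
    (x : Pt n) : jac (φ + ψ) x = jac φ x + jac ψ x := by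
  ext i
  simp [jac, fderiv_add (h1.differentiable one_ne_zero x) (h2.differentiable one_ne_zero x)]

theorem jac_smul {n N : ℕ} {φ : Pt n → Vec N} (c : ℝ) (h1 : ContDiff ℝ 1 φ) (x : Pt n) :
    jac (c • φ) x = c • jac φ x := by
  ext i
  simp [jac, fderiv_const_smul (h1.differentiable one_ne_zero x) c]

/-- The pairs `(φ, Dφ)` with `φ ∈ C_c^1(Ω)ᴺ`. -/
def testPairs {n : ℕ} (N : ℕ) (p : ℝ) [Fact (1 < p)] (Ω : Set (Pt n)) :
    Submodule ℝ (LpPair N p Ω) where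
  carrier := {w | ∃ φ : Pt n → Vec N, ContDiff ℝ 1 φ ∧ HasCompactSupport φ ∧ tsupport φ ⊆ Ω ∧
    w.1 =ᵐ[spaceMeas Ω] φ ∧ w.2 =ᵐ[spaceMeas Ω] jac φ}
  zero_mem' := by
    refine ⟨0, contDiff_const, HasCompactSupport.zero, by simp [tsupport], ?_, ?_⟩
    · exact Lp.coeFn_zero _ _ _
    · filter_upwards [Lp.coeFn_zero (Mat N n) (ENNReal.ofReal p) (spaceMeas Ω)] with x hx
      exact hx.trans (by ext i; simp [jac])
  add_mem' := by
    rintro a b ⟨φ, h1, h2, h3, h4, h5⟩ ⟨ψ, k1, k2, k3, k4, k5⟩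
    refine ⟨φ + ψ, h1.add k1, h2.add k2, (tsupport_add φ ψ).trans (union_subset h3 k3), ?_, ?_⟩
    · filter_upwards [Lp.coeFn_add a.1 b.1, h4, k4] with x hx h k
      exact hx.trans (by simp [h, k])
    · filter_upwards [Lp.coeFn_add a.2 b.2, h5, k5] with x hx h k
      rw [jac_add h1 k1, ← h, ← k]
      simpa using hx
  smul_mem' := by
    rintro c a ⟨φ, h1, h2, h3, h4, h5⟩
    refine ⟨c • φ, contDiff_const.smul h1, h2.smul_left (f := fun _ => c),
      (tsupport_smul_subset_right (fun _ => c) φ).trans h3, ?_, ?_⟩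
    · filter_upwards [Lp.coeFn_smul c a.1, h4] with x hx h
      simp [hx, h]
    · filter_upwards [Lp.coeFn_smul c a.2, h5] with x hx h
      rw [jac_smul c h1, ← h]
      simpa using hx

/-- The space `W_0^{1,p}(Ω)ᴺ`: the closure of `C_c^1(Ω)ᴺ` for the `W^{1,p}`-norm. -/
def W01p {n : ℕ} (N : ℕ) (p : ℝ) [Fact (1 < p)] (Ω : Set (Pt n)) :
    Submodule ℝ (LpPair N p Ω) :=
  (testPairs N p Ω).topologicalClosure

/-- Intersection with `L²(Ω)ᴺ`, imposed exactly when `p ≤ p_c`. -/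
def interL2 {n : ℕ} {N : ℕ} {p : ℝ} {Ω : Set (Pt n)} (W : Submodule ℝ (LpPair N p Ω)) :
    Submodule ℝ (LpPair N p Ω) where
  carrier := {w | w ∈ W ∧ (p ≤ pCrit n → MemLp w.1 2 (spaceMeas Ω))}
  zero_mem' := ⟨W.zero_mem, fun _ => (memLp_congr_ae (Lp.coeFn_zero _ _ _)).2 MemLp.zero⟩
  add_mem' := fun {a b} ha hb => ⟨W.add_mem ha.1 hb.1, fun h =>
    (memLp_congr_ae (Lp.coeFn_add a.1 b.1)).2 ((ha.2 h).add (hb.2 h))⟩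
  smul_mem' := fun c a ha => ⟨W.smul_mem c ha.1, fun h =>
    (memLp_congr_ae (Lp.coeFn_smul c a.1)).2 ((ha.2 h).const_smul c)⟩

/-- The expression `‖G‖_{L^p(Ω)}` if `p > p_c`, and `‖G‖_{L^p(Ω)} + ‖w‖_{L²(Ω)}` if `p ≤ p_c`.
For `G = Dw` it is the norm of `V_0`. -/
def v0Norm {n N : ℕ} (p : ℝ) (Ω : Set (Pt n)) (w : Pt n → Vec N) (G : Pt n → Mat N n) : ℝ :=
  (eLpNorm G (ENNReal.ofReal p) (spaceMeas Ω)).toReal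
    + if p ≤ pCrit n then (eLpNorm w 2 (spaceMeas Ω)).toReal else 0

theorem toReal_eLpNorm_add_le {X F : Type*} [MeasurableSpace X] [NormedAddCommGroup F]
    {μ : Measure X} {q : ℝ≥0∞} (hq : 1 ≤ q) {f g h : X → F} (hf : MemLp f q μ) (hg : MemLp g q μ)
    (hh : h =ᵐ[μ] f + g) :
    (eLpNorm h q μ).toReal ≤ (eLpNorm f q μ).toReal + (eLpNorm g q μ).toReal := by
  rw [eLpNorm_congr_ae hh, ← ENNReal.toReal_add hf.eLpNorm_ne_top hg.eLpNorm_ne_top]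
  exact ENNReal.toReal_mono (ENNReal.add_ne_top.2 ⟨hf.eLpNorm_ne_top, hg.eLpNorm_ne_top⟩)
    (eLpNorm_add_le hf.1 hg.1 hq)

theorem toReal_eLpNorm_smul {X F : Type*} [MeasurableSpace X] [NormedAddCommGroup F]
    [NormedSpace ℝ F] {μ : Measure X} {q : ℝ≥0∞} (c : ℝ) {f h : X → F} (hh : h =ᵐ[μ] c • f) :
    (eLpNorm h q μ).toReal = ‖c‖ * (eLpNorm f q μ).toReal := by
  rw [eLpNorm_congr_ae hh, eLpNorm_const_smul, ENNReal.toReal_mul, toReal_enorm]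

theorem v0Norm_add_le {n N : ℕ} {p : ℝ} [Fact (1 < p)] {Ω : Set (Pt n)}
    (W : Submodule ℝ (LpPair N p Ω)) (a b : ↥(interL2 W)) :
    v0Norm p Ω (a + b).1.1 (a + b).1.2 ≤ v0Norm p Ω a.1.1 a.1.2 + v0Norm p Ω b.1.1 b.1.2 := by
  have h1 := toReal_eLpNorm_add_le (Fact.out : 1 ≤ ENNReal.ofReal p) (Lp.memLp a.1.2)
    (Lp.memLp b.1.2) (Lp.coeFn_add a.1.2 b.1.2)
  unfold v0Norm
  split_ifs with h
  · have h2 := toReal_eLpNorm_add_le one_le_two (a.2.2 h) (b.2.2 h) (Lp.coeFn_add a.1.1 b.1.1)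
    exact (add_le_add h1 h2).trans_eq (by ring)
  · simpa using h1

theorem v0Norm_smul {n N : ℕ} {p : ℝ} {Ω : Set (Pt n)} (W : Submodule ℝ (LpPair N p Ω)) (c : ℝ) (a : ↥(interL2 W)) :
    v0Norm p Ω (c • a).1.1 (c • a).1.2 = ‖c‖ * v0Norm p Ω a.1.1 a.1.2 := by
  have h1 := toReal_eLpNorm_smul (q := ENNReal.ofReal p) c (Lp.coeFn_smul c a.1.2)
  have h2 := toReal_eLpNorm_smul (q := 2) c (Lp.coeFn_smul c a.1.1)
  unfold v0Norm
  split_ifs with h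
  · exact (congrArg₂ (· + ·) h1 h2).trans (by ring)
  · simpa using h1

theorem norm_fderiv_le {n N : ℕ} (φ : Pt n → Vec N) (x : Pt n) :
    ‖fderiv ℝ φ x‖ ≤ n * ‖jac φ x‖ := by
  have key : ∀ α : Fin n, ‖fderiv ℝ φ x (EuclideanSpace.single α 1)‖ ≤ ‖jac φ x‖ := by
    intro α
    rw [EuclideanSpace.norm_eq, EuclideanSpace.norm_eq]
    refine Real.sqrt_le_sqrt ?_
    rw [Fintype.sum_prod_type]
    refine Finset.sum_le_sum fun j _ => ?_
    exact Finset.single_le_sum (f := fun α => ‖jac φ x (j, α)‖ ^ 2)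
      (fun _ _ => by positivity) (Finset.mem_univ α)
  refine ContinuousLinearMap.opNorm_le_bound _ (by positivity) fun v => ?_
  have hv : v = ∑ α, v α • (EuclideanSpace.single α 1 : Pt n) := by
    ext β
    simp [Finset.sum_apply, Pi.single_apply]
  have hle : ‖fderiv ℝ φ x v‖ ≤ ∑ _α : Fin n, ‖v‖ * ‖jac φ x‖ := by
    conv_lhs => rw [hv, map_sum]
    refine norm_sum_le_of_le _ fun α _ => ?_
    rw [map_smul, norm_smul]
    exact mul_le_mul (PiLp.norm_apply_le v α) (key α) (norm_nonneg _) (norm_nonneg _)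
  refine hle.trans_eq ?_
  simp
  ring

theorem eLpNorm_fderiv_restrict {n N : ℕ} {Ω : Set (Pt n)} {φ : Pt n → Vec N}
    (h : tsupport φ ⊆ Ω) (q : ℝ≥0∞) :
    eLpNorm (fderiv ℝ φ) q (spaceMeas Ω) = eLpNorm (fderiv ℝ φ) q volume := by
  have h' : Function.support (fun x => ‖fderiv ℝ φ x‖) ⊆ Ω := fun x hx =>
    h (support_fderiv_subset ℝ (fun h0 => hx (by simp [h0])))
  rw [← eLpNorm_norm, ← eLpNorm_norm (fderiv ℝ φ)]
  exact eLpNorm_restrict_eq_of_support_subset h'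

/-- A function in `W_0^{1,p}` of a bounded set whose gradient vanishes is zero. -/
theorem W01p_eq_zero {n N : ℕ} {p : ℝ} [Fact (1 < p)] {Ω : Set (Pt n)} (hn : 2 ≤ n)
    (hΩ : Bornology.IsBounded Ω) (w : LpPair N p Ω) (hw : w ∈ W01p N p Ω)
    (h0 : ‖w.2‖ = 0) : w.1 = 0 := by
  obtain ⟨q, hq⟩ : ∃ q, q = ENNReal.ofReal p := ⟨_, rfl⟩
  have hq1 : 1 ≤ q := hq ▸ Fact.out
  have hfin : (spaceMeas Ω) univ ≠ ⊤ := by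
    rw [Measure.restrict_apply_univ]
    exact hΩ.measure_lt_top.ne
  obtain ⟨D, hD⟩ : ∃ D : ℝ≥0∞,
      D = (spaceMeas Ω) univ ^ (1 / (1 : ℝ≥0∞).toReal - 1 / q.toReal) := ⟨_, rfl⟩
  have hDfin : D ≠ ⊤ := by
    rw [hD]
    refine ENNReal.rpow_ne_top_of_nonneg ?_ hfin
    rw [hq, ENNReal.toReal_ofReal (by linarith [(Fact.out : 1 < p)])]
    have : 1 / p ≤ 1 := by
      rw [div_le_one (by linarith [(Fact.out : 1 < p)])]
      exact (Fact.out : 1 < p).le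
    simpa using this
  obtain ⟨K, hK⟩ : ∃ K : ℝ≥0∞, K = (eLpNormLESNormFDerivOfLeConst (Vec N) (volume : Measure (Pt n)) Ω 1 1 : ℝ≥0∞) :=
    ⟨_, rfl⟩
  have hbound : ∀ ε : ℝ≥0∞, 0 < ε → ε ≠ ⊤ → eLpNorm w.1 1 (spaceMeas Ω) ≤ (D + K * n * D) * ε := by
    intro ε hε hεt
    obtain ⟨a, ⟨φ, h1, h2, h3, h4, h5⟩, hda⟩ := Metric.mem_closure_iff.1 hw ε.toReal
      (ENNReal.toReal_pos hε.ne' hεt)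
    have hd1 : eLpNorm (fun x => w.1 x - a.1 x) q (spaceMeas Ω) ≤ ε := by
      rw [hq]
      refine (eLpNorm_congr_ae (Lp.coeFn_sub w.1 a.1)).symm.le.trans ?_
      rw [← Lp.enorm_def, ← edist_eq_enorm_sub]
      refine (le_max_left _ (edist w.2 a.2)).trans ?_
      change edist w a ≤ ε
      rw [edist_dist]
      exact ENNReal.ofReal_le_of_le_toReal hda.le
    have hd2 : eLpNorm a.2 q (spaceMeas Ω) ≤ ε := by
      have hw2 : w.2 = 0 := norm_eq_zero.1 h0
      have : edist w.2 a.2 ≤ ε := by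
        refine (le_max_right (edist w.1 a.1) _).trans ?_
        change edist w a ≤ ε
        rw [edist_dist]
        exact ENNReal.ofReal_le_of_le_toReal hda.le
      rw [hw2, edist_comm, edist_zero_right, Lp.enorm_def] at this
      rw [hq]
      exact this
    have hsupp : Function.support φ ⊆ Ω := (subset_tsupport φ).trans h3
    have e1 : eLpNorm a.1 1 (spaceMeas Ω) ≤ K * n * D * ε := by
      rw [eLpNorm_congr_ae h4, eLpNorm_restrict_eq_of_support_subset hsupp]
      have g1 : eLpNorm φ 1 volume ≤ K * eLpNorm (fderiv ℝ φ) 1 volume := by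
        have := eLpNorm_le_eLpNorm_fderiv (volume : Measure (Pt n)) h1 hsupp (p := 1) le_rfl
          (by simp; omega) hΩ
        rw [hK]
        simpa using this
      have g2 : eLpNorm (fderiv ℝ φ) 1 volume = eLpNorm (fderiv ℝ φ) 1 (spaceMeas Ω) := by
        exact (eLpNorm_fderiv_restrict h3 1).symm
      have g3 : eLpNorm (fderiv ℝ φ) 1 (spaceMeas Ω) ≤ n * eLpNorm a.2 1 (spaceMeas Ω) := by
        have := eLpNorm_le_mul_eLpNorm_of_ae_le_mul (μ := spaceMeas Ω) (f := fderiv ℝ φ) (g := a.2)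
          (c := (n : ℝ)) (by
            filter_upwards [h5] with x hx
            rw [hx]
            exact norm_fderiv_le φ x) 1
        simpa using this
      have g4 : eLpNorm a.2 1 (spaceMeas Ω) ≤ ε * D :=
        calc _ ≤ _ := eLpNorm_le_eLpNorm_mul_rpow_measure_univ hq1 (Lp.aestronglyMeasurable a.2)
          _ ≤ ε * D := by rw [hD]; gcongr
      calc eLpNorm φ 1 volume ≤ K * (n * (ε * D)) := by
            refine g1.trans ?_
            rw [g2]
            gcongr
            exact g3.trans (by gcongr)
        _ = K * n * D * ε := by ring
    have hm := (Lp.aestronglyMeasurable w.1).sub (Lp.aestronglyMeasurable a.1)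
    have e2 : eLpNorm (fun x => w.1 x - a.1 x) 1 (spaceMeas Ω) ≤ D * ε := by
      calc _ ≤ _ := eLpNorm_le_eLpNorm_mul_rpow_measure_univ hq1 hm
        _ ≤ ε * D := by rw [hD]; gcongr; exact hd1
        _ = D * ε := mul_comm _ _
    have e3 := eLpNorm_add_le hm (Lp.aestronglyMeasurable a.1) le_rfl
    rw [sub_add_cancel] at e3
    calc _ ≤ _ := e3
      _ ≤ D * ε + K * n * D * ε := add_le_add e2 e1
      _ = (D + K * n * D) * ε := by ring
  have hz : eLpNorm w.1 1 (spaceMeas Ω) = 0 := by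
    have hM : D + K * n * D ≠ ⊤ := by
      refine ENNReal.add_ne_top.2 ⟨hDfin, ENNReal.mul_ne_top (ENNReal.mul_ne_top ?_ ?_) hDfin⟩
      · rw [hK]
        exact ENNReal.coe_ne_top
      · exact ENNReal.natCast_ne_top n
    have ht : Filter.Tendsto (fun ε : ℝ≥0∞ => (D + K * n * D) * ε) (nhdsWithin 0 (Ioi 0))
        (nhds 0) := by
      have := (ENNReal.continuous_const_mul hM).tendsto 0
      rw [mul_zero] at this
      exact this.mono_left nhdsWithin_le_nhds
    refine le_antisymm (ge_of_tendsto ht ?_) zero_le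
    filter_upwards [self_mem_nhdsWithin,
      mem_nhdsWithin_of_mem_nhds (Iio_mem_nhds (ENNReal.zero_lt_top))] with ε h1 h2
    exact hbound ε h1 (ne_of_lt h2)
  have := (eLpNorm_eq_zero_iff (Lp.aestronglyMeasurable w.1) one_ne_zero).1 hz
  exact (Lp.eq_zero_iff_ae_eq_zero).2 this

/-- `V_0(Ω)ᴺ`: `W_0^{1,p}` if `p > p_c`, and `W_0^{1,p} ∩ L²` if `p ≤ p_c`. -/
def V0 {n : ℕ} (N : ℕ) (p : ℝ) [Fact (1 < p)] (Ω : Set (Pt n)) : Type :=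
  ↥(interL2 (W01p N p Ω))

/-- `V(Ω)ᴺ`: `W^{1,p}` if `p > p_c`, and `W^{1,p} ∩ L²` if `p ≤ p_c`. -/
def V {n : ℕ} (N : ℕ) (p : ℝ) [Fact (1 < p)] (Ω : Set (Pt n)) : Type :=
  ↥(interL2 (W1p N p Ω))

section instances

variable {n N : ℕ} {p : ℝ} [Fact (1 < p)] {Ω : Set (Pt n)}

instance : AddCommGroup (V0 N p Ω) := inferInstanceAs (AddCommGroup ↥(interL2 (W01p N p Ω)))
instance : Module ℝ (V0 N p Ω) := inferInstanceAs (Module ℝ ↥(interL2 (W01p N p Ω)))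
instance : AddCommGroup (V N p Ω) := inferInstanceAs (AddCommGroup ↥(interL2 (W1p N p Ω)))
instance : Module ℝ (V N p Ω) := inferInstanceAs (Module ℝ ↥(interL2 (W1p N p Ω)))

/-- The underlying function of an element of `V_0`. -/
def V0.fn (φ : V0 N p Ω) : Lp (Vec N) (ENNReal.ofReal p) (spaceMeas Ω) := φ.1.1

/-- The weak gradient of an element of `V_0`. -/
def V0.grad (φ : V0 N p Ω) : Lp (Mat N n) (ENNReal.ofReal p) (spaceMeas Ω) := φ.1.2

/-- The underlying function of an element of `V`. -/
def V.fn (φ : V N p Ω) : Lp (Vec N) (ENNReal.ofReal p) (spaceMeas Ω) := φ.1.1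

/-- The weak gradient of an element of `V`. -/
def V.grad (φ : V N p Ω) : Lp (Mat N n) (ENNReal.ofReal p) (spaceMeas Ω) := φ.1.2

theorem V0.eq_zero (hn : 2 ≤ n) (hΩ : Bornology.IsBounded Ω) (φ : V0 N p Ω)
    (h : v0Norm p Ω φ.fn φ.grad = 0) : φ = 0 := by
  have h2 : ‖φ.grad‖ = 0 := by
    refine le_antisymm ?_ (norm_nonneg _)
    rw [Lp.norm_def, ← h]
    unfold v0Norm
    split_ifs
    · exact le_add_of_nonneg_right ENNReal.toReal_nonneg
    · exact (add_zero _).ge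
  have h1 : φ.fn = 0 := W01p_eq_zero hn hΩ φ.1 φ.2.1 h2
  exact Subtype.ext (Prod.ext h1 (norm_eq_zero.1 h2))

/-- The norm of `V_0`. -/
def V0.groupNorm (hn : 2 ≤ n) (hΩ : Bornology.IsBounded Ω) : AddGroupNorm (V0 N p Ω) :=
  { (Seminorm.of (𝕜 := ℝ) (fun φ : V0 N p Ω => v0Norm p Ω φ.fn φ.grad) (v0Norm_add_le _)
      (v0Norm_smul _)).toAddGroupSeminorm with
    eq_zero_of_map_eq_zero' := V0.eq_zero hn hΩ }

/-- The norm of `V`: the `W^{1,p}`-norm if `p > p_c`, to which `‖·‖_{L²}` is added if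
`p ≤ p_c`. -/
def V.groupNorm : AddGroupNorm (V N p Ω) :=
  { (Seminorm.of (𝕜 := ℝ) (fun φ : V N p Ω => ‖φ.fn‖ + v0Norm p Ω φ.fn φ.grad)
      (fun a b => (add_le_add (norm_add_le a.fn b.fn) (v0Norm_add_le _ a b)).trans_eq
        (add_add_add_comm _ _ _ _))
      (fun c a => (congrArg₂ (· + ·) (norm_smul c a.fn) (v0Norm_smul _ c a)).trans
        (mul_add _ _ _).symm)).toAddGroupSeminorm with
    eq_zero_of_map_eq_zero' := by
      intro φ h
      have h' : ‖φ.fn‖ + (‖φ.grad‖ + if p ≤ pCrit n then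
        (eLpNorm φ.fn 2 (spaceMeas Ω)).toReal else 0) = 0 := h
      have h3 : 0 ≤ if p ≤ pCrit n then (eLpNorm φ.fn 2 (spaceMeas Ω)).toReal else 0 := by
        split_ifs
        · exact ENNReal.toReal_nonneg
        · exact le_rfl
      have h1 : φ.fn = 0 := norm_eq_zero.1 (by linarith [norm_nonneg φ.fn, norm_nonneg φ.grad])
      have h2 : φ.grad = 0 := norm_eq_zero.1 (by linarith [norm_nonneg φ.fn, norm_nonneg φ.grad])
      exact Subtype.ext (Prod.ext h1 h2) }

instance [hn : Fact (2 ≤ n)] [hΩ : IsBoundedLipschitzDomain Ω] :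
    NormedAddCommGroup (V0 N p Ω) :=
  (V0.groupNorm hn.out hΩ.isBounded).toNormedAddCommGroup

instance [Fact (2 ≤ n)] [IsBoundedLipschitzDomain Ω] : NormedSpace ℝ (V0 N p Ω) where
  norm_smul_le c a := (v0Norm_smul _ c a).le

instance : NormedAddCommGroup (V N p Ω) := V.groupNorm.toNormedAddCommGroup

instance : NormedSpace ℝ (V N p Ω) where
  norm_smul_le c a := ((congrArg₂ (· + ·) (norm_smul c a.fn) (v0Norm_smul _ c a)).trans
    (mul_add _ _ _).symm).le

theorem V0.norm_def [Fact (2 ≤ n)] [IsBoundedLipschitzDomain Ω] (φ : V0 N p Ω) :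
    ‖φ‖ = v0Norm p Ω φ.fn φ.grad := rfl

theorem V.norm_def (φ : V N p Ω) : ‖φ‖ = ‖φ.fn‖ + v0Norm p Ω φ.fn φ.grad := rfl

end instances

/-- The dual space `V_0'(Ω)ᴺ`. -/
abbrev V0' {n : ℕ} [Fact (2 ≤ n)] (N : ℕ) (p : ℝ) [Fact (1 < p)] (Ω : Set (Pt n))
    [IsBoundedLipschitzDomain Ω] : Type :=
  StrongDual ℝ (V0 N p Ω)

/-- The space `L²(Ω)ᴺ`. -/
abbrev L2 {n : ℕ} (N : ℕ) (Ω : Set (Pt n)) : Type := Lp (Vec N) 2 (spaceMeas Ω)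

/-! ### Parabolic function spaces -/

section parabolic

variable {n N : ℕ} [Fact (2 ≤ n)] (p : ℝ) [Fact (1 < p)] (Ω : Set (Pt n))
  [IsBoundedLipschitzDomain Ω] (T : ℝ)

/-- `w' = ∂_t w` as a `V_0'`-valued distribution on `(0, T)`, where `L² ⊂ V_0'` through the
`L²`-pairing. -/
def IsTimeDeriv (w : ℝ → L2 N Ω) (w' : ℝ → V0' N p Ω) : Prop :=
  ∀ ψ : ℝ → ℝ, ContDiff ℝ ∞ ψ → HasCompactSupport ψ → tsupport ψ ⊆ Ioo 0 T →
    ∀ φ : V0 N p Ω,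
      ∫ t, deriv ψ t * ∫ x, inner ℝ (w t x) (φ.fn x) ∂(spaceMeas Ω) ∂(timeMeas T)
        = - ∫ t, ψ t * w' t φ ∂(timeMeas T)

/-- `u ∈ X^p(0,T;Ω)ᴺ ∩ C([0,T];L²(Ω))ᴺ`, with spatial gradient `Du` (a function on `Ω_T`) and time
derivative `u' = ∂_t u`. -/
structure MemXC (u : ℝ → L2 N Ω) (Du : ℝ → Pt n → Mat N n) (u' : ℝ → V0' N p Ω) : Prop where
  continuousOn : ContinuousOn u (Icc 0 T)
  grad_meas : AEStronglyMeasurable (Function.uncurry Du) (cylMeas Ω T)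
  bochner : ∃ U : ℝ → V N p Ω, MemLp U (ENNReal.ofReal p) (timeMeas T) ∧
    ∀ᵐ t ∂(timeMeas T), (U t).fn =ᵐ[spaceMeas Ω] u t ∧ (U t).grad =ᵐ[spaceMeas Ω] Du t
  deriv_memLp : MemLp u' (ENNReal.ofReal (pConj p)) (timeMeas T)
  isTimeDeriv : IsTimeDeriv p Ω T u u'

/-- `w ∈ X_0^p(0,T;Ω)ᴺ`. -/
def MemX0 (w : ℝ → L2 N Ω) : Prop :=
  (∃ W : ℝ → V0 N p Ω, MemLp W (ENNReal.ofReal p) (timeMeas T) ∧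
    ∀ᵐ t ∂(timeMeas T), (W t).fn =ᵐ[spaceMeas Ω] w t) ∧
  ∃ w' : ℝ → V0' N p Ω, MemLp w' (ENNReal.ofReal (pConj p)) (timeMeas T) ∧
    IsTimeDeriv p Ω T w w'

/-- `f ∈ L^{2,1}(Ω_T)ᴺ ∩ L^{p'}(0,T;V_0')ᴺ`, where `L^{2,1}(Ω_T) = L¹(0,T;L²(Ω))`. -/
def MemForce (f : ℝ → L2 N Ω) : Prop :=
  MemLp f 1 (timeMeas T) ∧
  ∃ F : ℝ → V0' N p Ω, MemLp F (ENNReal.ofReal (pConj p)) (timeMeas T) ∧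
    ∀ᵐ t ∂(timeMeas T), ∀ φ : V0 N p Ω,
      F t φ = ∫ x, inner ℝ (f t x) (φ.fn x) ∂(spaceMeas Ω)

/-- The norm of `L^{2,1}(Ω_T)`. -/
def normL21 (f : ℝ → L2 N Ω) : ℝ := (eLpNorm f 1 (timeMeas T)).toReal

/-- The norm of `L^{p'}(0,T;V_0')`. -/
def normDual (F : ℝ → V0' N p Ω) : ℝ :=
  (eLpNorm F (ENNReal.ofReal (pConj p)) (timeMeas T)).toReal

/-- The norm of `L^s(Ω_T)` of a function with values in `ℝᴺⁿ`. -/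
def normCyl (s : ℝ) (G : ℝ → Pt n → Mat N n) : ℝ :=
  (eLpNorm (Function.uncurry G) (ENNReal.ofReal s) (cylMeas Ω T)).toReal

/-- The expression `‖w‖_{L^p(0,T;V_0)}` of a function `w` with spatial gradient `Dw`. -/
def normLpV0 (w : ℝ → L2 N Ω) (Dw : ℝ → Pt n → Mat N n) : ℝ :=
  (eLpNorm (fun t => v0Norm p Ω (w t) (Dw t)) (ENNReal.ofReal p) (timeMeas T)).toReal

end parabolic

/-- `sup_{0<τ<T} ∫_Ω |w(x,τ)|² dx`. -/
def supSq {n N : ℕ} {Ω : Set (Pt n)} (T : ℝ) (w : ℝ → L2 N Ω) : ℝ := ⨆ τ : Ioo (0 : ℝ) T, ‖w τ‖ ^ 2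

/-! ### The system -/

/-- `⟨ζ | η⟩_γ = γ_{αβ} ζ_α^j η_β^j`. -/
def gInner {n N : ℕ} (γ : Matrix (Fin n) (Fin n) ℝ) (ζ η : Mat N n) : ℝ :=
  ∑ j, ∑ α, ∑ β, γ α β * ζ (j, α) * η (j, β)

/-- `|ζ|_γ = ⟨ζ | ζ⟩_γ^{1/2}`. -/
def gNorm {n N : ℕ} (γ : Matrix (Fin n) (Fin n) ℝ) (ζ : Mat N n) : ℝ := √(gInner γ ζ ζ)

/-- The subdifferential of `|·|_γ` at `ζ`, with respect to `⟨· | ·⟩_γ`. -/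
def subdiff {n N : ℕ} (γ : Matrix (Fin n) (Fin n) ℝ) (ζ : Mat N n) : Set (Mat N n) :=
  {Z | ∀ ξ : Mat N n, gNorm γ ζ + gInner γ Z (ξ - ζ) ≤ gNorm γ ξ}

/-- The coefficients of the system. Functions of `(x, t)` take `t` first. -/
structure Coeffs (n : ℕ) where
  a₁ : ℝ → Pt n → ℝ
  aₚ : ℝ → Pt n → ℝ
  gₚ : ℝ → ℝ
  γ : ℝ → Pt n → Matrix (Fin n) (Fin n) ℝ

/-- Structure conditions on the coefficients with constants `γ₀`, `κ₀`, `Γ₀`. -/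
structure Coeffs.Admissible {n : ℕ} (c : Coeffs n) (p : ℝ) (Ω : Set (Pt n)) (T γ₀ κ₀ Γ₀ : ℝ) :
    Prop where
  γ_meas : ∀ α β,
    AEStronglyMeasurable (fun z : ℝ × Pt n => c.γ z.1 z.2 α β) (cylMeas Ω T)
  γ_symm : ∀ t ∈ Ioo 0 T, ∀ x ∈ Ω, (c.γ t x).IsSymm
  γ_elliptic : ∀ t ∈ Ioo 0 T, ∀ x ∈ Ω, ∀ ζ : Pt n,
    γ₀ * ‖ζ‖ ^ 2 ≤ ∑ α, ∑ β, c.γ t x α β * ζ α * ζ β ∧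
      ∑ α, ∑ β, c.γ t x α β * ζ α * ζ β ≤ γ₀⁻¹ * ‖ζ‖ ^ 2
  a₁_meas : AEStronglyMeasurable (Function.uncurry c.a₁) (cylMeas Ω T)
  aₚ_meas : AEStronglyMeasurable (Function.uncurry c.aₚ) (cylMeas Ω T)
  a_bounds : ∀ᵐ z ∂(cylMeas Ω T),
    0 ≤ c.a₁ z.1 z.2 ∧ Γ₀⁻¹ ≤ c.aₚ z.1 z.2 ∧ c.a₁ z.1 z.2 + c.aₚ z.1 z.2 ≤ Γ₀
  gₚ_pos : ∀ σ, 0 < σ → 0 < c.gₚ σ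
  gₚ_contDiff : ContDiffOn ℝ 1 c.gₚ (Ioi 0)
  gₚ_elliptic : ∀ σ, 0 ≤ σ → ∀ ε, 0 < ε → ε < 1 →
    κ₀ * (ε ^ 2 + σ) ^ (p / 2 - 1) ≤
      c.gₚ (ε ^ 2 + σ) + 2 * σ * min 0 (deriv c.gₚ (ε ^ 2 + σ))
  gₚ_growth : ∀ σ, 0 < σ → c.gₚ σ + σ * |deriv c.gₚ σ| ≤ Γ₀ * σ ^ (p / 2 - 1)

/-- The flux `A(x, t, ζ, Z) = a₁ Z + aₚ gₚ(|ζ|_γ²) ζ`. The value of `gₚ` at `0` is irrelevant. -/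
def Coeffs.flux {n N : ℕ} (c : Coeffs n) (t : ℝ) (x : Pt n) (ζ Z : Mat N n) : Mat N n :=
  c.a₁ t x • Z + (c.aₚ t x * c.gₚ (gNorm (c.γ t x) ζ ^ 2)) • ζ

section solutions

variable {n N : ℕ} [Fact (2 ≤ n)] (p : ℝ) [Fact (1 < p)] (Ω : Set (Pt n))
  [IsBoundedLipschitzDomain Ω] (T : ℝ) (c : Coeffs n)

/-- `u` is a weak solution of the system with force `f`; here `Du` is the spatial gradient of `u`,
and `Z ∈ L^∞(Ω_T)` is the selection of subgradients for which the weak formulation holds. -/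
structure IsWeakSol (f u : ℝ → L2 N Ω) (Du Z : ℝ → Pt n → Mat N n) : Prop where
  force : MemForce p Ω T f
  Z_memLp : MemLp (Function.uncurry Z) ⊤ (cylMeas Ω T)
  Z_mem : ∀ᵐ z ∂(cylMeas Ω T), Z z.1 z.2 ∈ subdiff (c.γ z.1 z.2) (Du z.1 z.2)
  weak : ∃ u' : ℝ → V0' N p Ω, MemXC p Ω T u Du u' ∧
    ∀ Φ : ℝ → V0 N p Ω, MemLp Φ (ENNReal.ofReal p) (timeMeas T) →
      ∫ t, u' t (Φ t) ∂(timeMeas T)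
        + ∫ t, ∫ x, gInner (c.γ t x) (c.flux t x (Du t x) (Z t x)) ((Φ t).grad x)
            ∂(spaceMeas Ω) ∂(timeMeas T)
        = ∫ t, ∫ x, inner ℝ (f t x) ((Φ t).fn x) ∂(spaceMeas Ω) ∂(timeMeas T)

/-- `u ∈ v + X_0^p(0,T;Ω)ᴺ` is a weak solution of the Dirichlet problem with force `f` and
parabolic boundary datum `v`. -/
structure IsDirichletSol (f v u : ℝ → L2 N Ω) (Du Z : ℝ → Pt n → Mat N n) : Prop where
  sol : IsWeakSol p Ω T c f u Du Z
  lateral : MemX0 p Ω T (fun t => u t - v t)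
  initial : u 0 = v 0

end solutions

end OnePLaplace

end

noncomputable section

namespace OnePLaplace

/-! ### The form `⟨· | ·⟩_γ` and the structure of the flux -/

section algebra

variable {n N : ℕ} {γ : Matrix (Fin n) (Fin n) ℝ} {γ₀ : ℝ}

/-! Both estimates are energy estimates: the equation is tested on `(0, τ)` with the solution minus
its boundary datum. Put w = u − v; it is `V_0`-valued for a.e. time and vanishes at t = 0. Since ∂_t
w pairs with w to give half the increment of ‖w‖², the equation becomes

½‖w(τ)‖² + ∬⟨A(Du) | Du⟩ = ∬⟨A(Du) | Dv⟩ + ∫(f, w) − ∫⟨∂_t v, w⟩.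

The flux is coercive (`flux_coercive`): the singular part contributes a₁|Du|_γ ≥ 0 and the other
part is bounded below by a multiple of |Du|^p. It grows at most like 1 + |Du|^(p−1)
(`norm_flux_le`), because subgradients of the norm have length at most 1. Hölder and Young
(`energy_absorption`) put the right side into small multiples of ∬|Du|^p and sup‖w‖², plus data. If
p ≤ p_c, the `V_0`-norm of w also contains its L²-norm, which is controlled by the supremum in time.
This costs the square of the dual norm of ∂_t v, harmless since then p' ≥ 2.

For stability, the two equations are subtracted and tested with w = (u₁ − v₁) − (u₂ − v₂). The flux
is monotone (`flux_mono`): the subdifferential is, and so is g(|ζ|²)ζ, because s ↦ g(s²)s is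
nondecreasing. Hence the left side is a sum of nonnegative terms. Coercivity plays no role here; the
mixed terms are left as products of norms. For equal data everything on the right vanishes, which
gives uniqueness.

The analytic core is `energy_identity`, proved by symmetric difference quotients and continuity of
translations in L^P and L^Q rather than by mollification. It needs three links to the weak
formulation: `sub_eq_integral_of_weakDeriv` converts distributional time derivatives into
increments, `exists_V0_valued` identifies the gradient of w as Du − Dv by uniqueness of weak
gradients, and `weak_cutoff` restricts the equation to `(0, τ)`. -/

theorem gInner_add_left (ζ ξ η : Mat N n) :
    gInner γ (ζ + ξ) η = gInner γ ζ η + gInner γ ξ η := by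
  simp only [gInner, PiLp.add_apply, ← Finset.sum_add_distrib]
  refine Finset.sum_congr rfl fun _ _ => Finset.sum_congr rfl fun _ _ =>
    Finset.sum_congr rfl fun _ _ => by ring

theorem gInner_add_right (ζ ξ η : Mat N n) :
    gInner γ ζ (ξ + η) = gInner γ ζ ξ + gInner γ ζ η := by
  simp only [gInner, PiLp.add_apply, ← Finset.sum_add_distrib]
  refine Finset.sum_congr rfl fun _ _ => Finset.sum_congr rfl fun _ _ =>
    Finset.sum_congr rfl fun _ _ => by ring

theorem gInner_smul_left (c : ℝ) (ζ η : Mat N n) :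
    gInner γ (c • ζ) η = c * gInner γ ζ η := by
  simp only [gInner, PiLp.smul_apply, smul_eq_mul, Finset.mul_sum]
  refine Finset.sum_congr rfl fun _ _ => Finset.sum_congr rfl fun _ _ =>
    Finset.sum_congr rfl fun _ _ => by ring

theorem gInner_smul_right (c : ℝ) (ζ η : Mat N n) :
    gInner γ ζ (c • η) = c * gInner γ ζ η := by
  simp only [gInner, PiLp.smul_apply, smul_eq_mul, Finset.mul_sum]
  refine Finset.sum_congr rfl fun _ _ => Finset.sum_congr rfl fun _ _ =>
    Finset.sum_congr rfl fun _ _ => by ring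

theorem gInner_sub_left (ζ ξ η : Mat N n) :
    gInner γ (ζ - ξ) η = gInner γ ζ η - gInner γ ξ η := by
  have := gInner_add_left (γ := γ) (ζ - ξ) ξ η
  rw [sub_add_cancel] at this
  linarith

theorem gInner_sub_right (ζ ξ η : Mat N n) :
    gInner γ ζ (ξ - η) = gInner γ ζ ξ - gInner γ ζ η := by
  have := gInner_add_right (γ := γ) ζ (ξ - η) η
  rw [sub_add_cancel] at this
  linarith

theorem gInner_zero_right (ζ : Mat N n) : gInner γ ζ 0 = 0 := by simp [gInner]

theorem gInner_comm (hγ : γ.IsSymm) (ζ η : Mat N n) : gInner γ ζ η = gInner γ η ζ := by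
  simp only [gInner]
  refine Finset.sum_congr rfl fun j _ => ?_
  rw [Finset.sum_comm]
  refine Finset.sum_congr rfl fun α _ => Finset.sum_congr rfl fun β _ => ?_
  rw [← hγ.apply α β]
  ring

/-- Symmetric matrices with ellipticity constant `γ₀`. -/
structure IsElliptic (γ₀ : ℝ) (γ : Matrix (Fin n) (Fin n) ℝ) : Prop where
  symm : γ.IsSymm
  bounds : ∀ ζ : Pt n, γ₀ * ‖ζ‖ ^ 2 ≤ ∑ α, ∑ β, γ α β * ζ α * ζ β ∧
    ∑ α, ∑ β, γ α β * ζ α * ζ β ≤ γ₀⁻¹ * ‖ζ‖ ^ 2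

/-- Ellipticity is assumed for vectors in ℝⁿ; splitting into rows transfers it to N × n matrices
with the same constants. -/
theorem Mat.norm_sq_eq (ζ : Mat N n) :
    ‖ζ‖ ^ 2 = ∑ j, ‖(WithLp.toLp 2 fun α => ζ (j, α) : Pt n)‖ ^ 2 := by
  simp only [EuclideanSpace.norm_sq_eq, Fintype.sum_prod_type]

theorem IsElliptic.le_gInner (h : IsElliptic γ₀ γ) (ζ : Mat N n) :
    γ₀ * ‖ζ‖ ^ 2 ≤ gInner γ ζ ζ := by
  rw [Mat.norm_sq_eq, Finset.mul_sum]
  exact Finset.sum_le_sum fun j _ => (h.bounds (WithLp.toLp 2 fun α => ζ (j, α))).1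

theorem IsElliptic.gInner_le (h : IsElliptic γ₀ γ) (ζ : Mat N n) :
    gInner γ ζ ζ ≤ γ₀⁻¹ * ‖ζ‖ ^ 2 := by
  rw [Mat.norm_sq_eq, Finset.mul_sum]
  exact Finset.sum_le_sum fun j _ => (h.bounds (WithLp.toLp 2 fun α => ζ (j, α))).2

theorem gNorm_nonneg (ζ : Mat N n) : 0 ≤ gNorm γ ζ := Real.sqrt_nonneg _

theorem gNorm_zero : gNorm γ (0 : Mat N n) = 0 := by simp [gNorm, gInner]

theorem gNorm_smul (c : ℝ) (ζ : Mat N n) : gNorm γ (c • ζ) = |c| * gNorm γ ζ := by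
  rw [gNorm, gInner_smul_left, gInner_smul_right, ← mul_assoc, Real.sqrt_mul (mul_self_nonneg c),
    Real.sqrt_mul_self_eq_abs, gNorm]

/-- Testing the subgradient inequality with 0 and with 2ζ gives opposite bounds, by homogeneity of
degree one. -/
theorem gInner_subdiff_self {ζ Z : Mat N n} (hZ : Z ∈ subdiff γ ζ) :
    gInner γ Z ζ = gNorm γ ζ := by
  have h0 := hZ 0
  have h2 := hZ ((2 : ℝ) • ζ)
  rw [gInner_sub_right, gInner_zero_right, gNorm_zero] at h0
  rw [gInner_sub_right, gInner_smul_right, gNorm_smul, abs_two] at h2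
  linarith

/-- The two subgradient inequalities, each tested with the other's base point, are added. -/
theorem gInner_subdiff_mono {ζ₁ ζ₂ Z₁ Z₂ : Mat N n} (h₁ : Z₁ ∈ subdiff γ ζ₁)
    (h₂ : Z₂ ∈ subdiff γ ζ₂) : 0 ≤ gInner γ (Z₁ - Z₂) (ζ₁ - ζ₂) := by
  have a := h₁ ζ₂
  have b := h₂ ζ₁
  rw [gInner_sub_right] at a b
  rw [gInner_sub_left, gInner_sub_right, gInner_sub_right]
  linarith

theorem gInner_subdiff_le {ζ Z : Mat N n} (hZ : Z ∈ subdiff γ ζ) (ξ : Mat N n) :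
    gInner γ Z ξ ≤ gNorm γ ξ := by
  have h0 := hZ ξ
  rw [gInner_sub_right, gInner_subdiff_self hZ] at h0
  linarith

/-! ### Cauchy–Schwarz, comparison of norms and monotonicity of radial fields. -/

section elliptic

variable (hγ₀ : 0 < γ₀) (h : IsElliptic γ₀ γ)
include hγ₀ h

theorem IsElliptic.gInner_self_nonneg (ζ : Mat N n) : 0 ≤ gInner γ ζ ζ :=
  (by positivity : 0 ≤ γ₀ * ‖ζ‖ ^ 2).trans (h.le_gInner ζ)

theorem IsElliptic.gNorm_sq (ζ : Mat N n) : gNorm γ ζ ^ 2 = gInner γ ζ ζ :=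
  Real.sq_sqrt (h.gInner_self_nonneg hγ₀ ζ)

/-- The quadratic polynomial t ↦ ⟨ζ + tη | ζ + tη⟩_γ is nonnegative, so its discriminant is at most
0. -/
theorem IsElliptic.gInner_sq_le (ζ η : Mat N n) :
    gInner γ ζ η ^ 2 ≤ gInner γ ζ ζ * gInner γ η η := by
  have key : ∀ t : ℝ, 0 ≤ gInner γ η η * (t * t) + 2 * gInner γ ζ η * t + gInner γ ζ ζ := by
    intro t
    have := h.gInner_self_nonneg hγ₀ (ζ + t • η)
    rw [gInner_add_left, gInner_add_right, gInner_add_right, gInner_smul_left, gInner_smul_left,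
      gInner_smul_right, gInner_smul_right, gInner_comm h.symm η ζ] at this
    linarith
  have := discrim_le_zero key
  rw [discrim] at this
  nlinarith

theorem IsElliptic.abs_gInner_le (ζ η : Mat N n) :
    |gInner γ ζ η| ≤ gNorm γ ζ * gNorm γ η := by
  rw [gNorm, gNorm, ← Real.sqrt_mul (h.gInner_self_nonneg hγ₀ ζ)]
  exact Real.abs_le_sqrt (h.gInner_sq_le hγ₀ ζ η)

theorem IsElliptic.gNorm_le (ζ : Mat N n) : gNorm γ ζ ≤ √γ₀⁻¹ * ‖ζ‖ := by
  rw [gNorm, ← Real.sqrt_sq (norm_nonneg ζ), ← Real.sqrt_mul (by positivity)]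
  exact Real.sqrt_le_sqrt (h.gInner_le ζ)

theorem IsElliptic.norm_le (ζ : Mat N n) : √γ₀ * ‖ζ‖ ≤ gNorm γ ζ := by
  rw [gNorm, ← Real.sqrt_sq (norm_nonneg ζ), ← Real.sqrt_mul hγ₀.le]
  exact Real.sqrt_le_sqrt (h.le_gInner ζ)

theorem IsElliptic.abs_gInner_le_norm (ζ η : Mat N n) :
    |gInner γ ζ η| ≤ γ₀⁻¹ * (‖ζ‖ * ‖η‖) := by
  refine (h.abs_gInner_le hγ₀ ζ η).trans ?_
  refine (mul_le_mul (h.gNorm_le hγ₀ ζ) (h.gNorm_le hγ₀ η) (gNorm_nonneg _)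
    (by positivity)).trans_eq ?_
  calc _ = (√γ₀⁻¹ * √γ₀⁻¹) * (‖ζ‖ * ‖η‖) := by ring
    _ = _ := by rw [Real.mul_self_sqrt (by positivity)]

/-- Testing with ξ = Z gives |Z|_γ² ≤ |Z|_γ. -/
theorem IsElliptic.gNorm_subdiff_le {ζ Z : Mat N n} (hZ : Z ∈ subdiff γ ζ) : gNorm γ Z ≤ 1 := by
  have := gInner_subdiff_le hZ Z
  rw [← h.gNorm_sq hγ₀] at this
  nlinarith [gNorm_nonneg (γ := γ) Z]

/-- The field `g(|ζ|²) ζ` is monotone if `s ↦ g(s²) s` is. -/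
theorem IsElliptic.gInner_radial_mono {g : ℝ → ℝ} (hpos : ∀ s, 0 < s → 0 < g s)
    (hmono : ∀ s t, 0 < s → s ≤ t → g (s ^ 2) * s ≤ g (t ^ 2) * t) (ζ₁ ζ₂ : Mat N n) :
    0 ≤ gInner γ (g (gNorm γ ζ₁ ^ 2) • ζ₁ - g (gNorm γ ζ₂ ^ 2) • ζ₂) (ζ₁ - ζ₂) := by
  have zero_of : ∀ ζ : Mat N n, gNorm γ ζ = 0 → ζ = 0 := by
    intro ζ hζ
    have := h.norm_le hγ₀ ζ
    rw [hζ] at this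
    have h3 : ‖ζ‖ ≤ 0 := by
      by_contra hc
      have := mul_pos (Real.sqrt_pos.2 hγ₀) (not_le.1 hc)
      linarith
    exact norm_le_zero_iff.1 h3
  have self_nonneg : ∀ ζ : Mat N n, 0 ≤ gInner γ (g (gNorm γ ζ ^ 2) • ζ) ζ := by
    intro ζ
    rw [gInner_smul_left]
    rcases (gNorm_nonneg (γ := γ) ζ).eq_or_lt with h0 | h0
    · rw [zero_of ζ h0.symm, gInner_zero_right, mul_zero]
    · exact mul_nonneg (hpos _ (by positivity)).le (h.gInner_self_nonneg hγ₀ ζ)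
  -- Zero arguments are treated apart: nothing is known about g at 0, but there the field vanishes
  -- anyway.
  rcases (gNorm_nonneg (γ := γ) ζ₁).eq_or_lt with h1 | h1
  · rw [zero_of ζ₁ h1.symm]
    have := self_nonneg ζ₂
    simp only [smul_zero, zero_sub]
    rw [← neg_one_smul ℝ ζ₂, ← neg_one_smul ℝ (g (gNorm γ ζ₂ ^ 2) • ζ₂), gInner_smul_left,
      gInner_smul_right]
    linarith
  rcases (gNorm_nonneg (γ := γ) ζ₂).eq_or_lt with h2 | h2
  · rw [zero_of ζ₂ h2.symm]
    simpa using self_nonneg ζ₁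
  have cs := (le_abs_self _).trans (h.abs_gInner_le hγ₀ ζ₁ ζ₂)
  have g1 := hpos _ (pow_pos h1 2)
  have g2 := hpos _ (pow_pos h2 2)
  rw [gInner_sub_left, gInner_sub_right, gInner_sub_right, gInner_smul_left, gInner_smul_left,
    gInner_smul_left, gInner_smul_left, gInner_comm h.symm ζ₂ ζ₁, ← h.gNorm_sq hγ₀,
    ← h.gNorm_sq hγ₀]
  obtain ⟨a, ha⟩ : ∃ a, a = gNorm γ ζ₁ := ⟨_, rfl⟩
  obtain ⟨b, hb⟩ : ∃ b, b = gNorm γ ζ₂ := ⟨_, rfl⟩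
  rw [← ha] at h1 cs g1 ⊢
  rw [← hb] at h2 cs g2 ⊢
  -- With a = |ζ₁|_γ and b = |ζ₂|_γ, Cauchy–Schwarz bounds the form from below by g(a²)a² + g(b²)b²
  -- − (g(a²) + g(b²))ab, which factors into this product.
  have key : 0 ≤ (g (a ^ 2) * a - g (b ^ 2) * b) * (a - b) := by
    rcases le_total a b with hab | hab
    · exact mul_nonneg_of_nonpos_of_nonpos (by linarith [hmono a b h1 hab]) (by linarith)
    · exact mul_nonneg (by linarith [hmono b a h2 hab]) (by linarith)
  have := mul_le_mul_of_nonneg_left cs (add_pos g1 g2).le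
  linarith

end elliptic

end algebra

/-! ### Consequences of the structure conditions -/

section structureConditions

variable {n N : ℕ} {c : Coeffs n} {p : ℝ} {Ω : Set (Pt n)} {T γ₀ κ₀ Γ₀ : ℝ}

theorem Coeffs.Admissible.isElliptic (hc : c.Admissible p Ω T γ₀ κ₀ Γ₀) {t : ℝ}
    (ht : t ∈ Ioo 0 T) {x : Pt n} (hx : x ∈ Ω) : IsElliptic γ₀ (c.γ t x) :=
  ⟨hc.γ_symm t ht x hx, hc.γ_elliptic t ht x hx⟩

/-- The ellipticity condition is used at σ = s − ε² with ε² ≤ s; its extra term is nonpositive and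
can be dropped. -/
theorem Coeffs.Admissible.le_gp (hc : c.Admissible p Ω T γ₀ κ₀ Γ₀) {s : ℝ} (hs : 0 < s) :
    κ₀ * s ^ (p / 2 - 1) ≤ c.gₚ s := by
  obtain ⟨ε, hε0, hε1, hεs⟩ : ∃ ε : ℝ, 0 < ε ∧ ε < 1 ∧ ε ^ 2 ≤ s := by
    refine ⟨min (1 / 2) √s, lt_min (by norm_num) (Real.sqrt_pos.2 hs),
      (min_le_left _ _).trans_lt (by norm_num), ?_⟩
    calc (min (1 / 2) √s) ^ 2 ≤ √s ^ 2 := by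
          gcongr
          exact min_le_right _ _
      _ = s := Real.sq_sqrt hs.le
  have := hc.gₚ_elliptic (s - ε ^ 2) (by linarith) ε hε0 hε1
  rw [add_sub_cancel] at this
  have h2 : 2 * (s - ε ^ 2) * min 0 (deriv c.gₚ s) ≤ 0 :=
    mul_nonpos_of_nonneg_of_nonpos (by linarith) (min_le_left _ _)
  linarith

/-- The ellipticity condition at σ = s − ε² carries the weight s − ε² instead of s in front of the
derivative. The discrepancy is 2ε²|g'(s)|, which a small ε makes too small to allow a negative
value. -/
theorem Coeffs.Admissible.gp_add_deriv_nonneg (hκ₀ : 0 < κ₀)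
    (hc : c.Admissible p Ω T γ₀ κ₀ Γ₀) {s : ℝ} (hs : 0 < s) :
    0 ≤ c.gₚ s + 2 * s * deriv c.gₚ s := by
  by_contra! hneg
  have hg := hc.gₚ_pos s hs
  have hd : deriv c.gₚ s < 0 := by
    by_contra! h0
    have : 0 ≤ 2 * s * deriv c.gₚ s := by positivity
    linarith
  obtain ⟨ε, hε0, hε1, hεs, hε⟩ : ∃ ε : ℝ, 0 < ε ∧ ε < 1 ∧ ε ^ 2 ≤ s ∧
      c.gₚ s + 2 * s * deriv c.gₚ s - 2 * ε ^ 2 * deriv c.gₚ s ≤ 0 := by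
    -- This d is the value of ε² at which g(s) + 2(s − ε²)g'(s) is zero; any smaller ε² keeps the
    -- expression nonpositive.
    obtain ⟨d, hd'⟩ : ∃ d, d = - (c.gₚ s + 2 * s * deriv c.gₚ s) / (2 * (-deriv c.gₚ s)) :=
      ⟨_, rfl⟩
    have hdpos : 0 < d := by
      rw [hd']
      exact div_pos (by linarith) (by linarith)
    have hdeq : d * (2 * (-deriv c.gₚ s)) = - (c.gₚ s + 2 * s * deriv c.gₚ s) := by
      rw [hd']
      exact div_mul_cancel₀ _ (by linarith)
    obtain ⟨m, hm⟩ : ∃ m, m = min (1 / 4) (min s d) := ⟨_, rfl⟩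
    have hm0 : 0 < m := by
      rw [hm]
      exact lt_min (by norm_num) (lt_min hs hdpos)
    have hm1 : m ≤ 1 / 4 := hm ▸ min_le_left _ _
    have hm2 : m ≤ s := hm ▸ (min_le_right _ _).trans (min_le_left _ _)
    have hm3 : m ≤ d := hm ▸ (min_le_right _ _).trans (min_le_right _ _)
    refine ⟨√m, Real.sqrt_pos.2 hm0, ?_, ?_, ?_⟩
    · rw [Real.sqrt_lt' one_pos]
      linarith
    · rwa [Real.sq_sqrt hm0.le]
    · rw [Real.sq_sqrt hm0.le]
      nlinarith
  have := hc.gₚ_elliptic (s - ε ^ 2) (by linarith) ε hε0 hε1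
  rw [add_sub_cancel, min_eq_right hd.le] at this
  have h3 : 0 < κ₀ * s ^ (p / 2 - 1) := by positivity
  linarith

/-- The derivative of r ↦ g(r²)r is g(σ) + 2σg'(σ) at σ = r², which `gp_add_deriv_nonneg` controls.
-/
theorem Coeffs.Admissible.gp_radial_mono (hκ₀ : 0 < κ₀) (hc : c.Admissible p Ω T γ₀ κ₀ Γ₀)
    (s t : ℝ) (hs : 0 < s) (hst : s ≤ t) : c.gₚ (s ^ 2) * s ≤ c.gₚ (t ^ 2) * t := by
  have hder : ∀ r : ℝ, 0 < r → HasDerivAt (fun r => c.gₚ (r ^ 2) * r)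
      (c.gₚ (r ^ 2) + 2 * r ^ 2 * deriv c.gₚ (r ^ 2)) r := by
    intro r hr
    have h1 : DifferentiableAt ℝ c.gₚ (r ^ 2) :=
      ((hc.gₚ_contDiff.differentiableOn one_ne_zero).differentiableAt
        (Ioi_mem_nhds (by positivity)))
    have h2 : HasDerivAt (fun r : ℝ => r ^ 2) (2 * r) r := by
      simpa using hasDerivAt_pow 2 r
    have h3 := (HasDerivAt.comp (h₂ := c.gₚ) (h := fun r : ℝ => r ^ 2) r h1.hasDerivAt h2).mul
      (hasDerivAt_id r)
    refine h3.congr_deriv ?_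
    simp
    ring
  have hmono : MonotoneOn (fun r => c.gₚ (r ^ 2) * r) (Ioi 0) := by
    refine monotoneOn_of_deriv_nonneg (convex_Ioi 0)
      (fun r hr => (hder r hr).continuousAt.continuousWithinAt)
      (fun r hr => ?_) (fun r hr => ?_)
    · rw [interior_Ioi] at hr
      exact (hder r hr).differentiableAt.differentiableWithinAt
    · rw [interior_Ioi] at hr
      rw [(hder r hr).deriv]
      exact hc.gp_add_deriv_nonneg hκ₀ (pow_pos hr 2)
  exact hmono hs (hs.trans_le hst) hst

theorem Coeffs.Admissible.gp_le (hc : c.Admissible p Ω T γ₀ κ₀ Γ₀) {s : ℝ} (hs : 0 < s) :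
    c.gₚ s ≤ Γ₀ * s ^ (p / 2 - 1) := by
  have := hc.gₚ_growth s hs
  have h2 : 0 ≤ s * |deriv c.gₚ s| := by positivity
  linarith

theorem sq_rpow_half_sub_one {s : ℝ} (hs : 0 < s) (p : ℝ) : (s ^ 2) ^ (p / 2 - 1) = s ^ (p - 2) := by
  rw [← Real.rpow_natCast s 2, ← Real.rpow_mul hs.le]
  congr 1
  push_cast
  ring

/-- The bounds at a point which hold almost everywhere. -/
structure Coeffs.PointBounds (c : Coeffs n) (γ₀ Γ₀ : ℝ) (t : ℝ) (x : Pt n) : Prop where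
  elliptic : IsElliptic γ₀ (c.γ t x)
  a₁_nonneg : 0 ≤ c.a₁ t x
  le_aₚ : Γ₀⁻¹ ≤ c.aₚ t x
  add_le : c.a₁ t x + c.aₚ t x ≤ Γ₀

variable {t : ℝ} {x : Pt n}

/-- The flux is a combination with nonnegative coefficients of two monotone fields: the
subdifferential and the radial field. -/
theorem Coeffs.PointBounds.flux_mono (hκ₀ : 0 < κ₀) (hγ₀ : 0 < γ₀) (hΓ₀ : 1 < Γ₀)
    (hc : c.Admissible p Ω T γ₀ κ₀ Γ₀) (hb : c.PointBounds γ₀ Γ₀ t x) {ζ₁ ζ₂ Z₁ Z₂ : Mat N n}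
    (h₁ : Z₁ ∈ subdiff (c.γ t x) ζ₁) (h₂ : Z₂ ∈ subdiff (c.γ t x) ζ₂) :
    0 ≤ gInner (c.γ t x) (c.flux t x ζ₁ Z₁ - c.flux t x ζ₂ Z₂) (ζ₁ - ζ₂) := by
  have e : c.flux t x ζ₁ Z₁ - c.flux t x ζ₂ Z₂ = c.a₁ t x • (Z₁ - Z₂)
      + c.aₚ t x • (c.gₚ (gNorm (c.γ t x) ζ₁ ^ 2) • ζ₁ - c.gₚ (gNorm (c.γ t x) ζ₂ ^ 2) • ζ₂) := by
    simp only [Coeffs.flux, smul_sub, smul_smul]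
    abel
  have hp : 0 ≤ c.aₚ t x := (inv_nonneg.2 (by linarith)).trans hb.le_aₚ
  rw [e, gInner_add_left, gInner_smul_left, gInner_smul_left]
  exact add_nonneg (mul_nonneg hb.a₁_nonneg (gInner_subdiff_mono h₁ h₂))
    (mul_nonneg hp (hb.elliptic.gInner_radial_mono hγ₀ hc.gₚ_pos
      (hc.gp_radial_mono hκ₀) ζ₁ ζ₂))

/-- The subgradient part gives a₁|ζ|_γ ≥ 0 and is discarded; the lower bound comes from the p-growth
part alone. -/
theorem Coeffs.PointBounds.flux_coercive (hp : 1 < p) (hκ₀ : 0 < κ₀) (hγ₀ : 0 < γ₀)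
    (hΓ₀ : 1 < Γ₀)
    (hc : c.Admissible p Ω T γ₀ κ₀ Γ₀) (hb : c.PointBounds γ₀ Γ₀ t x) {ζ Z : Mat N n}
    (hZ : Z ∈ subdiff (c.γ t x) ζ) :
    Γ₀⁻¹ * κ₀ * (√γ₀) ^ p * ‖ζ‖ ^ p ≤ gInner (c.γ t x) (c.flux t x ζ Z) ζ := by
  rw [Coeffs.flux, gInner_add_left, gInner_smul_left, gInner_smul_left,
    gInner_subdiff_self hZ, ← hb.elliptic.gNorm_sq hγ₀]
  have h1 : 0 ≤ c.a₁ t x * gNorm (c.γ t x) ζ := mul_nonneg hb.a₁_nonneg (gNorm_nonneg _)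
  have hG : 0 < Γ₀⁻¹ := inv_pos.2 (by linarith)
  have h3 := hb.elliptic.norm_le hγ₀ ζ
  rcases (gNorm_nonneg (γ := c.γ t x) ζ).eq_or_lt with h0 | h0
  · rw [← h0] at h3 ⊢
    have h4 : ‖ζ‖ = 0 := by
      by_contra hne
      have := mul_pos (Real.sqrt_pos.2 hγ₀) ((norm_nonneg ζ).lt_of_ne' hne)
      linarith
    rw [h4, Real.zero_rpow (by linarith)]
    simp
  · have h4 := hc.le_gp (pow_pos h0 2)
    rw [sq_rpow_half_sub_one h0] at h4
    have e : gNorm (c.γ t x) ζ ^ (p - 2) * gNorm (c.γ t x) ζ ^ 2 = gNorm (c.γ t x) ζ ^ p := by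
      rw [← Real.rpow_natCast _ 2, ← Real.rpow_add h0]
      congr 1
      push_cast
      ring
    calc Γ₀⁻¹ * κ₀ * (√γ₀) ^ p * ‖ζ‖ ^ p = Γ₀⁻¹ * κ₀ * (√γ₀ * ‖ζ‖) ^ p := by
          rw [Real.mul_rpow (Real.sqrt_nonneg _) (norm_nonneg _)]
          ring
      _ ≤ Γ₀⁻¹ * κ₀ * gNorm (c.γ t x) ζ ^ p := by gcongr
      _ = Γ₀⁻¹ * (κ₀ * gNorm (c.γ t x) ζ ^ (p - 2)) * gNorm (c.γ t x) ζ ^ 2 := by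
          rw [← e]; ring
      _ ≤ c.aₚ t x * c.gₚ (gNorm (c.γ t x) ζ ^ 2) * gNorm (c.γ t x) ζ ^ 2 := by
          gcongr
          · exact hG.le.trans hb.le_aₚ
          · exact hb.le_aₚ
      _ ≤ _ := by linarith

theorem Coeffs.PointBounds.norm_flux_le (hp : 1 < p) (hγ₀ : 0 < γ₀) (hΓ₀ : 1 < Γ₀)
    (hc : c.Admissible p Ω T γ₀ κ₀ Γ₀) (hb : c.PointBounds γ₀ Γ₀ t x) {ζ Z : Mat N n}
    (hZ : Z ∈ subdiff (c.γ t x) ζ) :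
    √γ₀ * ‖c.flux t x ζ Z‖ ≤ Γ₀ + Γ₀ * (Γ₀ * ((√γ₀⁻¹) ^ (p - 1) * ‖ζ‖ ^ (p - 1))) := by
  have hZ1 : √γ₀ * ‖Z‖ ≤ 1 := (hb.elliptic.norm_le hγ₀ Z).trans
    (hb.elliptic.gNorm_subdiff_le hγ₀ hZ)
  have hG : 0 < Γ₀⁻¹ := inv_pos.2 (by linarith)
  have hap : 0 ≤ c.aₚ t x := hG.le.trans hb.le_aₚ
  have ha1 : c.a₁ t x ≤ Γ₀ := by linarith [hb.add_le]
  have hap' : c.aₚ t x ≤ Γ₀ := by linarith [hb.add_le, hb.a₁_nonneg]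
  have h1 : ‖c.a₁ t x • Z‖ = c.a₁ t x * ‖Z‖ := by
    rw [norm_smul, Real.norm_of_nonneg hb.a₁_nonneg]
  have h2 : √γ₀ * ‖(c.aₚ t x * c.gₚ (gNorm (c.γ t x) ζ ^ 2)) • ζ‖
      ≤ Γ₀ * (Γ₀ * ((√γ₀⁻¹) ^ (p - 1) * ‖ζ‖ ^ (p - 1))) := by
    rcases (gNorm_nonneg (γ := c.γ t x) ζ).eq_or_lt with h0 | h0
    · have h3 := hb.elliptic.norm_le hγ₀ ζ
      rw [← h0] at h3
      rw [norm_smul]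
      calc √γ₀ * (‖c.aₚ t x * c.gₚ (gNorm (c.γ t x) ζ ^ 2)‖ * ‖ζ‖)
          = ‖c.aₚ t x * c.gₚ (gNorm (c.γ t x) ζ ^ 2)‖ * (√γ₀ * ‖ζ‖) := by ring
        _ ≤ 0 := mul_nonpos_of_nonneg_of_nonpos (norm_nonneg _) h3
        _ ≤ _ := by positivity
    · have hg := hc.gp_le (pow_pos h0 2)
      rw [sq_rpow_half_sub_one h0] at hg
      have hgp := hc.gₚ_pos _ (pow_pos h0 2)
      rw [norm_smul, Real.norm_of_nonneg (mul_nonneg hap hgp.le)]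
      calc √γ₀ * (c.aₚ t x * c.gₚ (gNorm (c.γ t x) ζ ^ 2) * ‖ζ‖)
          = c.aₚ t x * c.gₚ (gNorm (c.γ t x) ζ ^ 2) * (√γ₀ * ‖ζ‖) := by ring
        _ ≤ Γ₀ * (Γ₀ * gNorm (c.γ t x) ζ ^ (p - 2)) * gNorm (c.γ t x) ζ := by
            gcongr
            exact hb.elliptic.norm_le hγ₀ ζ
        -- The powers are merged before passing to the Euclidean norm: p − 2 may be negative,
        -- whereas x ↦ x^(p−1) is increasing.
        _ = Γ₀ * (Γ₀ * gNorm (c.γ t x) ζ ^ (p - 1)) := by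
            have : gNorm (c.γ t x) ζ ^ (p - 2) * gNorm (c.γ t x) ζ
                = gNorm (c.γ t x) ζ ^ (p - 1) := by
              rw [← Real.rpow_add_one h0.ne']
              congr 1
              ring
            rw [← this]
            ring
        _ ≤ Γ₀ * (Γ₀ * (√γ₀⁻¹ * ‖ζ‖) ^ (p - 1)) := by
            have := hb.elliptic.gNorm_le hγ₀ ζ
            have hp1 : 0 ≤ p - 1 := by linarith
            gcongr
        _ = _ := by rw [Real.mul_rpow (Real.sqrt_nonneg _) (norm_nonneg _)]
  rw [Coeffs.flux]
  calc √γ₀ * ‖c.a₁ t x • Z + (c.aₚ t x * c.gₚ (gNorm (c.γ t x) ζ ^ 2)) • ζ‖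
      ≤ √γ₀ * (‖c.a₁ t x • Z‖ + ‖(c.aₚ t x * c.gₚ (gNorm (c.γ t x) ζ ^ 2)) • ζ‖) := by
        gcongr
        exact norm_add_le _ _
    _ = c.a₁ t x * (√γ₀ * ‖Z‖)
        + √γ₀ * ‖(c.aₚ t x * c.gₚ (gNorm (c.γ t x) ζ ^ 2)) • ζ‖ := by rw [h1]; ring
    _ ≤ Γ₀ * 1 + Γ₀ * (Γ₀ * ((√γ₀⁻¹) ^ (p - 1) * ‖ζ‖ ^ (p - 1))) := by
        gcongr
    _ = _ := by ring

end structureConditions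

/-! ### The energy identity for functions with a time derivative in the dual space -/

section energyIdentity

open Filter Topology

variable {E : Type*} [NormedAddCommGroup E] [NormedSpace ℝ E] {P Q : ℝ≥0∞}

theorem integrable_dual_apply [ENNReal.HolderConjugate Q P] {X : Type*} [MeasurableSpace X]
    {μ : Measure X} {F : X → StrongDual ℝ E} {f : X → E} (hF : MemLp F Q μ) (hf : MemLp f P μ) :
    Integrable (fun x => F x (f x)) μ :=
  memLp_one_iff_integrable.1
    ((ContinuousLinearMap.id ℝ (StrongDual ℝ E)).memLp_of_bilin 1 hF hf)

theorem memLp_translate {F : Type*} [NormedAddCommGroup F] {f : ℝ → F} (hf : MemLp f P volume)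
    (s : ℝ) : MemLp (fun t => f (s + t)) P volume :=
  hf.comp_measurePreserving (measurePreserving_add_left volume s)

/-- The pairing of translates of a function in `L^Q` and a function in `L^P` is continuous. -/
theorem continuous_translate_pairing [Fact (1 ≤ P)] [Fact (1 ≤ Q)] [ENNReal.HolderConjugate Q P]
    [Fact (P ≠ ⊤)] [Fact (Q ≠ ⊤)] {F : ℝ → StrongDual ℝ E}
    {f : ℝ → E} (hF : MemLp F Q volume) (hf : MemLp f P volume) (s : Set ℝ) :
    Continuous fun z : ℝ × ℝ => ∫ t in s, F (z.1 + t) (f (z.2 + t) + f t) := by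
  -- The integral is a bounded bilinear pairing of L^Q and L^P evaluated at translates, and
  -- translation acts continuously on L^P and L^Q because both exponents are finite.
  have e : (fun z : ℝ × ℝ => ∫ t in s, F (z.1 + t) (f (z.2 + t) + f t))
      = fun z : ℝ × ℝ => (ContinuousLinearMap.id ℝ (StrongDual ℝ E)).lpPairing
        (volume.restrict s) Q P
        (LpToLpRestrictCLM ℝ _ ℝ volume Q s (DomAddAct.mk z.1 +ᵥ hF.toLp F))
        (LpToLpRestrictCLM ℝ _ ℝ volume P s ((DomAddAct.mk z.2 +ᵥ hf.toLp f) + hf.toLp f)) := by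
    ext z
    rw [ContinuousLinearMap.lpPairing_eq_integral, DomAddAct.mk_vadd_toLp,
      DomAddAct.mk_vadd_toLp, ← MemLp.toLp_add]
    refine integral_congr_ae ?_
    filter_upwards [LpToLpRestrictCLM_coeFn ℝ s ((memLp_translate hF z.1).toLp _),
      LpToLpRestrictCLM_coeFn ℝ s (((memLp_translate hf z.2).add hf).toLp _),
      ae_restrict_of_ae ((memLp_translate hF z.1).coeFn_toLp),
      ae_restrict_of_ae (((memLp_translate hf z.2).add hf).coeFn_toLp)] with t h1 h2 h3 h4
    exact (congrArg₂ (fun (a : StrongDual ℝ E) (b : E) => a b) (h1.trans h3) (h2.trans h4)).symm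
  rw [e]
  have c1 : Continuous fun z : ℝ × ℝ =>
      LpToLpRestrictCLM ℝ _ ℝ volume Q s (DomAddAct.mk z.1 +ᵥ hF.toLp F) := by
    refine (LpToLpRestrictCLM ℝ _ ℝ volume Q s).continuous.comp ?_
    exact (DomAddAct.continuous_mk.comp continuous_fst).vadd continuous_const
  have c2 : Continuous fun z : ℝ × ℝ =>
      LpToLpRestrictCLM ℝ _ ℝ volume P s ((DomAddAct.mk z.2 +ᵥ hf.toLp f) + hf.toLp f) := by
    refine (LpToLpRestrictCLM ℝ _ ℝ volume P s).continuous.comp ?_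
    exact ((DomAddAct.continuous_mk.comp continuous_snd).vadd continuous_const).add
      continuous_const
  exact (((ContinuousLinearMap.id ℝ (StrongDual ℝ E)).lpPairing
        (volume.restrict s) Q P).continuous.comp c1).clm_apply c2

/-- Averages over shrinking intervals converge to the value at the end point. -/
theorem tendsto_average_right {G : ℝ × ℝ → ℝ} (hG : Continuous G) :
    Tendsto (fun h : ℝ => h⁻¹ * ∫ θ in (0 : ℝ)..h, G (θ, h)) (𝓝[>] 0) (𝓝 (G (0, 0))) := by
  rw [Metric.tendsto_nhdsWithin_nhds]
  intro ε hε
  obtain ⟨δ, hδ, hd⟩ := Metric.continuousAt_iff.1 (hG.continuousAt (x := (0, 0))) (ε / 2)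
    (half_pos hε)
  refine ⟨δ, hδ, fun {h} hh0 hhδ => ?_⟩
  have hh : 0 < h := hh0
  have hc : Continuous fun θ : ℝ => G (θ, h) := hG.comp (by fun_prop)
  have e : h⁻¹ * (∫ θ in (0 : ℝ)..h, G (θ, h)) - G (0, 0)
      = h⁻¹ * ∫ θ in (0 : ℝ)..h, (G (θ, h) - G (0, 0)) := by
    rw [intervalIntegral.integral_sub (hc.intervalIntegrable _ _) (by simp)]
    simp
    field_simp
  have hb : ‖∫ θ in (0 : ℝ)..h, (G (θ, h) - G (0, 0))‖ ≤ ε / 2 * |h - 0| := by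
    refine intervalIntegral.norm_integral_le_of_norm_le_const fun θ hθ => ?_
    rw [uIoc_of_le hh.le] at hθ
    rw [← dist_eq_norm]
    refine (hd ?_).le
    rw [dist_zero_right, Real.norm_of_nonneg hh.le] at hhδ
    rw [Prod.dist_eq]
    refine max_lt ?_ ?_
    · simp only [dist_zero_right]
      rw [Real.norm_of_nonneg hθ.1.le]
      exact hθ.2.trans_lt hhδ
    · simp only [dist_zero_right]
      rwa [Real.norm_of_nonneg hh.le]
  rw [dist_eq_norm, e, norm_mul, norm_inv, Real.norm_of_nonneg hh.le]
  rw [sub_zero, abs_of_pos hh] at hb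
  calc h⁻¹ * ‖∫ θ in (0 : ℝ)..h, (G (θ, h) - G (0, 0))‖ ≤ h⁻¹ * (ε / 2 * h) := by gcongr
    _ = ε / 2 := by field_simp
    _ < ε := half_lt_self hε

theorem integrableOn_dual_apply_const [Fact (1 ≤ Q)] {F : ℝ → StrongDual ℝ E}
    (hF : MemLp F Q volume) (e : E) (a b : ℝ) : IntervalIntegrable (fun t => F t e) volume a b := by
  have h1 : LocallyIntegrable F volume := hF.locallyIntegrable Fact.out
  have h2 : IntervalIntegrable F volume a b :=
    (h1.integrableOn_isCompact isCompact_uIcc).intervalIntegrable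
  exact ⟨(ContinuousLinearMap.apply ℝ ℝ e).integrable_comp h2.1,
    (ContinuousLinearMap.apply ℝ ℝ e).integrable_comp h2.2⟩

variable {H : Type*} [NormedAddCommGroup H] [InnerProductSpace ℝ H]

/-- The symmetric quotient ‖w(t+h)‖² − ‖w(t)‖² = ⟨w(t+h) − w(t), w(t+h) + w(t)⟩ equals the integral
of F(θ+t)(f(h+t) + f(t)) over θ in (0, h). It is integrated over t in (a, b), the order of
integration is exchanged, and h⁻¹ times the result has the limit claimed. The relation `hrel` is
needed only for the test elements f(r) attached to w(r), so no embedding of E into H enters. -/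
theorem energy_identity_interior [Fact (1 ≤ P)] [Fact (1 ≤ Q)] [ENNReal.HolderConjugate Q P]
    [Fact (P ≠ ⊤)] [Fact (Q ≠ ⊤)] {F : ℝ → StrongDual ℝ E} {f : ℝ → E} {w : ℝ → H} {T : ℝ}
    (hFm : StronglyMeasurable F) (hfm : StronglyMeasurable f)
    (hF : MemLp F Q volume) (hf : MemLp f P volume) (hw : Continuous w)
    (hrel : ∀ᵐ r, r ∈ Ioo 0 T → ∀ s ∈ Icc 0 T, ∀ t ∈ Icc 0 T, s ≤ t →
      inner ℝ (w t - w s) (w r) = ∫ σ in s..t, F σ (f r))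
    {a b : ℝ} (ha : 0 < a) (hab : a ≤ b) (hb : b < T) :
    ‖w b‖ ^ 2 - ‖w a‖ ^ 2 = 2 * ∫ t in a..b, F t (f t) := by
  obtain ⟨q, hq⟩ : ∃ q : ℝ → ℝ, q = fun t => ‖w t‖ ^ 2 := ⟨_, rfl⟩
  have hqc : Continuous q := by rw [hq]; fun_prop
  -- difference quotients
  have key : ∀ h : ℝ, 0 < h → h < T - b →
      (∫ θ in (0 : ℝ)..h, q (b + θ)) - (∫ θ in (0 : ℝ)..h, q (a + θ))
        = ∫ θ in (0 : ℝ)..h, ∫ t in Ioc a b, F (θ + t) (f (h + t) + f t) := by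
    intro h hh hhT
    have e1 : (∫ θ in (0 : ℝ)..h, q (b + θ)) - (∫ θ in (0 : ℝ)..h, q (a + θ))
        = ∫ t in Ioc a b, (q (h + t) - q t) := by
      have i := fun x y => hqc.intervalIntegrable (μ := volume) x y
      have ih : IntervalIntegrable (fun t => q (h + t)) volume a b :=
        (hqc.comp (continuous_const_add h)).intervalIntegrable _ _
      rw [← intervalIntegral.integral_of_le hab, intervalIntegral.integral_sub ih (i _ _),
        intervalIntegral.integral_comp_add_left, intervalIntegral.integral_comp_add_left,
        intervalIntegral.integral_comp_add_left, add_zero, add_zero, add_comm h b, add_comm h a]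
      have h1 := intervalIntegral.integral_add_adjacent_intervals (i a b) (i b (b + h))
      have h2 := intervalIntegral.integral_add_adjacent_intervals (i a (a + h)) (i (a + h) (b + h))
      linarith
    have e2 : ∫ t in Ioc a b, (q (h + t) - q t)
        = ∫ t in Ioc a b, ∫ θ in Ioc 0 h, F (θ + t) (f (h + t) + f t) := by
      refine integral_congr_ae ?_
      -- The increment formula is needed at r = t and at r = h + t; translation preserves null sets,
      -- so both hold for a.e. t.
      have hsh := (measurePreserving_add_left (volume : Measure ℝ) h).quasiMeasurePreserving.ae hrel
      filter_upwards [ae_restrict_of_ae hrel, ae_restrict_of_ae hsh,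
        ae_restrict_mem measurableSet_Ioc] with t h1 h2 ht
      have t1 : t ∈ Ioo 0 T := ⟨ha.trans ht.1, ht.2.trans_lt hb⟩
      have t2 : h + t ∈ Ioo 0 T := ⟨by linarith [t1.1], by linarith [ht.2]⟩
      have r1 := h1 t1 t ⟨t1.1.le, t1.2.le⟩ (h + t) ⟨t2.1.le, t2.2.le⟩ (by linarith)
      have r2 := h2 t2 t ⟨t1.1.le, t1.2.le⟩ (h + t) ⟨t2.1.le, t2.2.le⟩ (by linarith)
      have r3 : q (h + t) - q t = inner ℝ (w (h + t) - w t) (w (h + t))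
          + inner ℝ (w (h + t) - w t) (w t) := by
        rw [hq, ← inner_add_right]
        simp only [inner_sub_left, inner_add_right, real_inner_self_eq_norm_sq,
          real_inner_comm (w t) (w (h + t))]
        ring
      rw [r3, r1, r2, ← intervalIntegral.integral_add (integrableOn_dual_apply_const hF _ _ _)
        (integrableOn_dual_apply_const hF _ _ _), ← intervalIntegral.integral_of_le hh.le]
      rw [intervalIntegral.integral_comp_add_right (fun σ => F σ (f (h + t) + f t)) t, zero_add]
      simp only [map_add]
    rw [e1, e2, intervalIntegral.integral_of_le hh.le]
    refine integral_integral_swap ?_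
    have hg : MemLp (fun t => f (h + t) + f t) P (volume.restrict (Ioc a b)) :=
      ((memLp_translate hf h).add hf).restrict _
    have hFt : ∀ θ : ℝ, MemLp (fun t => F (θ + t)) Q (volume.restrict (Ioc a b)) :=
      fun θ => (memLp_translate hF θ).restrict _
    have hm1 : StronglyMeasurable fun z : ℝ × ℝ => F (z.2 + z.1) :=
      hFm.comp_measurable (by fun_prop)
    have hm2 : StronglyMeasurable fun z : ℝ × ℝ => f (h + z.1) + f z.1 :=
      (hfm.comp_measurable (by fun_prop)).add (hfm.comp_measurable (by fun_prop))
    have hm : StronglyMeasurable fun z : ℝ × ℝ => F (z.2 + z.1) (f (h + z.1) + f z.1) := by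
      exact isBoundedBilinearMap_apply.continuous.comp_stronglyMeasurable (hm1.prodMk hm2)
    refine (integrable_prod_iff' hm.aestronglyMeasurable).2 ⟨Eventually.of_forall fun θ =>
      integrable_dual_apply (hFt θ) hg, ?_⟩
    -- Integrability for Fubini: by Hölder and translation invariance, the integral over t of the
    -- absolute value is bounded uniformly in θ, and θ runs over a bounded interval.
    refine Integrable.of_bound
      (C := (eLpNorm F Q volume * eLpNorm (fun t => f (h + t) + f t) P
        (volume.restrict (Ioc a b))).toReal) ?_ ?_
    · exact (hm.norm.comp_measurable measurable_swap).integral_prod_right'.aestronglyMeasurable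
    · refine Eventually.of_forall fun θ => ?_
      rw [Real.norm_of_nonneg (integral_nonneg fun _ => norm_nonneg _),
        integral_norm_eq_lintegral_enorm (integrable_dual_apply (hFt θ) hg).1]
      refine ENNReal.toReal_mono (ENNReal.mul_ne_top hF.eLpNorm_ne_top hg.eLpNorm_ne_top) ?_
      rw [← eLpNorm_one_eq_lintegral_enorm]
      refine (eLpNorm_le_eLpNorm_mul_eLpNorm_of_nnnorm (p := Q) (q := P) (r := 1) (hFt θ).1 hg.1
        (fun L x => L x) 1 (Eventually.of_forall fun t => ?_)).trans ?_
      · rw [one_mul]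
        exact (F (θ + t)).le_opNNNorm _
      · rw [ENNReal.coe_one, one_mul]
        gcongr
        calc eLpNorm (fun t => F (θ + t)) Q (volume.restrict (Ioc a b))
            ≤ eLpNorm (fun t => F (θ + t)) Q volume :=
              eLpNorm_mono_measure _ Measure.restrict_le_self
          _ = eLpNorm F Q volume := eLpNorm_comp_measurePreserving hF.1
              (measurePreserving_add_left volume θ)
  -- Both sides of `key`, divided by h, are averages over (0, h) of functions continuous in (θ, h),
  -- so they converge to the values at (0, 0).
  have l1 := tendsto_average_right (G := fun z => q (b + z.1) - q (a + z.1)) (by fun_prop)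
  have l2 := tendsto_average_right (continuous_translate_pairing hF hf (Ioc a b))
  have l3 := tendsto_nhds_unique_of_eventuallyEq l1 l2 (by
    filter_upwards [Ioo_mem_nhdsGT (sub_pos.2 hb)] with h hh
    rw [← key h hh.1 hh.2, ← intervalIntegral.integral_sub]
    · exact (hqc.comp (by fun_prop)).intervalIntegrable _ _
    · exact (hqc.comp (by fun_prop)).intervalIntegrable _ _)
  simp only [add_zero, zero_add] at l3
  rw [hq] at l3
  rw [l3, intervalIntegral.integral_of_le hab, ← integral_const_mul]
  refine integral_congr_ae (Eventually.of_forall fun t => ?_)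
  simp only [map_add]
  ring

/-- Zero extension makes translations meaningful on the whole line, and a strongly measurable
representative gives joint measurability of (t, θ) ↦ F(θ + t) for Fubini. -/
theorem exists_stronglyMeasurable_extension {X G : Type*} [MeasurableSpace X] {μ : Measure X}
    [NormedAddCommGroup G] {g : X → G} {s : Set X} (hs : MeasurableSet s)
    (hg : MemLp g P (μ.restrict s)) :
    ∃ G : X → G, StronglyMeasurable G ∧ MemLp G P μ ∧ ∀ᵐ t ∂(μ.restrict s), G t = g t := by
  refine ⟨s.indicator (hg.1.mk g), hg.1.stronglyMeasurable_mk.indicator hs,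
    (memLp_indicator_iff_restrict hs).2 ((memLp_congr_ae hg.1.ae_eq_mk).1 hg), ?_⟩
  filter_upwards [hg.1.ae_eq_mk, ae_restrict_mem hs] with t h1 h2
  rw [indicator_of_mem h2, ← h1]

/-- The energy identity. -/
theorem energy_identity [Fact (1 ≤ P)] [Fact (1 ≤ Q)] [ENNReal.HolderConjugate Q P]
    [Fact (P ≠ ⊤)] [Fact (Q ≠ ⊤)] {w' : ℝ → StrongDual ℝ E} {W : ℝ → E} {w : ℝ → H} {T : ℝ}
    (hT : 0 < T) (hw' : MemLp w' Q (volume.restrict (Ioo 0 T)))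
    (hW : MemLp W P (volume.restrict (Ioo 0 T))) (hw : ContinuousOn w (Icc 0 T))
    (hrel : ∀ᵐ r ∂(volume.restrict (Ioo 0 T)), ∀ s ∈ Icc 0 T, ∀ t ∈ Icc 0 T, s ≤ t →
      inner ℝ (w t - w s) (w r) = ∫ σ in s..t, w' σ (W r))
    {τ : ℝ} (hτ : τ ∈ Icc 0 T) :
    ‖w τ‖ ^ 2 - ‖w 0‖ ^ 2 = 2 * ∫ t in Ioo 0 τ, w' t (W t) := by
  obtain ⟨F, hFm, hF, hFw⟩ := exists_stronglyMeasurable_extension measurableSet_Ioo hw'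
  obtain ⟨f, hfm, hf, hfW⟩ := exists_stronglyMeasurable_extension measurableSet_Ioo hW
  -- The interior version asks for w continuous on ℝ; w is continued by its end values, and only its
  -- values on [0, T] matter.
  have hext : ∀ t ∈ Icc 0 T, IccExtend hT.le ((Icc 0 T).domRestrict w) t = w t := fun t ht =>
    IccExtend_of_mem _ _ ht
  have hsub : ∀ {s t : ℝ}, s ∈ Icc 0 T → t ∈ Icc 0 T →
      ∀ᵐ σ ∂(volume.restrict (Ioc s t)), F σ = w' σ := by
    intro s t hs ht
    rw [Measure.restrict_congr_set Ioo_ae_eq_Ioc.symm]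
    exact ae_restrict_of_ae_restrict_of_subset (Ioo_subset_Ioo hs.1 ht.2) hFw
  have hint : IntegrableOn (fun t => F t (f t)) (Icc 0 T) :=
    (integrable_dual_apply hF hf).integrableOn
  -- It remains to see that φ is constant: this holds on (0, T) by the interior identity and extends
  -- to the end points by continuity.
  obtain ⟨φ, hφ⟩ : ∃ φ : ℝ → ℝ, φ = fun t => ‖w t‖ ^ 2 - 2 * ∫ σ in (0 : ℝ)..t, F σ (f σ) :=
    ⟨_, rfl⟩
  have hφc : ContinuousOn φ (Icc 0 T) := by
    rw [hφ]
    refine (hw.norm.pow 2).sub (continuousOn_const.mul ?_)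
    have := intervalIntegral.continuousOn_primitive_interval (a := 0) (b := T) (μ := volume)
      (f := fun t => F t (f t)) (by rwa [uIcc_of_le hT.le])
    rwa [uIcc_of_le hT.le] at this
  have hi : ∀ x y : ℝ, IntervalIntegrable (fun t => F t (f t)) volume x y := fun x y =>
    (integrable_dual_apply hF hf).intervalIntegrable
  have hconst : ∀ a ∈ Ioo 0 T, ∀ b ∈ Ioo 0 T, a ≤ b → φ b = φ a := by
    intro a ha b hb hab
    have := energy_identity_interior (w := IccExtend hT.le ((Icc 0 T).domRestrict w)) (T := T)
      hFm hfm hF hf (continuousOn_iff_continuous_domRestrict.1 hw).Icc_extend' (by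
        rw [ae_restrict_iff' measurableSet_Ioo] at hrel hfW
        filter_upwards [hrel, hfW] with r h1 h2 hr s hs t ht hst
        rw [hext t ht, hext s hs, hext r ⟨hr.1.le, hr.2.le⟩, h1 hr s hs t ht hst,
          intervalIntegral.integral_of_le hst, intervalIntegral.integral_of_le hst]
        refine integral_congr_ae ?_
        filter_upwards [hsub hs ht] with σ h3
        rw [h3, h2 hr]) ha.1 hab hb.2
    rw [hext a ⟨ha.1.le, ha.2.le⟩, hext b ⟨hb.1.le, hb.2.le⟩] at this
    have h2 := intervalIntegral.integral_add_adjacent_intervals (hi 0 a) (hi a b)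
    simp only [hφ]
    linarith
  have hmid : T / 2 ∈ Ioo 0 T := ⟨by linarith, by linarith⟩
  have hall : EqOn φ (fun _ => φ (T / 2)) (Icc 0 T) := by
    refine EqOn.of_subset_closure (s := Ioo 0 T) (fun t ht => ?_) hφc continuousOn_const
      Ioo_subset_Icc_self (by rw [closure_Ioo hT.ne])
    rcases le_total t (T / 2) with h | h
    · exact (hconst t ht _ hmid h).symm
    · exact hconst _ hmid t ht h
  have h1 := (hall hτ).trans (hall ⟨le_rfl, hT.le⟩).symm
  simp only [hφ, intervalIntegral.integral_same, mul_zero, sub_zero] at h1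
  have h2 : ∫ σ in (0 : ℝ)..τ, F σ (f σ) = ∫ t in Ioo 0 τ, w' t (W t) := by
    rw [intervalIntegral.integral_of_le hτ.1, integral_Ioc_eq_integral_Ioo]
    refine integral_congr_ae ?_
    have hss : Ioo 0 τ ⊆ Ioo 0 T := Ioo_subset_Ioo_right hτ.2
    filter_upwards [ae_restrict_of_ae_restrict_of_subset hss hFw,
      ae_restrict_of_ae_restrict_of_subset hss hfW] with t h3 h4
    rw [h3, h4]
  rw [← h2]
  linarith

end energyIdentity

/-! ### From weak time derivatives to increments -/

section increments

open Filter Topology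

/-- A smooth step rising from `0` to `1` on `[a, a + ε]`. -/
def smoothStep (a ε t : ℝ) : ℝ := Real.smoothTransition ((t - a) / ε)

theorem contDiff_smoothStep (a ε : ℝ) : ContDiff ℝ ∞ (smoothStep a ε) :=
  Real.smoothTransition.contDiff.comp (by fun_prop)

theorem smoothStep_of_le {a ε t : ℝ} (hε : 0 < ε) (h : t ≤ a) : smoothStep a ε t = 0 :=
  Real.smoothTransition.zero_of_nonpos (div_nonpos_of_nonpos_of_nonneg (by linarith) hε.le)

theorem smoothStep_of_ge {a ε t : ℝ} (hε : 0 < ε) (h : a + ε ≤ t) : smoothStep a ε t = 1 :=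
  Real.smoothTransition.one_of_one_le ((one_le_div hε).2 (by linarith))

theorem smoothStep_mono {a ε : ℝ} (hε : 0 < ε) : Monotone (smoothStep a ε) := fun s t h =>
  Real.smoothTransition.monotone (by gcongr)

theorem continuous_deriv_smoothStep (a ε : ℝ) : Continuous (deriv (smoothStep a ε)) :=
  (contDiff_smoothStep a ε).continuous_deriv (by simp)

theorem deriv_smoothStep_eq_zero {a ε t : ℝ} (hε : 0 < ε) (h : t ∉ Icc a (a + ε)) :
    deriv (smoothStep a ε) t = 0 := by
  rw [mem_Icc, not_and_or, not_le, not_le] at h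
  rcases h with h | h
  · have : smoothStep a ε =ᶠ[𝓝 t] fun _ => 0 := by
      filter_upwards [Iio_mem_nhds h] with s hs using smoothStep_of_le hε (le_of_lt hs)
    rw [this.deriv_eq, deriv_const]
  · have : smoothStep a ε =ᶠ[𝓝 t] fun _ => 1 := by
      filter_upwards [Ioi_mem_nhds h] with s hs using smoothStep_of_ge hε (le_of_lt hs)
    rw [this.deriv_eq, deriv_const]

/-- The derivatives of the steps are nonnegative, have mass 1 and live in [a, a + ε]: an approximate
identity at a from the right. -/
theorem tendsto_integral_deriv_smoothStep {F : ℝ → ℝ} {a T : ℝ} (hF : ContinuousOn F (Icc 0 T))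
    (ha : 0 < a) (haT : a < T) :
    Tendsto (fun ε => ∫ t in Ioo 0 T, deriv (smoothStep a ε) t * F t) (𝓝[>] 0) (𝓝 (F a)) := by
  rw [Metric.tendsto_nhdsWithin_nhds]
  intro η hη
  obtain ⟨δ, hδ, hd⟩ := Metric.continuousAt_iff.1
    (hF.continuousAt (Icc_mem_nhds ha haT)) (η / 2) (half_pos hη)
  refine ⟨min δ (T - a), lt_min hδ (by linarith), fun {ε} hε hεδ => ?_⟩
  have hε : 0 < ε := hε
  rw [dist_zero_right, Real.norm_of_nonneg hε.le, lt_min_iff] at hεδ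
  have hsub : Icc a (a + ε) ⊆ Ioo 0 T := fun t ht => ⟨ha.trans_le ht.1, by linarith [ht.2]⟩
  have e1 : ∫ t in Ioo 0 T, deriv (smoothStep a ε) t * F t
      = ∫ t in Icc a (a + ε), deriv (smoothStep a ε) t * F t := by
    refine setIntegral_eq_of_subset_of_forall_sdiff_eq_zero measurableSet_Ioo hsub fun t ht => ?_
    rw [deriv_smoothStep_eq_zero hε ht.2, zero_mul]
  have hFc : ContinuousOn F (Icc a (a + ε)) := hF.mono (hsub.trans Ioo_subset_Icc_self)
  have hdc := continuous_deriv_smoothStep a ε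
  have hle : a ≤ a + ε := by linarith
  have e2 : ∫ t in a..(a + ε), deriv (smoothStep a ε) t = 1 := by
    rw [intervalIntegral.integral_deriv_eq_sub
      (fun t _ => ((contDiff_smoothStep a ε).differentiable (by simp)).differentiableAt)
      (hdc.intervalIntegrable _ _), smoothStep_of_ge hε le_rfl, smoothStep_of_le hε le_rfl,
      sub_zero]
  have i1 : IntervalIntegrable (fun t => deriv (smoothStep a ε) t * F t) volume a (a + ε) := by
    refine ContinuousOn.intervalIntegrable ?_
    rw [uIcc_of_le hle]
    exact hdc.continuousOn.mul hFc
  have i2 : IntervalIntegrable (fun t => deriv (smoothStep a ε) t * F a) volume a (a + ε) :=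
    (hdc.mul continuous_const).intervalIntegrable _ _
  rw [e1, integral_Icc_eq_integral_Ioc, ← intervalIntegral.integral_of_le hle, dist_eq_norm]
  have e3 : (∫ t in a..(a + ε), deriv (smoothStep a ε) t * F t) - F a
      = ∫ t in a..(a + ε), deriv (smoothStep a ε) t * (F t - F a) := by
    simp only [mul_sub]
    rw [intervalIntegral.integral_sub i1 i2, intervalIntegral.integral_mul_const, e2, one_mul]
  rw [e3]
  have e4 : ‖∫ t in a..(a + ε), deriv (smoothStep a ε) t * (F t - F a)‖
      ≤ ∫ t in a..(a + ε), deriv (smoothStep a ε) t * (η / 2) := by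
    refine intervalIntegral.norm_integral_le_of_norm_le hle ?_
      ((hdc.mul continuous_const).intervalIntegrable _ _)
    refine Eventually.of_forall fun t ht => ?_
    have h0 : 0 ≤ deriv (smoothStep a ε) t := (smoothStep_mono hε).deriv_nonneg
    rw [norm_mul, Real.norm_of_nonneg h0]
    gcongr
    rw [← dist_eq_norm]
    refine (hd ?_).le
    rw [dist_eq_norm, Real.norm_of_nonneg (by linarith [ht.1])]
    linarith [ht.2]
  rw [intervalIntegral.integral_mul_const, e2, one_mul] at e4
  linarith

/-- A continuous function with an integrable weak derivative is the primitive of the latter. -/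
theorem sub_eq_integral_of_weakDeriv {F g : ℝ → ℝ} {T : ℝ} (hT : 0 < T)
    (hF : ContinuousOn F (Icc 0 T)) (hg : IntegrableOn g (Ioo 0 T))
    (hweak : ∀ ψ : ℝ → ℝ, ContDiff ℝ ∞ ψ → HasCompactSupport ψ → tsupport ψ ⊆ Ioo 0 T →
      ∫ t in Ioo 0 T, deriv ψ t * F t = - ∫ t in Ioo 0 T, ψ t * g t)
    {a b : ℝ} (ha : a ∈ Icc 0 T) (hb : b ∈ Icc 0 T) :
    F b - F a = ∫ t in a..b, g t := by
  have interior : ∀ a ∈ Ioo 0 T, ∀ b ∈ Ioo 0 T, a ≤ b → F b - F a = ∫ t in a..b, g t := by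
    intro a ha b hb hab
    have hdiff : ∀ (a ε : ℝ) t, DifferentiableAt ℝ (smoothStep a ε) t := fun a ε t =>
      ((contDiff_smoothStep a ε).differentiable (by simp)).differentiableAt
    have hFi : ∀ a ε, IntegrableOn (fun t => deriv (smoothStep a ε) t * F t) (Ioo 0 T) := by
      intro a ε
      exact (((continuous_deriv_smoothStep a ε).continuousOn.mul hF).integrableOn_Icc).mono_set
        Ioo_subset_Icc_self
    -- The test function is the difference of the steps at a and at b, a smooth approximation of the
    -- indicator of (a, b]. Its derivative picks out F(a) − F(b) in the limit.
    have l1 := (tendsto_integral_deriv_smoothStep hF ha.1 ha.2).sub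
      (tendsto_integral_deriv_smoothStep hF hb.1 hb.2)
    have l2 : Tendsto (fun ε => - ∫ t in Ioo 0 T, (smoothStep a ε t - smoothStep b ε t) * g t)
        (𝓝[>] 0) (𝓝 (- ∫ t in Ioo 0 T, (Ioc a b).indicator g t)) := by
      refine Tendsto.neg (tendsto_integral_filter_of_dominated_convergence (fun t => ‖g t‖)
        ?_ ?_ hg.norm ?_)
      · refine Eventually.of_forall fun ε => ?_
        exact ((contDiff_smoothStep a ε).continuous.sub
          (contDiff_smoothStep b ε).continuous).aestronglyMeasurable.mul hg.1
      · refine Eventually.of_forall fun ε => Eventually.of_forall fun t => ?_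
        rw [norm_mul]
        refine mul_le_of_le_one_left (norm_nonneg _) ?_
        rw [Real.norm_eq_abs, abs_le]
        have h1 := Real.smoothTransition.le_one ((t - a) / ε)
        have h2 := Real.smoothTransition.nonneg ((t - a) / ε)
        have h3 := Real.smoothTransition.le_one ((t - b) / ε)
        have h4 := Real.smoothTransition.nonneg ((t - b) / ε)
        constructor <;> simp only [smoothStep] <;> linarith
      -- Pointwise the convergence is trivial: for each t the integrand is already equal to its
      -- limit once ε is small.
      · refine Eventually.of_forall fun t => tendsto_const_nhds.congr' ?_
        rcases le_or_gt t a with h | h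
        · filter_upwards [self_mem_nhdsWithin] with ε hε
          rw [smoothStep_of_le hε h, smoothStep_of_le hε (h.trans hab),
            indicator_of_notMem (fun hh => absurd hh.1 (not_lt.2 h)), sub_zero, zero_mul]
        · rcases le_or_gt t b with h' | h'
          · filter_upwards [Ioo_mem_nhdsGT (sub_pos.2 h)] with ε hε
            rw [smoothStep_of_ge hε.1 (by linarith [hε.2]), smoothStep_of_le hε.1 h',
              indicator_of_mem (mem_Ioc.2 ⟨h, h'⟩), sub_zero, one_mul]
          · filter_upwards [Ioo_mem_nhdsGT (sub_pos.2 h')] with ε hε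
            rw [smoothStep_of_ge hε.1 (by linarith [hε.2]),
              smoothStep_of_ge hε.1 (by linarith [hε.2]),
              indicator_of_notMem (fun hh => absurd hh.2 (not_le.2 h')), sub_self, zero_mul]
    have l3 := tendsto_nhds_unique_of_eventuallyEq l1 l2 (by
      filter_upwards [Ioo_mem_nhdsGT (sub_pos.2 hb.2)] with ε hε
      have hsupp : Function.support (fun t => smoothStep a ε t - smoothStep b ε t)
          ⊆ Icc a (b + ε) := by
        intro t ht
        by_contra hc
        rw [mem_Icc, not_and_or, not_le, not_le] at hc
        refine ht ?_
        rcases hc with h | h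
        · simp only [smoothStep_of_le hε.1 h.le, smoothStep_of_le hε.1 (h.le.trans hab), sub_self]
        · simp only [smoothStep_of_ge hε.1 h.le,
            smoothStep_of_ge hε.1 ((add_le_add_left hab ε).trans h.le), sub_self]
      have hts : tsupport (fun t => smoothStep a ε t - smoothStep b ε t) ⊆ Icc a (b + ε) :=
        closure_minimal hsupp isClosed_Icc
      have := hweak (fun t => smoothStep a ε t - smoothStep b ε t)
        ((contDiff_smoothStep a ε).sub (contDiff_smoothStep b ε))
        (HasCompactSupport.of_support_subset_isCompact isCompact_Icc hsupp)
        (hts.trans fun t ht => ⟨ha.1.trans_le ht.1, by linarith [ht.2, hε.2]⟩)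
      rw [← this, ← integral_sub (hFi a ε) (hFi b ε)]
      refine integral_congr_ae (Eventually.of_forall fun t => ?_)
      have : deriv (fun t => smoothStep a ε t - smoothStep b ε t) t
          = deriv (smoothStep a ε) t - deriv (smoothStep b ε) t :=
        deriv_fun_sub (hdiff _ _ _) (hdiff _ _ _)
      simp only [this, sub_mul])
    have hss : Ioc a b ⊆ Ioo 0 T := fun t ht => ⟨ha.1.trans ht.1, ht.2.trans_lt hb.2⟩
    rw [setIntegral_indicator measurableSet_Ioc, inter_eq_right.2 hss] at l3
    rw [intervalIntegral.integral_of_le hab]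
    linarith
  have hi : IntegrableOn g (Icc 0 T) := by
    rwa [integrableOn_Icc_iff_integrableOn_Ioo]
  have hii : ∀ x ∈ Icc 0 T, ∀ y ∈ Icc 0 T, IntervalIntegrable g volume x y := by
    intro x hx y hy
    exact (hi.mono_set (ordConnected_Icc.uIcc_subset hx hy)).intervalIntegrable
  -- F minus the primitive of g is continuous on [0, T] and constant on (0, T), which brings in the
  -- end points.
  have hc : ContinuousOn (fun t => F t - ∫ σ in (0 : ℝ)..t, g σ) (Icc 0 T) := by
    refine hF.sub ?_
    have := intervalIntegral.continuousOn_primitive_interval (a := 0) (b := T) (μ := volume)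
      (f := g) (by rwa [uIcc_of_le hT.le])
    rwa [uIcc_of_le hT.le] at this
  have h0 : (0 : ℝ) ∈ Icc 0 T := ⟨le_rfl, hT.le⟩
  have hmid : T / 2 ∈ Ioo 0 T := ⟨by linarith, by linarith⟩
  have hmid' := Ioo_subset_Icc_self hmid
  have hall : EqOn (fun t => F t - ∫ σ in (0 : ℝ)..t, g σ)
      (fun _ => F (T / 2) - ∫ σ in (0 : ℝ)..(T / 2), g σ) (Icc 0 T) := by
    refine EqOn.of_subset_closure (s := Ioo 0 T) (fun t ht => ?_) hc continuousOn_const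
      Ioo_subset_Icc_self (by rw [closure_Ioo hT.ne])
    have ht' := Ioo_subset_Icc_self ht
    rcases le_total t (T / 2) with h | h
    · have h1 := interior t ht _ hmid h
      have h2 := intervalIntegral.integral_add_adjacent_intervals (hii 0 h0 t ht')
        (hii t ht' _ hmid')
      linarith
    · have h1 := interior _ hmid t ht h
      have h2 := intervalIntegral.integral_add_adjacent_intervals (hii 0 h0 _ hmid')
        (hii _ hmid' t ht')
      linarith
  have h1 := (hall hb).trans (hall ha).symm
  have h2 := intervalIntegral.integral_add_adjacent_intervals (hii 0 h0 a ha) (hii a ha b hb)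
  simp only at h1
  linarith

end increments

/-! ### Exponents -/

section exponents

variable (p : ℝ)

theorem holderConjugate_pConj [hp : Fact (1 < p)] : (pConj p).HolderConjugate p :=
  (Real.HolderConjugate.conjExponent hp.out).symm

instance fact_one_lt_pConj [Fact (1 < p)] : Fact (1 < pConj p) := ⟨(holderConjugate_pConj p).lt⟩

instance ennrealHolderConjugate_pConj [Fact (1 < p)] :
    ENNReal.HolderConjugate (ENNReal.ofReal (pConj p)) (ENNReal.ofReal p) :=
  (holderConjugate_pConj p).ennrealOfReal

instance fact_ofReal_ne_top : Fact (ENNReal.ofReal p ≠ ⊤) := ⟨ENNReal.ofReal_ne_top⟩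

theorem lintegral_enorm_rpow {X F : Type*} [MeasurableSpace X] [NormedAddCommGroup F]
    {μ : Measure X} {q : ℝ} (hq : 0 < q) (f : X → F) :
    ∫⁻ x, ‖f x‖ₑ ^ q ∂μ = eLpNorm f (ENNReal.ofReal q) μ ^ q := by
  rw [eLpNorm_eq_eLpNorm' (by simpa using hq) ENNReal.ofReal_ne_top, ENNReal.toReal_ofReal hq.le,
    lintegral_rpow_enorm_eq_rpow_eLpNorm' hq]

theorem integral_norm_rpow {X F : Type*} [MeasurableSpace X] [NormedAddCommGroup F]
    {μ : Measure X} {q : ℝ} (hq : 0 < q) {f : X → F} (hf : AEStronglyMeasurable f μ) :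
    ∫ x, ‖f x‖ ^ q ∂μ = (eLpNorm f (ENNReal.ofReal q) μ).toReal ^ q := by
  rw [integral_eq_lintegral_of_nonneg_ae (Filter.Eventually.of_forall fun x => by positivity)
    (hf.norm.aemeasurable.pow_const q).aestronglyMeasurable, ENNReal.toReal_rpow,
    ← lintegral_enorm_rpow hq]
  congr 1
  refine lintegral_congr fun x => ?_
  rw [← ENNReal.ofReal_rpow_of_nonneg (norm_nonneg _) hq.le, ofReal_norm]

end exponents

/-! ### Weak gradients -/

section weakGradients

variable {n N : ℕ} {p : ℝ} [hp : Fact (1 < p)] {Ω : Set (Pt n)}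

theorem continuous_integral_coord_mul {ι : Type*} [Fintype ι] (i : ι) {ζ : Pt n → ℝ}
    (hζ : Continuous ζ) (hc : HasCompactSupport ζ) :
    Continuous fun u : Lp (EuclideanSpace ℝ ι) (ENNReal.ofReal p) (spaceMeas Ω) =>
      ∫ x, u x i * ζ x ∂(spaceMeas Ω) := by
  have hm : MemLp ζ (ENNReal.ofReal (pConj p)) (spaceMeas Ω) :=
    hζ.memLp_of_hasCompactSupport hc
  have : ENNReal.HolderConjugate (ENNReal.ofReal p) (ENNReal.ofReal (pConj p)) :=
    (holderConjugate_pConj p).symm.ennrealOfReal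
  have e : (fun u : Lp (EuclideanSpace ℝ ι) (ENNReal.ofReal p) (spaceMeas Ω) =>
      ∫ x, u x i * ζ x ∂(spaceMeas Ω)) = fun u =>
      ((ContinuousLinearMap.mul ℝ ℝ).comp (EuclideanSpace.proj i)).lpPairing (spaceMeas Ω)
        (ENNReal.ofReal p) (ENNReal.ofReal (pConj p)) u (hm.toLp ζ) := by
    ext u
    rw [ContinuousLinearMap.lpPairing_eq_integral]
    refine integral_congr_ae ?_
    filter_upwards [hm.coeFn_toLp] with x hx
    simp [hx]
  rw [e]
  exact (ContinuousLinearMap.continuous _).clm_apply continuous_const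

/-- For a fixed test function both sides of the defining identity are pairings with an L^{p'}
function, hence continuous in the pair (u, Du). -/
theorem isClosed_W1p : IsClosed (W1p N p Ω : Set (LpPair N p Ω)) := by
  have e : (W1p N p Ω : Set (LpPair N p Ω)) = ⋂ (η : Pt n → ℝ) (_ : ContDiff ℝ ∞ η)
      (_ : HasCompactSupport η) (_ : tsupport η ⊆ Ω) (j : Fin N) (α : Fin n),
      {w | ∫ x, w.1 x j * fderiv ℝ η x (EuclideanSpace.single α 1) ∂(spaceMeas Ω)
        = - ∫ x, w.2 x (j, α) * η x ∂(spaceMeas Ω)} := by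
    ext w
    simp only [mem_iInter]
    rfl
  rw [e]
  refine isClosed_iInter fun η => isClosed_iInter fun h1 => isClosed_iInter fun h2 =>
    isClosed_iInter fun _ => isClosed_iInter fun j => isClosed_iInter fun α => ?_
  refine isClosed_eq ?_ ?_
  · exact (continuous_integral_coord_mul j ((h1.continuous_fderiv (by simp)).clm_apply
      continuous_const) (h2.fderiv_apply (𝕜 := ℝ) _)).comp continuous_fst
  · exact ((continuous_integral_coord_mul (j, α) h1.continuous h2).comp continuous_snd).neg

/-- Integration by parts on all of ℝⁿ: the products vanish outside Ω, so restricting to Ω changes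
nothing and no boundary regularity is needed. -/
theorem testPairs_le_W1p : testPairs N p Ω ≤ W1p N p Ω := by
  rintro w ⟨φ, hφ, hφc, hφs, e1, e2⟩ η hη hηc hηs j α
  have hφj : ContDiff ℝ 1 fun x => φ x j := (EuclideanSpace.proj (𝕜 := ℝ) j).contDiff.comp hφ
  have hφd : ∀ x, fderiv ℝ (fun x => φ x j) x (EuclideanSpace.single α 1) = jac φ x (j, α) := by
    intro x
    have := ((EuclideanSpace.proj (𝕜 := ℝ) j).hasFDerivAt.comp x
      (hφ.differentiable one_ne_zero x).hasFDerivAt).fderiv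
    have e : (EuclideanSpace.proj (𝕜 := ℝ) j : Vec N → ℝ) ∘ φ = fun x => φ x j := rfl
    rw [e] at this
    rw [this]
    rfl
  have hdc : Continuous fun x => fderiv ℝ η x (EuclideanSpace.single α 1) :=
    (hη.continuous_fderiv (by simp)).clm_apply continuous_const
  have hdc' : Continuous fun x => fderiv ℝ (fun x => φ x j) x (EuclideanSpace.single α 1) :=
    (hφj.continuous_fderiv one_ne_zero).clm_apply continuous_const
  have r1 : ∫ x, w.1 x j * fderiv ℝ η x (EuclideanSpace.single α 1) ∂(spaceMeas Ω)
      = ∫ x, φ x j * fderiv ℝ η x (EuclideanSpace.single α 1) := by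
    rw [← setIntegral_eq_integral_of_forall_compl_eq_zero (s := Ω) (μ := volume)
      (f := fun x => φ x j * fderiv ℝ η x (EuclideanSpace.single α 1)) fun x hx => by
        rw [image_eq_zero_of_notMem_tsupport fun h => hx (hφs h)]
        simp]
    refine integral_congr_ae ?_
    filter_upwards [e1] with x hx
    rw [hx]
  have r2 : ∫ x, w.2 x (j, α) * η x ∂(spaceMeas Ω)
      = ∫ x, fderiv ℝ (fun x => φ x j) x (EuclideanSpace.single α 1) * η x := by
    rw [← setIntegral_eq_integral_of_forall_compl_eq_zero (s := Ω) (μ := volume)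
      (f := fun x => fderiv ℝ (fun x => φ x j) x (EuclideanSpace.single α 1) * η x) fun x hx => by
        rw [image_eq_zero_of_notMem_tsupport fun h => hx (hηs h), mul_zero]]
    refine integral_congr_ae ?_
    filter_upwards [e2] with x hx
    rw [hx, hφd]
  rw [r1, r2]
  refine integral_mul_fderiv_eq_neg_fderiv_mul_of_integrable ?_ ?_ ?_
    (fun x _ => hφj.differentiable one_ne_zero x) (fun x _ => hη.differentiable (by simp) x)
  · exact (hdc'.mul hη.continuous).integrable_of_hasCompactSupport hηc.mul_left
  · exact (hφj.continuous.mul hdc).integrable_of_hasCompactSupport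
      (hηc.fderiv_apply (𝕜 := ℝ) _).mul_left
  · exact (hφj.continuous.mul hη.continuous).integrable_of_hasCompactSupport hηc.mul_left

/-- The second component of an element of `W01p`, defined only as a limit, is therefore a weak
gradient, and uniqueness of weak gradients applies to it. -/
theorem W01p_le_W1p : W01p N p Ω ≤ W1p N p Ω :=
  Submodule.topologicalClosure_minimal _ testPairs_le_W1p isClosed_W1p

/-- The weak gradient is unique. -/
theorem grad_ae_eq_of_fn_ae_eq (hΩ : IsOpen Ω) {w₁ w₂ : LpPair N p Ω} (h₁ : w₁ ∈ W1p N p Ω)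
    (h₂ : w₂ ∈ W1p N p Ω) (h : w₁.1 =ᵐ[spaceMeas Ω] w₂.1) : w₁.2 =ᵐ[spaceMeas Ω] w₂.2 := by
  have key : ∀ i : Fin N × Fin n, ∀ᵐ x ∂(spaceMeas Ω), w₁.2 x i - w₂.2 x i = 0 := by
    rintro ⟨j, α⟩
    have hloc : ∀ G : Lp (Mat N n) (ENNReal.ofReal p) (spaceMeas Ω),
        LocallyIntegrable (fun x => G x (j, α)) (spaceMeas Ω) := by
      intro G
      have hG : MemLp (fun x => G x (j, α)) (ENNReal.ofReal p) (spaceMeas Ω) :=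
        (EuclideanSpace.proj (𝕜 := ℝ) (j, α)).comp_memLp' (Lp.memLp G)
      exact hG.locallyIntegrable Fact.out
    have := hΩ.ae_eq_zero_of_integral_contDiff_smul_eq_zero (μ := spaceMeas Ω)
      (f := fun x => w₁.2 x (j, α) - w₂.2 x (j, α))
      (((hloc w₁.2).sub (hloc w₂.2)).locallyIntegrableOn Ω) (by
        intro η hη hηc hηs
        have e1 := h₁ η hη hηc hηs j α
        have e2 := h₂ η hη hηc hηs j α
        have e3 : ∫ x, w₁.1 x j * fderiv ℝ η x (EuclideanSpace.single α 1) ∂(spaceMeas Ω)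
            = ∫ x, w₂.1 x j * fderiv ℝ η x (EuclideanSpace.single α 1) ∂(spaceMeas Ω) := by
          refine integral_congr_ae ?_
          filter_upwards [h] with x hx
          rw [hx]
        have e4 := integral_sub (integrable_coord_mul w₁.2 (j, α) hη.continuous hηc)
          (integrable_coord_mul w₂.2 (j, α) hη.continuous hηc)
        calc ∫ x, η x • (w₁.2 x (j, α) - w₂.2 x (j, α)) ∂(spaceMeas Ω)
            = ∫ x, (w₁.2 x (j, α) * η x - w₂.2 x (j, α) * η x) ∂(spaceMeas Ω) :=
              integral_congr_ae (Filter.Eventually.of_forall fun x => by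
                simp only [smul_eq_mul]; ring)
          _ = 0 := by rw [e4]; linarith)
    filter_upwards [this, ae_restrict_mem hΩ.measurableSet] with x h3 h4 using h3 h4
  filter_upwards [ae_all_iff.2 key] with x hx
  ext i
  linarith [hx i]

theorem V.norm_grad_le (φ : V N p Ω) : ‖φ.grad‖ ≤ ‖φ‖ := by
  rw [V.norm_def, v0Norm, Lp.norm_def φ.grad]
  have h1 := norm_nonneg φ.fn
  have h2 : 0 ≤ if p ≤ pCrit n then (eLpNorm φ.fn 2 (spaceMeas Ω)).toReal else 0 := by
    split_ifs
    · exact ENNReal.toReal_nonneg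
    · exact le_rfl
  linarith

end weakGradients

/-! ### Gradients on the cylinder -/

section cylinder

variable {n N : ℕ} [Fact (2 ≤ n)] {p : ℝ} [hp : Fact (1 < p)] {Ω : Set (Pt n)}
  [hΩ : IsBoundedLipschitzDomain Ω] {T : ℝ}

instance isFiniteMeasure_spaceMeas : IsFiniteMeasure (spaceMeas Ω) :=
  ⟨by
    rw [Measure.restrict_apply_univ]
    exact hΩ.isBounded.measure_lt_top⟩

/-- By Tonelli the L^p norm on the cylinder is the L^p norm in time of the slice norms, and each
slice is dominated by the `V`-norm of the Bochner representative. -/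
theorem MemXC.memLp_grad {u : ℝ → L2 N Ω} {Du : ℝ → Pt n → Mat N n} {u' : ℝ → V0' N p Ω}
    (hu : MemXC p Ω T u Du u') :
    MemLp (Function.uncurry Du) (ENNReal.ofReal p) (cylMeas Ω T) := by
  have hp0 : 0 < p := one_pos.trans hp.out
  refine ⟨hu.grad_meas, ?_⟩
  obtain ⟨U, hU, hUD⟩ := hu.bochner
  refine (ENNReal.rpow_lt_top_iff_of_pos hp0).1 ?_
  rw [← lintegral_enorm_rpow hp0, lintegral_prod _ (hu.grad_meas.enorm.pow_const p)]
  calc ∫⁻ t, ∫⁻ x, ‖Function.uncurry Du (t, x)‖ₑ ^ p ∂(spaceMeas Ω) ∂(timeMeas T)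
      ≤ ∫⁻ t, ‖U t‖ₑ ^ p ∂(timeMeas T) := by
        refine lintegral_mono_ae ?_
        filter_upwards [hUD] with t ht
        have e : ∀ x, Function.uncurry Du (t, x) = Du t x := fun _ => rfl
        simp only [e]
        rw [lintegral_enorm_rpow hp0, ← eLpNorm_congr_ae ht.2, ← Lp.enorm_def]
        gcongr
        exact enorm_le_iff_norm_le.2 (V.norm_grad_le _)
    _ < ⊤ := by
        rw [lintegral_enorm_rpow hp0]
        exact ENNReal.rpow_lt_top_of_nonneg hp0.le hU.eLpNorm_ne_top

end cylinder

/-! ### Functions with a time derivative in the dual space -/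

section timeDerivatives

variable {n N : ℕ} [Fact (2 ≤ n)] {p : ℝ} [hp : Fact (1 < p)] {Ω : Set (Pt n)}
  [hΩ : IsBoundedLipschitzDomain Ω] {T : ℝ}

variable (p Ω T) in
/-- `w ∈ C([0,T];L²)` has time derivative `w' ∈ L^{p'}(0,T;V_0')` in the sense that its increments,
tested with elements of `V_0 ∩ L²`, are the integrals of `w'`. -/
structure HasDualDeriv (w : ℝ → L2 N Ω) (w' : ℝ → V0' N p Ω) : Prop where
  continuousOn : ContinuousOn w (Icc 0 T)
  memLp : MemLp w' (ENNReal.ofReal (pConj p)) (timeMeas T)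
  inner_sub : ∀ (φ : V0 N p Ω) (ψ : L2 N Ω), φ.fn =ᵐ[spaceMeas Ω] ψ →
    ∀ s ∈ Icc 0 T, ∀ t ∈ Icc 0 T, inner ℝ (w t - w s) ψ = ∫ σ in s..t, w' σ φ

theorem integrableOn_dual_apply {w' : ℝ → V0' N p Ω}
    (h : MemLp w' (ENNReal.ofReal (pConj p)) (timeMeas T)) (φ : V0 N p Ω) :
    IntegrableOn (fun t => w' t φ) (Ioo 0 T) :=
  (ContinuousLinearMap.apply ℝ ℝ φ).integrable_comp (h.integrable Fact.out)

/-- For fixed ψ the scalar function t ↦ ⟨u(t), ψ⟩ is continuous with an integrable weak derivative,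
so it is a primitive. -/
theorem MemXC.hasDualDeriv (hT : 0 < T) {u : ℝ → L2 N Ω} {Du : ℝ → Pt n → Mat N n}
    {u' : ℝ → V0' N p Ω} (hu : MemXC p Ω T u Du u') : HasDualDeriv p Ω T u u' where
  continuousOn := hu.continuousOn
  memLp := hu.deriv_memLp
  inner_sub φ ψ h s hs t ht := by
    have e : ∀ r, ∫ x, inner ℝ (u r x) (φ.fn x) ∂(spaceMeas Ω) = inner ℝ (u r) ψ := by
      intro r
      rw [L2.inner_def]
      refine integral_congr_ae ?_
      filter_upwards [h] with x hx
      rw [hx]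
    rw [inner_sub_left]
    refine sub_eq_integral_of_weakDeriv (F := fun r => inner ℝ (u r) ψ) hT
      (hu.continuousOn.inner continuousOn_const) (integrableOn_dual_apply hu.deriv_memLp φ) ?_ hs ht
    intro η h1 h2 h3
    have := hu.isTimeDeriv η h1 h2 h3 φ
    simpa only [e] using this

theorem HasDualDeriv.sub {u v : ℝ → L2 N Ω} {u' v' : ℝ → V0' N p Ω} (hu : HasDualDeriv p Ω T u u')
    (hv : HasDualDeriv p Ω T v v') :
    HasDualDeriv p Ω T (fun t => u t - v t) (fun t => u' t - v' t) where
  continuousOn := hu.continuousOn.sub hv.continuousOn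
  memLp := hu.memLp.sub hv.memLp
  inner_sub φ ψ h s hs t ht := by
    have hi : ∀ {w' : ℝ → V0' N p Ω}, MemLp w' (ENNReal.ofReal (pConj p)) (timeMeas T) →
        IntervalIntegrable (fun σ => w' σ φ) volume s t := fun hw =>
      (IntegrableOn.mono_set (by
        rw [integrableOn_Icc_iff_integrableOn_Ioo]
        exact integrableOn_dual_apply hw φ)
        (ordConnected_Icc.uIcc_subset hs ht)).intervalIntegrable
    have h3 := intervalIntegral.integral_sub (hi hu.memLp) (hi hv.memLp)
    have h1 := hu.inner_sub φ ψ h s hs t ht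
    have h2 := hv.inner_sub φ ψ h s hs t ht
    have e : u t - v t - (u s - v s) = (u t - u s) - (v t - v s) := by abel
    rw [e, inner_sub_left, h1, h2, ← h3]
    rfl

/-- For a.e. r the element W(r) of `V_0` has the L² representative w(r), so it may be inserted in
the increment formula. Neither density of `V_0` in L² nor a Sobolev embedding is used. -/
theorem HasDualDeriv.energy (hT : 0 < T) {w : ℝ → L2 N Ω} {w' : ℝ → V0' N p Ω}
    (hw : HasDualDeriv p Ω T w w') {W : ℝ → V0 N p Ω}
    (hW : MemLp W (ENNReal.ofReal p) (timeMeas T))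
    (hWw : ∀ᵐ t ∂(timeMeas T), (W t).fn =ᵐ[spaceMeas Ω] w t) {τ : ℝ} (hτ : τ ∈ Icc 0 T) :
    ‖w τ‖ ^ 2 - ‖w 0‖ ^ 2 = 2 * ∫ t, w' t (W t) ∂(timeMeas τ) := by
  refine energy_identity hT hw.memLp hW hw.continuousOn ?_ hτ
  filter_upwards [hWw] with r hr s hs t ht _
  exact hw.inner_sub _ _ hr s hs t ht

end timeDerivatives

/-! ### The flux as a function on the cylinder -/

section fluxOnCylinder

variable {n N : ℕ}

theorem timeMeas_mono {τ T : ℝ} (h : τ ≤ T) : timeMeas τ ≤ timeMeas T :=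
  Measure.restrict_mono (Ioo_subset_Ioo_right h) le_rfl

theorem cylMeas_mono (Ω : Set (Pt n)) {τ T : ℝ} (h : τ ≤ T) : cylMeas Ω τ ≤ cylMeas Ω T :=
  Measure.prod_mono (timeMeas_mono h) le_rfl

theorem aestronglyMeasurable_gInner {X : Type*} [MeasurableSpace X] {μ : Measure X}
    {γ : X → Matrix (Fin n) (Fin n) ℝ} (hγ : ∀ α β, AEStronglyMeasurable (fun z => γ z α β) μ)
    {F G : X → Mat N n} (hF : AEStronglyMeasurable F μ) (hG : AEStronglyMeasurable G μ) :
    AEStronglyMeasurable (fun z => gInner (γ z) (F z) (G z)) μ := by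
  unfold gInner
  have hc : ∀ {F : X → Mat N n}, AEStronglyMeasurable F μ → ∀ i,
      AEStronglyMeasurable (fun z => F z i) μ := fun hF i =>
    (EuclideanSpace.proj (𝕜 := ℝ) i).continuous.comp_aestronglyMeasurable hF
  refine Finset.aestronglyMeasurable_fun_sum _ fun j _ => Finset.aestronglyMeasurable_fun_sum _
    fun α _ => Finset.aestronglyMeasurable_fun_sum _ fun β _ => ?_
  exact ((hγ α β).mul (hc hF _)).mul (hc hG _)

variable {c : Coeffs n} {p : ℝ} {Ω : Set (Pt n)} {T γ₀ κ₀ Γ₀ : ℝ}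

theorem Coeffs.Admissible.ae_pointBounds (hΩ : MeasurableSet Ω)
    (hc : c.Admissible p Ω T γ₀ κ₀ Γ₀) :
    ∀ᵐ z ∂(cylMeas Ω T), c.PointBounds γ₀ Γ₀ z.1 z.2 := by
  have h1 : ∀ᵐ z ∂(cylMeas Ω T), z ∈ Ioo 0 T ×ˢ Ω := by
    rw [cylMeas, Measure.prod_restrict]
    exact ae_restrict_mem (measurableSet_Ioo.prod hΩ)
  filter_upwards [h1, hc.a_bounds] with z h2 h3
  exact ⟨hc.isElliptic h2.1 h2.2, h3.1, h3.2.1, h3.2.2⟩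

theorem Coeffs.Admissible.measurable_indicator_gp (hc : c.Admissible p Ω T γ₀ κ₀ Γ₀) :
    Measurable ((Ioi 0).indicator c.gₚ) := by
  classical
  have := hc.gₚ_contDiff.continuousOn.measurable_piecewise (g := (0 : ℝ → ℝ))
    continuous_zero.continuousOn measurableSet_Ioi
  rwa [piecewise_eq_indicator] at this

/-- `gₚ` is known to be continuous only on (0, ∞), so it is replaced by 0 elsewhere to be
measurable. The flux does not change: |Du|_γ = 0 forces Du = 0. -/
theorem Coeffs.Admissible.aestronglyMeasurable_flux (hγ₀ : 0 < γ₀) (hΩ : MeasurableSet Ω)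
    (hc : c.Admissible p Ω T γ₀ κ₀ Γ₀) {Du Z : ℝ → Pt n → Mat N n}
    (hDu : AEStronglyMeasurable (Function.uncurry Du) (cylMeas Ω T))
    (hZ : AEStronglyMeasurable (Function.uncurry Z) (cylMeas Ω T)) :
    AEStronglyMeasurable (Function.uncurry fun t x => c.flux t x (Du t x) (Z t x))
      (cylMeas Ω T) := by
  have hn : AEMeasurable (fun z : ℝ × Pt n => gNorm (c.γ z.1 z.2) (Du z.1 z.2) ^ 2)
      (cylMeas Ω T) :=
    ((aestronglyMeasurable_gInner hc.γ_meas hDu hDu).aemeasurable.sqrt).pow_const 2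
  have hg : AEStronglyMeasurable (fun z : ℝ × Pt n =>
      (Ioi 0).indicator c.gₚ (gNorm (c.γ z.1 z.2) (Du z.1 z.2) ^ 2)) (cylMeas Ω T) :=
    (hc.measurable_indicator_gp.comp_aemeasurable hn).aestronglyMeasurable
  refine ((hc.a₁_meas.smul hZ).add ((hc.aₚ_meas.mul hg).smul hDu)).congr ?_
  filter_upwards [hc.ae_pointBounds hΩ] with z hz
  simp only [Function.uncurry, Coeffs.flux, Pi.add_apply, Pi.smul_apply', Pi.mul_apply]
  congr 1
  rcases (gNorm_nonneg (γ := c.γ z.1 z.2) (Du z.1 z.2)).eq_or_lt with h0 | h0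
  · have h3 := hz.elliptic.norm_le hγ₀ (Du z.1 z.2)
    rw [← h0] at h3
    have h4 : Du z.1 z.2 = 0 := by
      by_contra hne
      have := mul_pos (Real.sqrt_pos.2 hγ₀) (norm_pos_iff.2 hne)
      linarith
    rw [h4, smul_zero, smul_zero]
  · rw [indicator_of_mem (mem_Ioi.2 (pow_pos h0 2))]

theorem integrable_gInner [Fact (1 < p)] {X : Type*} [MeasurableSpace X] {μ : Measure X}
    {γ : X → Matrix (Fin n) (Fin n) ℝ} (hγ₀ : 0 < γ₀)
    (hγ : ∀ α β, AEStronglyMeasurable (fun z => γ z α β) μ) (hel : ∀ᵐ z ∂μ, IsElliptic γ₀ (γ z))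
    {F G : X → Mat N n} (hF : MemLp F (ENNReal.ofReal (pConj p)) μ)
    (hG : MemLp G (ENNReal.ofReal p) μ) :
    Integrable (fun z => gInner (γ z) (F z) (G z)) μ ∧
    |∫ z, gInner (γ z) (F z) (G z) ∂μ| ≤ γ₀⁻¹ * ((eLpNorm F (ENNReal.ofReal (pConj p)) μ).toReal
      * (eLpNorm G (ENNReal.ofReal p) μ).toReal) := by
  have hm := aestronglyMeasurable_gInner hγ hF.1 hG.1
  have hi : Integrable (fun z => ‖F z‖ * ‖G z‖) μ := hF.norm.integrable_mul hG.norm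
  have hb : ∀ᵐ z ∂μ, ‖gInner (γ z) (F z) (G z)‖ ≤ γ₀⁻¹ * (‖F z‖ * ‖G z‖) := by
    filter_upwards [hel] with z hz using hz.abs_gInner_le_norm hγ₀ _ _
  refine ⟨(hi.const_mul γ₀⁻¹).mono' hm hb, ?_⟩
  rw [← Real.norm_eq_abs]
  refine (norm_integral_le_of_norm_le (hi.const_mul γ₀⁻¹) hb).trans ?_
  rw [integral_const_mul]
  gcongr
  have h1 := integral_mul_le_Lp_mul_Lq_of_nonneg (μ := μ) (holderConjugate_pConj p)
    (f := fun z => ‖F z‖) (g := fun z => ‖G z‖) (Filter.Eventually.of_forall fun _ => norm_nonneg _)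
    (Filter.Eventually.of_forall fun _ => norm_nonneg _) hF.norm hG.norm
  have hp := (holderConjugate_pConj p).symm.pos
  have hq := (holderConjugate_pConj p).pos
  rw [integral_norm_rpow hp hG.1, integral_norm_rpow hq hF.1,
    ← Real.rpow_mul ENNReal.toReal_nonneg, ← Real.rpow_mul ENNReal.toReal_nonneg,
    mul_one_div_cancel hp.ne', mul_one_div_cancel hq.ne', Real.rpow_one, Real.rpow_one] at h1
  exact h1

theorem memLp_norm_rpow_sub_one [hp : Fact (1 < p)] {X F : Type*} [MeasurableSpace X]
    [NormedAddCommGroup F] {μ : Measure X} {f : X → F} (hf : MemLp f (ENNReal.ofReal p) μ) :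
    MemLp (fun x => ‖f x‖ ^ (p - 1)) (ENNReal.ofReal (pConj p)) μ ∧
    (eLpNorm (fun x => ‖f x‖ ^ (p - 1)) (ENNReal.ofReal (pConj p)) μ).toReal
      = (eLpNorm f (ENNReal.ofReal p) μ).toReal ^ (p - 1) := by
  have hp1 : 0 < p - 1 := by linarith [hp.out]
  have hq0 : 0 < pConj p := (holderConjugate_pConj p).pos
  constructor
  · have := hf.norm_rpow_div (ENNReal.ofReal (p - 1))
    rwa [← ENNReal.ofReal_div_of_pos hp1, ENNReal.toReal_ofReal hp1.le] at this
  · have e : pConj p * (p - 1) = p := by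
      rw [pConj]
      field_simp
    rw [eLpNorm_norm_rpow _ hp1, ← ENNReal.ofReal_mul hq0.le, ENNReal.toReal_rpow, e]

/-- The flux is in `L^{p'}`, with a bound of order `p - 1` in terms of the gradient. -/
theorem Coeffs.Admissible.memLp_flux [hp : Fact (1 < p)] (hγ₀ : 0 < γ₀) (hΓ₀ : 1 < Γ₀)
    (hΩ : MeasurableSet Ω) [IsFiniteMeasure (cylMeas Ω T)]
    (hc : c.Admissible p Ω T γ₀ κ₀ Γ₀) {Du Z : ℝ → Pt n → Mat N n}
    (hDu : MemLp (Function.uncurry Du) (ENNReal.ofReal p) (cylMeas Ω T))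
    (hZ : AEStronglyMeasurable (Function.uncurry Z) (cylMeas Ω T))
    (hsub : ∀ᵐ z ∂(cylMeas Ω T), Z z.1 z.2 ∈ subdiff (c.γ z.1 z.2) (Du z.1 z.2)) {τ : ℝ}
    (hτ : τ ≤ T) :
    MemLp (Function.uncurry fun t x => c.flux t x (Du t x) (Z t x))
      (ENNReal.ofReal (pConj p)) (cylMeas Ω T) ∧
    normCyl Ω τ (pConj p) (fun t x => c.flux t x (Du t x) (Z t x))
      ≤ (√γ₀)⁻¹ * Γ₀ * ((cylMeas Ω T univ).toReal ^ (1 / pConj p))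
        + (√γ₀)⁻¹ * Γ₀ ^ 2 * (√γ₀⁻¹) ^ (p - 1) * normCyl Ω τ p Du ^ (p - 1) := by
  have hp0 : 0 < p := one_pos.trans hp.out
  have hp1 : 0 < p - 1 := by linarith [hp.out]
  have hq0 : 0 < pConj p := (holderConjugate_pConj p).pos
  have hmeas := hc.aestronglyMeasurable_flux hγ₀ hΩ hDu.1 hZ
  have hs : 0 < √γ₀ := Real.sqrt_pos.2 hγ₀
  obtain ⟨K, hK⟩ : ∃ K, K = (√γ₀)⁻¹ * Γ₀ ^ 2 * (√γ₀⁻¹) ^ (p - 1) := ⟨_, rfl⟩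
  have hK0 : 0 ≤ K := by rw [hK]; positivity
  have hb : ∀ᵐ z ∂(cylMeas Ω T),
      ‖Function.uncurry (fun t x => c.flux t x (Du t x) (Z t x)) z‖
        ≤ ‖(√γ₀)⁻¹ * Γ₀ + K * ‖Function.uncurry Du z‖ ^ (p - 1)‖ := by
    filter_upwards [hc.ae_pointBounds hΩ, hsub] with z h1 h2
    have h3 := h1.norm_flux_le hp.out hγ₀ hΓ₀ hc h2
    have h4 : ‖c.flux z.1 z.2 (Du z.1 z.2) (Z z.1 z.2)‖
        = (√γ₀)⁻¹ * (√γ₀ * ‖c.flux z.1 z.2 (Du z.1 z.2) (Z z.1 z.2)‖) := by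
      field_simp
    change ‖c.flux z.1 z.2 (Du z.1 z.2) (Z z.1 z.2)‖
      ≤ ‖(√γ₀)⁻¹ * Γ₀ + K * ‖Du z.1 z.2‖ ^ (p - 1)‖
    rw [Real.norm_of_nonneg (by positivity), h4]
    refine (mul_le_mul_of_nonneg_left h3 (by positivity)).trans_eq ?_
    rw [hK]
    ring
  have hsum : ∀ {μ : Measure (ℝ × Pt n)} [IsFiniteMeasure μ],
      MemLp (Function.uncurry Du) (ENNReal.ofReal p) μ →
      MemLp (fun z => (√γ₀)⁻¹ * Γ₀ + K * ‖Function.uncurry Du z‖ ^ (p - 1))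
        (ENNReal.ofReal (pConj p)) μ := by
    intro μ _ h
    have h1 : MemLp (fun _ : ℝ × Pt n => (√γ₀)⁻¹ * Γ₀) (ENNReal.ofReal (pConj p)) μ :=
      memLp_const _
    have h2 : MemLp (fun z => K * ‖Function.uncurry Du z‖ ^ (p - 1))
        (ENNReal.ofReal (pConj p)) μ := (memLp_norm_rpow_sub_one h).1.const_mul K
    exact h1.add h2
  refine ⟨(hsum hDu).mono hmeas hb, ?_⟩
  have hle := cylMeas_mono Ω hτ
  have hfin : IsFiniteMeasure (cylMeas Ω τ) :=
    ⟨(hle univ).trans_lt (measure_lt_top _ _)⟩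
  have hDτ := hDu.mono_measure hle
  have e1 : normCyl Ω τ (pConj p) (fun t x => c.flux t x (Du t x) (Z t x))
      ≤ (eLpNorm (fun z => (√γ₀)⁻¹ * Γ₀ + K * ‖Function.uncurry Du z‖ ^ (p - 1))
        (ENNReal.ofReal (pConj p)) (cylMeas Ω τ)).toReal :=
    ENNReal.toReal_mono (hsum hDτ).eLpNorm_ne_top (eLpNorm_mono_ae (ae_mono hle hb))
  refine e1.trans ((toReal_eLpNorm_add_le (fact_one_le_ofReal (pConj p)).out
    (memLp_const _) ((memLp_norm_rpow_sub_one hDτ).1.const_mul K) (Filter.EventuallyEq.refl _ _)).trans ?_)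
  rw [← hK]
  refine add_le_add ?_ ?_
  -- The constant part is bounded with the measure of the full cylinder, which makes the bound
  -- uniform in τ.
  · rw [eLpNorm_const' _ (by simpa using hq0) ENNReal.ofReal_ne_top, ENNReal.toReal_mul,
      toReal_enorm, Real.norm_of_nonneg (by positivity), ENNReal.toReal_ofReal hq0.le,
      ← ENNReal.toReal_rpow]
    gcongr
    · exact measure_ne_top _ _
  · have := toReal_eLpNorm_smul (q := ENNReal.ofReal (pConj p)) (μ := cylMeas Ω τ) K
      (f := fun z => ‖Function.uncurry Du z‖ ^ (p - 1))
      (h := fun z => K * ‖Function.uncurry Du z‖ ^ (p - 1)) (Filter.EventuallyEq.refl _ _)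
    rw [this, (memLp_norm_rpow_sub_one hDτ).2, Real.norm_of_nonneg hK0]
    rfl

end fluxOnCylinder

/-! ### Suprema in time -/

section suprema

variable {n N : ℕ} {Ω : Set (Pt n)} {T : ℝ}

/-- A real supremum of an unbounded family is 0 by convention; continuity on the compact interval
[0, T] makes `supSq` a genuine supremum. -/
theorem bddAbove_norm_sq {w : ℝ → L2 N Ω} (hw : ContinuousOn w (Icc 0 T)) :
    BddAbove (range fun τ : Ioo (0 : ℝ) T => ‖w τ‖ ^ 2) := by
  have := (isCompact_Icc.image_of_continuousOn (hw.norm.pow 2)).bddAbove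
  refine this.mono ?_
  rintro _ ⟨τ, rfl⟩
  exact ⟨τ, Ioo_subset_Icc_self τ.2, rfl⟩

theorem norm_sq_le_supSq {w : ℝ → L2 N Ω} (hw : ContinuousOn w (Icc 0 T)) {τ : ℝ}
    (hτ : τ ∈ Ioo 0 T) : ‖w τ‖ ^ 2 ≤ supSq T w :=
  le_ciSup (bddAbove_norm_sq hw) ⟨τ, hτ⟩

theorem supSq_nonneg (w : ℝ → L2 N Ω) : 0 ≤ supSq T w :=
  Real.iSup_nonneg fun _ => by positivity

theorem supSq_le (hT : 0 < T) {w : ℝ → L2 N Ω} {R : ℝ} (h : ∀ τ ∈ Ioo 0 T, ‖w τ‖ ^ 2 ≤ R) :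
    supSq T w ≤ R := by
  have : Nonempty (Ioo (0 : ℝ) T) := ⟨⟨T / 2, by linarith, by linarith⟩⟩
  exact ciSup_le fun τ => h τ τ.2

theorem norm_le_sqrt_supSq {w : ℝ → L2 N Ω} (hw : ContinuousOn w (Icc 0 T)) {τ : ℝ}
    (hτ : τ ∈ Ioo 0 T) : ‖w τ‖ ≤ √(supSq T w) :=
  Real.le_sqrt_of_sq_le (norm_sq_le_supSq hw hτ)

theorem normCyl_mono {s τ : ℝ} {G : ℝ → Pt n → Mat N n}
    (hG : MemLp (Function.uncurry G) (ENNReal.ofReal s) (cylMeas Ω T)) (hτ : τ ≤ T) :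
    normCyl Ω τ s G ≤ normCyl Ω T s G :=
  ENNReal.toReal_mono hG.eLpNorm_ne_top (eLpNorm_mono_measure _ (cylMeas_mono Ω hτ))

theorem integrable_inner_of_continuousOn {f w : ℝ → L2 N Ω} (hf : MemLp f 1 (timeMeas T))
    (hw : ContinuousOn w (Icc 0 T)) {τ : ℝ} (hτ : τ ≤ T) :
    Integrable (fun t => (inner ℝ (f t) (w t) : ℝ)) (timeMeas τ) := by
  have hfτ := hf.mono_measure (timeMeas_mono hτ)
  have hwm : AEStronglyMeasurable w (timeMeas τ) :=
    (hw.mono ((Ioo_subset_Ioo_right hτ).trans Ioo_subset_Icc_self)).aestronglyMeasurable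
      measurableSet_Ioo
  have hfi : Integrable (fun t => ‖f t‖ * √(supSq T w)) (timeMeas τ) :=
    ((memLp_one_iff_integrable.1 hfτ).norm).mul_const _
  refine hfi.mono' (hfτ.1.inner hwm) ?_
  filter_upwards [ae_restrict_mem measurableSet_Ioo] with t ht
  refine (norm_inner_le_norm _ _).trans ?_
  gcongr
  exact norm_le_sqrt_supSq hw (Ioo_subset_Ioo_right hτ ht)

theorem abs_integral_inner_le {f w : ℝ → L2 N Ω} (hf : MemLp f 1 (timeMeas T))
    (hw : ContinuousOn w (Icc 0 T)) {τ : ℝ} (hτ : τ ≤ T) :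
    |∫ t, inner ℝ (f t) (w t) ∂(timeMeas τ)| ≤ √(supSq T w) * normL21 Ω T f := by
  have hfi : Integrable (fun t => ‖f t‖ * √(supSq T w)) (timeMeas τ) :=
    ((memLp_one_iff_integrable.1 (hf.mono_measure (timeMeas_mono hτ))).norm).mul_const _
  rw [← Real.norm_eq_abs]
  refine (norm_integral_le_of_norm_le hfi ?_).trans ?_
  · filter_upwards [ae_restrict_mem measurableSet_Ioo] with t ht
    refine (norm_inner_le_norm _ _).trans ?_
    gcongr
    exact norm_le_sqrt_supSq hw (Ioo_subset_Ioo_right hτ ht)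
  · rw [integral_mul_const, mul_comm]
    gcongr
    rw [integral_norm_eq_lintegral_enorm (hf.mono_measure (timeMeas_mono hτ)).1,
      ← eLpNorm_one_eq_lintegral_enorm]
    exact ENNReal.toReal_mono hf.eLpNorm_ne_top (eLpNorm_mono_measure _ (timeMeas_mono hτ))

end suprema

/-! ### Testing the weak formulation on `(0, τ)` -/

section testing

variable {n N : ℕ} [hn : Fact (2 ≤ n)] {p : ℝ} [hp : Fact (1 < p)] {Ω : Set (Pt n)}
  [hΩ : IsBoundedLipschitzDomain Ω] {T : ℝ}

instance isFiniteMeasure_cylMeas : IsFiniteMeasure (cylMeas Ω T) := by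
  have : IsFiniteMeasure (timeMeas T) :=
    ⟨by rw [Measure.restrict_apply_univ]; exact measure_Ioo_lt_top⟩
  infer_instance

/-- Differences of admissible functions with zero lateral values, as `V_0`-valued functions with
known gradients. -/
theorem exists_V0_valued {u v : ℝ → L2 N Ω} {Du Dv : ℝ → Pt n → Mat N n} {u' v' : ℝ → V0' N p Ω}
    (hu : MemXC p Ω T u Du u') (hv : MemXC p Ω T v Dv v')
    (h : MemX0 p Ω T (fun t => u t - v t)) :
    ∃ W : ℝ → V0 N p Ω, MemLp W (ENNReal.ofReal p) (timeMeas T) ∧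
      ∀ᵐ t ∂(timeMeas T), (W t).fn =ᵐ[spaceMeas Ω] (u t - v t : L2 N Ω) ∧
        (W t).grad =ᵐ[spaceMeas Ω] fun x => Du t x - Dv t x := by
  obtain ⟨⟨W, hW, hWw⟩, -⟩ := h
  obtain ⟨U, -, hU⟩ := hu.bochner
  obtain ⟨V, -, hV⟩ := hv.bochner
  refine ⟨W, hW, ?_⟩
  filter_upwards [hWw, hU, hV] with t h1 h2 h3
  refine ⟨h1, ?_⟩
  -- W(t) and U(t) − V(t) have the same underlying function and both consist of a function and a
  -- weak gradient, so their gradients agree.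
  have h4 : (W t).grad =ᵐ[spaceMeas Ω] ((U t).grad - (V t).grad : Lp _ _ _) := by
    refine grad_ae_eq_of_fn_ae_eq hΩ.isOpen (w₁ := (W t).1) (w₂ := (U t).1 - (V t).1)
      (W01p_le_W1p (W t).2.1) ((W1p N p Ω).sub_mem (U t).2.1 (V t).2.1) ?_
    refine h1.trans ?_
    have e1 := Lp.coeFn_sub (u t) (v t)
    have e2 := Lp.coeFn_sub (U t).fn (V t).fn
    filter_upwards [e1, e2, h2.1, h3.1] with x k1 k2 k3 k4
    refine k1.trans (Eq.trans ?_ k2.symm)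
    simp only [Pi.sub_apply, k3, k4]
  filter_upwards [h4, Lp.coeFn_sub (U t).grad (V t).grad, h2.2, h3.2] with x k1 k2 k3 k4
  rw [k1, k2, Pi.sub_apply, k3, k4]

theorem timeMeas_restrict_Iio {τ : ℝ} (hτ : τ ≤ T) : (timeMeas T).restrict (Iio τ) = timeMeas τ := by
  rw [Measure.restrict_restrict measurableSet_Iio]
  congr 1
  ext t
  simp only [mem_inter_iff, mem_Iio, mem_Ioo]
  exact ⟨fun h => ⟨h.2.1, h.1⟩, fun h => ⟨h.2, h.1, h.2.trans_le hτ⟩⟩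

theorem integral_timeMeas_ite {τ : ℝ} (hτ : τ ≤ T) {f g : ℝ → ℝ}
    (h1 : ∀ t, t < τ → g t = f t) (h2 : ∀ t, ¬ t < τ → g t = 0) :
    ∫ t, g t ∂(timeMeas T) = ∫ t, f t ∂(timeMeas τ) := by
  rw [← timeMeas_restrict_Iio hτ, ← integral_indicator measurableSet_Iio]
  congr 1
  ext t
  by_cases h : t < τ
  · rw [h1 t h, indicator_of_mem (mem_Iio.2 h)]
  · rw [h2 t h, indicator_of_notMem (fun hh => h (mem_Iio.1 hh))]

variable {c : Coeffs n} {γ₀ κ₀ Γ₀ : ℝ}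

theorem IsWeakSol.memLp_flux (hγ₀ : 0 < γ₀) (hΓ₀ : 1 < Γ₀) (hc : c.Admissible p Ω T γ₀ κ₀ Γ₀)
    {f u : ℝ → L2 N Ω} {Du Z : ℝ → Pt n → Mat N n} (hu : IsWeakSol p Ω T c f u Du Z) :
    MemLp (Function.uncurry fun t x => c.flux t x (Du t x) (Z t x))
      (ENNReal.ofReal (pConj p)) (cylMeas Ω T) := by
  obtain ⟨u', hu', -⟩ := hu.weak
  exact (hc.memLp_flux hγ₀ hΓ₀ hΩ.isOpen.measurableSet hu'.memLp_grad hu.Z_memLp.1 hu.Z_mem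
    le_rfl).1

theorem IsWeakSol.integrable_flux (hγ₀ : 0 < γ₀) (hΓ₀ : 1 < Γ₀)
    (hc : c.Admissible p Ω T γ₀ κ₀ Γ₀)
    {f u : ℝ → L2 N Ω} {Du Z : ℝ → Pt n → Mat N n} (hu : IsWeakSol p Ω T c f u Du Z)
    {G : ℝ → Pt n → Mat N n} (hG : MemLp (Function.uncurry G) (ENNReal.ofReal p) (cylMeas Ω T))
    {τ : ℝ} (hτ : τ ≤ T) :
    Integrable (fun z => gInner (c.γ z.1 z.2) (c.flux z.1 z.2 (Du z.1 z.2) (Z z.1 z.2))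
      (G z.1 z.2)) (cylMeas Ω τ) ∧
    |∫ z, gInner (c.γ z.1 z.2) (c.flux z.1 z.2 (Du z.1 z.2) (Z z.1 z.2))
      (G z.1 z.2) ∂(cylMeas Ω τ)| ≤ γ₀⁻¹ * (normCyl Ω τ (pConj p)
        (fun t x => c.flux t x (Du t x) (Z t x)) * normCyl Ω τ p G) := by
  have hle := cylMeas_mono Ω hτ
  have hF : MemLp (fun z : ℝ × Pt n => c.flux z.1 z.2 (Du z.1 z.2) (Z z.1 z.2))
      (ENNReal.ofReal (pConj p)) (cylMeas Ω τ) :=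
    (hu.memLp_flux hγ₀ hΓ₀ hc).mono_measure hle
  have hG' : MemLp (fun z : ℝ × Pt n => G z.1 z.2) (ENNReal.ofReal p) (cylMeas Ω τ) :=
    hG.mono_measure hle
  have hel : ∀ᵐ z ∂(cylMeas Ω τ), IsElliptic γ₀ (c.γ z.1 z.2) := ae_mono hle
    ((hc.ae_pointBounds hΩ.isOpen.measurableSet).mono fun _ h => h.elliptic)
  exact integrable_gInner hγ₀ (fun α β => (hc.γ_meas α β).mono_measure hle) hel hF hG'

/-- The weak formulation for a test function cut off at time `τ`. -/
theorem IsWeakSol.weak_cutoff (hγ₀ : 0 < γ₀) (hΓ₀ : 1 < Γ₀)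
    (hc : c.Admissible p Ω T γ₀ κ₀ Γ₀)
    {f u : ℝ → L2 N Ω} {Du Z : ℝ → Pt n → Mat N n} (hu : IsWeakSol p Ω T c f u Du Z) :
    ∃ u' : ℝ → V0' N p Ω, MemXC p Ω T u Du u' ∧
      ∀ (Φ : ℝ → V0 N p Ω) (φ : ℝ → L2 N Ω) (G : ℝ → Pt n → Mat N n),
        MemLp Φ (ENNReal.ofReal p) (timeMeas T) →
        MemLp (Function.uncurry G) (ENNReal.ofReal p) (cylMeas Ω T) →
        (∀ᵐ t ∂(timeMeas T), (Φ t).fn =ᵐ[spaceMeas Ω] φ t ∧ (Φ t).grad =ᵐ[spaceMeas Ω] G t) →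
        ∀ τ ≤ T, ∫ t, u' t (Φ t) ∂(timeMeas τ)
          + ∫ z, gInner (c.γ z.1 z.2) (c.flux z.1 z.2 (Du z.1 z.2) (Z z.1 z.2)) (G z.1 z.2)
              ∂(cylMeas Ω τ)
          = ∫ t, inner ℝ (f t) (φ t) ∂(timeMeas τ) := by
  obtain ⟨u', hu', hweak⟩ := hu.weak
  refine ⟨u', hu', fun Φ φ G hΦ hG hΦG τ hτ => ?_⟩
  -- Test functions need no regularity in time, so a sharp cut-off at τ is admissible.
  have h := hweak ((Iio τ).indicator Φ) (hΦ.indicator measurableSet_Iio)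
  have in_of : ∀ t, t < τ → (Iio τ).indicator Φ t = Φ t := fun t ht =>
    indicator_of_mem (mem_Iio.2 ht) _
  have out_of : ∀ t, ¬ t < τ → (Iio τ).indicator Φ t = 0 := fun t ht =>
    indicator_of_notMem (fun h => ht (mem_Iio.1 h)) _
  have z1 : (0 : V0 N p Ω).fn =ᵐ[spaceMeas Ω] 0 := Lp.coeFn_zero _ _ _
  have z2 : (0 : V0 N p Ω).grad =ᵐ[spaceMeas Ω] 0 := Lp.coeFn_zero _ _ _
  rw [integral_timeMeas_ite hτ (f := fun t => u' t (Φ t)) (fun t ht => by rw [in_of t ht])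
      (fun t ht => by rw [out_of t ht, map_zero]),
    integral_timeMeas_ite hτ (f := fun t => ∫ x, gInner (c.γ t x)
      (c.flux t x (Du t x) (Z t x)) ((Φ t).grad x) ∂(spaceMeas Ω))
      (fun t ht => by rw [in_of t ht])
      (fun t ht => by
        rw [out_of t ht]
        refine integral_eq_zero_of_ae ?_
        filter_upwards [z2] with x hx
        rw [hx]
        exact gInner_zero_right _),
    integral_timeMeas_ite hτ (f := fun t => ∫ x, inner ℝ (f t x) ((Φ t).fn x) ∂(spaceMeas Ω))
      (fun t ht => by rw [in_of t ht])
      (fun t ht => by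
        rw [out_of t ht]
        refine integral_eq_zero_of_ae ?_
        filter_upwards [z1] with x hx
        rw [hx]
        exact inner_zero_right _)] at h
  have hΦτ := ae_mono (timeMeas_mono hτ) hΦG
  have e1 : ∫ t, ∫ x, gInner (c.γ t x) (c.flux t x (Du t x) (Z t x)) ((Φ t).grad x)
        ∂(spaceMeas Ω) ∂(timeMeas τ)
      = ∫ z, gInner (c.γ z.1 z.2) (c.flux z.1 z.2 (Du z.1 z.2) (Z z.1 z.2)) (G z.1 z.2)
              ∂(cylMeas Ω τ) := by
    rw [integral_prod _ (hu.integrable_flux hγ₀ hΓ₀ hc hG hτ).1]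
    refine integral_congr_ae ?_
    filter_upwards [hΦτ] with t ht
    refine integral_congr_ae ?_
    filter_upwards [ht.2] with x hx
    rw [hx]
  have e2 : ∫ t, ∫ x, inner ℝ (f t x) ((Φ t).fn x) ∂(spaceMeas Ω) ∂(timeMeas τ)
      = ∫ t, inner ℝ (f t) (φ t) ∂(timeMeas τ) := by
    refine integral_congr_ae ?_
    filter_upwards [hΦτ] with t ht
    rw [L2.inner_def]
    refine integral_congr_ae ?_
    filter_upwards [ht.1] with x hx
    rw [hx]
  rw [e1, e2] at h
  exact h

/-! ### Bounds for the terms of the energy balance -/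

theorem abs_integral_dual_le {F : ℝ → V0' N p Ω} {W : ℝ → V0 N p Ω}
    (hF : MemLp F (ENNReal.ofReal (pConj p)) (timeMeas T))
    (hW : MemLp W (ENNReal.ofReal p) (timeMeas T)) {τ : ℝ} (hτ : τ ≤ T) :
    |∫ t, F t (W t) ∂(timeMeas τ)| ≤ normDual p Ω T F
      * (eLpNorm W (ENNReal.ofReal p) (timeMeas τ)).toReal := by
  have hle := timeMeas_mono hτ
  have hi : Integrable (fun t => ‖F t‖ * ‖W t‖) (timeMeas τ) :=
    (hF.mono_measure hle).norm.integrable_mul (hW.mono_measure hle).norm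
  rw [← Real.norm_eq_abs]
  refine (norm_integral_le_of_norm_le hi
    (Filter.Eventually.of_forall fun t => (F t).le_opNorm _)).trans ?_
  have h1 := integral_mul_le_Lp_mul_Lq_of_nonneg (μ := timeMeas τ) (holderConjugate_pConj p)
    (f := fun z => ‖F z‖) (g := fun z => ‖W z‖) (Filter.Eventually.of_forall fun _ => norm_nonneg _)
    (Filter.Eventually.of_forall fun _ => norm_nonneg _) (hF.mono_measure hle).norm
    (hW.mono_measure hle).norm
  have hp := (holderConjugate_pConj p).symm.pos
  have hq := (holderConjugate_pConj p).pos
  rw [integral_norm_rpow hp (hW.mono_measure hle).1, integral_norm_rpow hq (hF.mono_measure hle).1,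
    ← Real.rpow_mul ENNReal.toReal_nonneg, ← Real.rpow_mul ENNReal.toReal_nonneg,
    mul_one_div_cancel hp.ne', mul_one_div_cancel hq.ne', Real.rpow_one, Real.rpow_one] at h1
  refine h1.trans ?_
  gcongr
  exact ENNReal.toReal_mono hF.eLpNorm_ne_top (eLpNorm_mono_measure _ hle)

end testing

/-! ### Absorption of terms by Young's inequality -/

section young

theorem young_eps {p q : ℝ} (hpq : p.HolderConjugate q) {δ : ℝ} (hδ : 0 < δ) :
    ∃ C : ℝ, 0 < C ∧ ∀ a b : ℝ, 0 ≤ a → 0 ≤ b → a * b ≤ δ * a ^ p + C * b ^ q := by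
  -- Young's inequality is applied to (la)(b/l), with l chosen so that l^p = δ.
  obtain ⟨l, hl⟩ : ∃ l, l = δ ^ (1 / p) := ⟨_, rfl⟩
  have hl0 : 0 < l := hl ▸ Real.rpow_pos_of_pos hδ _
  have hlp : l ^ p = δ := by
    rw [hl, ← Real.rpow_mul hδ.le, one_div_mul_cancel hpq.pos.ne', Real.rpow_one]
  refine ⟨(l⁻¹) ^ q, by positivity, fun a b ha hb => ?_⟩
  have h := Real.young_inequality_of_nonneg (mul_nonneg hl0.le ha)
    (mul_nonneg (inv_nonneg.2 hl0.le) hb) hpq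
  have e : l * a * (l⁻¹ * b) = a * b := by field_simp
  rw [e, Real.mul_rpow hl0.le ha, Real.mul_rpow (by positivity) hb, hlp] at h
  refine h.trans (add_le_add (div_le_self (by positivity) hpq.lt.le)
    (div_le_self (by positivity) hpq.symm.lt.le))

theorem le_one_add_rpow {q b : ℝ} (hq : 1 ≤ q) (hb : 0 ≤ b) : b ≤ 1 + b ^ q := by
  rcases le_total b 1 with h | h
  · linarith [Real.rpow_nonneg hb q]
  · have := Real.self_le_rpow_of_one_le h hq
    linarith

theorem sq_le_one_add_rpow {q b : ℝ} (hq : 2 ≤ q) (hb : 0 ≤ b) : b ^ 2 ≤ 1 + b ^ q := by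
  have := le_one_add_rpow (q := q / 2) (by linarith) (sq_nonneg b)
  have e : (b ^ 2) ^ (q / 2) = b ^ q := by
    rw [← Real.rpow_natCast b 2, ← Real.rpow_mul hb, Nat.cast_ofNat, mul_div_cancel₀ q two_ne_zero]
  rwa [e] at this

/-- The letters stand for m = ‖w(τ)‖, X = ‖Du‖ on (0, τ), D = ‖Dv‖, F = ‖f‖, B = ‖∂_t v‖ and M =
(sup‖w‖²)^(1/2), while P is the case p ≤ p_c. Two terms of size c₀X^p/4 are absorbed on the left.
Two of size M²/16 remain on the right, to be absorbed after taking the supremum over τ. In case P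
the product BM costs B², which B^q dominates up to 1 because q ≥ 2. -/
theorem energy_absorption {p q : ℝ} (hpq : p.HolderConjugate q) {c₀ K L : ℝ} (hc₀ : 0 < c₀)
    (hK : 0 ≤ K) (P : Prop) [Decidable P] (hP : P → 2 ≤ q) :
    ∃ C : ℝ, 0 < C ∧ ∀ m X D F B M : ℝ, 0 ≤ X → 0 ≤ D → 0 ≤ B →
      1 / 2 * m ^ 2 + c₀ * X ^ p ≤ K * (1 + X ^ (p - 1)) * D + M * F
        + B * (X + D + if P then L * M else 0) →
      1 / 2 * m ^ 2 + c₀ / 2 * X ^ p ≤ 1 / 8 * M ^ 2 + C * (B ^ q + D ^ p + F ^ 2 + 1) := by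
  have hp1 : 1 < p := hpq.lt
  have hδ : 0 < c₀ / 4 := by positivity
  obtain ⟨C₁, hC₁, h₁⟩ := young_eps hpq hδ
  obtain ⟨C₂, hC₂, h₂⟩ := young_eps hpq.symm (δ := c₀ / 4) hδ
  -- This sum dominates the coefficient of each of B^q, D^p, F² and 1 arising in `a1`–`a6`; 5 = 4 +
  -- 1 comes from `a4` and `a5`.
  refine ⟨C₁ + C₂ * K ^ p + K + 4 * L ^ 2 + 5, by positivity,
    fun m X D F B M hX hD hB h => ?_⟩
  have hBq : 0 ≤ B ^ q := by positivity
  have hDp : 0 ≤ D ^ p := by positivity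
  have a1 : X * B ≤ c₀ / 4 * X ^ p + C₁ * B ^ q := h₁ X B hX hB
  have a2 : X ^ (p - 1) * (K * D) ≤ c₀ / 4 * X ^ p + C₂ * (K ^ p * D ^ p) := by
    have := h₂ (X ^ (p - 1)) (K * D) (by positivity) (by positivity)
    rwa [← Real.rpow_mul hX, hpq.sub_one_mul_conj, Real.mul_rpow hK hD] at this
  have a3 : K * D ≤ K * (1 + D ^ p) := by
    gcongr
    exact le_one_add_rpow hp1.le hD
  have a4 : M * F ≤ 1 / 16 * M ^ 2 + 4 * F ^ 2 := by nlinarith [sq_nonneg (M / 4 - 2 * F)]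
  have a5 : D * B ≤ D ^ p + B ^ q := by
    have := Real.young_inequality_of_nonneg hD hB hpq
    refine this.trans (add_le_add (div_le_self hDp hpq.lt.le) (div_le_self hBq hpq.symm.lt.le))
  have a6 : B * (if P then L * M else 0) ≤ 1 / 16 * M ^ 2 + 4 * L ^ 2 * (1 + B ^ q) := by
    split_ifs with hh
    · have s1 := sq_le_one_add_rpow (hP hh) hB
      have s2 : B * (L * M) ≤ 1 / 16 * M ^ 2 + 4 * L ^ 2 * B ^ 2 := by
        nlinarith [sq_nonneg (M / 4 - 2 * (L * B))]
      have s3 : 4 * L ^ 2 * B ^ 2 ≤ 4 * L ^ 2 * (1 + B ^ q) := by gcongr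
      linarith
    · rw [mul_zero]
      positivity
  have b1 : 0 ≤ C₁ * (D ^ p + F ^ 2 + 1) := by positivity
  have b2 : 0 ≤ C₂ * K ^ p * (B ^ q + F ^ 2 + 1) := by positivity
  have b3 : 0 ≤ K * (B ^ q + F ^ 2) := by positivity
  have b4 : 0 ≤ 4 * L ^ 2 * (D ^ p + F ^ 2) := by positivity
  have b5 : 0 ≤ F ^ 2 := sq_nonneg F
  linarith

end young

/-! ### Norms of `V_0`-valued functions -/

section v0Norm

variable {n N : ℕ} {p : ℝ} {Ω : Set (Pt n)}

theorem ite_eLpNorm_nonneg (w : Pt n → Vec N) :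
    0 ≤ if p ≤ pCrit n then (eLpNorm w 2 (spaceMeas Ω)).toReal else 0 := by
  split_ifs
  · exact ENNReal.toReal_nonneg
  · exact le_rfl

theorem v0Norm_nonneg (w : Pt n → Vec N) (G : Pt n → Mat N n) : 0 ≤ v0Norm p Ω w G :=
  add_nonneg ENNReal.toReal_nonneg (ite_eLpNorm_nonneg w)

theorem v0Norm_congr {w₁ w₂ : Pt n → Vec N} {G₁ G₂ : Pt n → Mat N n}
    (h1 : w₁ =ᵐ[spaceMeas Ω] w₂) (h2 : G₁ =ᵐ[spaceMeas Ω] G₂) :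
    v0Norm p Ω w₁ G₁ = v0Norm p Ω w₂ G₂ := by
  rw [v0Norm, v0Norm, eLpNorm_congr_ae h1, eLpNorm_congr_ae h2]

theorem v0Norm_sub_le [Fact (1 < p)] {w₁ w₂ w : L2 N Ω} {G₁ G₂ G : Pt n → Mat N n}
    (h₁ : MemLp G₁ (ENNReal.ofReal p) (spaceMeas Ω))
    (h₂ : MemLp G₂ (ENNReal.ofReal p) (spaceMeas Ω)) (hw : w = w₁ - w₂)
    (hG : G = fun x => G₁ x - G₂ x) :
    v0Norm p Ω w G ≤ v0Norm p Ω w₁ G₁ + v0Norm p Ω w₂ G₂ := by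
  have h3 := toReal_eLpNorm_add_le (fact_one_le_ofReal p).out h₁ h₂.neg (h := G)
    (Filter.Eventually.of_forall fun x => by rw [hG]; simp [sub_eq_add_neg])
  rw [eLpNorm_neg] at h3
  rw [v0Norm, v0Norm, v0Norm]
  split_ifs
  · have h4 := norm_sub_le w₁ w₂
    rw [← hw, Lp.norm_def, Lp.norm_def, Lp.norm_def] at h4
    linarith
  · simpa using h3

/-- By the triangle inequality the `V_0` expression is 1-Lipschitz on `V`; this yields measurability
in time for functions that need not vanish on the boundary. -/
theorem continuous_V_v0Norm [Fact (1 < p)] : Continuous fun φ : V N p Ω => v0Norm p Ω φ.fn φ.grad := by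
  have h : ∀ φ ψ : V N p Ω, v0Norm p Ω φ.fn φ.grad - v0Norm p Ω ψ.fn ψ.grad ≤ ‖φ - ψ‖ := by
    intro φ ψ
    have h1 : v0Norm p Ω (φ - ψ + ψ).fn (φ - ψ + ψ).grad
        ≤ v0Norm p Ω (φ - ψ).fn (φ - ψ).grad + v0Norm p Ω ψ.fn ψ.grad :=
      v0Norm_add_le (W1p N p Ω) (φ - ψ) ψ
    rw [sub_add_cancel] at h1
    rw [V.norm_def]
    linarith [norm_nonneg (φ - ψ).fn]
  refine (LipschitzWith.of_dist_le_mul (K := 1) fun φ ψ => ?_).continuous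
  rw [dist_eq_norm, dist_eq_norm, NNReal.coe_one, one_mul, Real.norm_eq_abs, abs_le]
  have h1 := h φ ψ
  have h2 := h ψ φ
  rw [norm_sub_rev] at h2
  constructor <;> linarith

end v0Norm

/-! ### Norms in L^p(0,T;V_0) and their bounds by norms on the cylinder. -/

section normsV0

variable {n N : ℕ} [hn : Fact (2 ≤ n)] {p : ℝ} [hp : Fact (1 < p)] {Ω : Set (Pt n)}
  [hΩ : IsBoundedLipschitzDomain Ω] {T : ℝ}

theorem continuous_V0_grad : Continuous (V0.grad : V0 N p Ω → _) := by
  refine (LipschitzWith.of_dist_le_mul (K := 1) fun φ ψ => ?_).continuous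
  rw [dist_eq_norm, dist_eq_norm, NNReal.coe_one, one_mul]
  change ‖(φ - ψ).grad‖ ≤ ‖φ - ψ‖
  rw [V0.norm_def, v0Norm, Lp.norm_def]
  exact le_add_of_nonneg_right (ite_eLpNorm_nonneg _)

/-- Domination by the `V`-norm makes `normLpV0` of a difference finite, so its `toReal` is not a
default value. -/
theorem memLp_v0Norm_sub {u₁ u₂ : ℝ → L2 N Ω} {Du₁ Du₂ : ℝ → Pt n → Mat N n}
    {u₁' u₂' : ℝ → V0' N p Ω} (h₁ : MemXC p Ω T u₁ Du₁ u₁') (h₂ : MemXC p Ω T u₂ Du₂ u₂') :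
    MemLp (fun t => v0Norm p Ω (u₁ t - u₂ t : L2 N Ω) (fun x => Du₁ t x - Du₂ t x))
      (ENNReal.ofReal p) (timeMeas T) := by
  obtain ⟨U₁, hU₁, k₁⟩ := h₁.bochner
  obtain ⟨U₂, hU₂, k₂⟩ := h₂.bochner
  have hU := hU₁.sub hU₂
  have h3 : MemLp (fun t => v0Norm p Ω (U₁ t - U₂ t).fn (U₁ t - U₂ t).grad)
      (ENNReal.ofReal p) (timeMeas T) := by
    refine hU.mono (continuous_V_v0Norm.comp_aestronglyMeasurable hU.1)
      (Filter.Eventually.of_forall fun t => ?_)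
    rw [Real.norm_of_nonneg (v0Norm_nonneg _ _), Pi.sub_apply, V.norm_def]
    exact le_add_of_nonneg_left (norm_nonneg _)
  refine (memLp_congr_ae ?_).1 h3
  filter_upwards [k₁, k₂] with t h1 h2
  refine v0Norm_congr ?_ ?_
  · filter_upwards [Lp.coeFn_sub (U₁ t).fn (U₂ t).fn, Lp.coeFn_sub (u₁ t) (u₂ t), h1.1, h2.1]
      with x e1 e2 e3 e4
    rw [e2, Pi.sub_apply, ← e3, ← e4]
    exact e1
  · filter_upwards [Lp.coeFn_sub (U₁ t).grad (U₂ t).grad, h1.2, h2.2] with x e1 e3 e4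
    rw [← e3, ← e4]
    exact e1

theorem MemXC.ae_memLp_grad {u : ℝ → L2 N Ω} {Du : ℝ → Pt n → Mat N n} {u' : ℝ → V0' N p Ω}
    (hu : MemXC p Ω T u Du u') :
    ∀ᵐ t ∂(timeMeas T), MemLp (Du t) (ENNReal.ofReal p) (spaceMeas Ω) := by
  obtain ⟨U, -, hU⟩ := hu.bochner
  filter_upwards [hU] with t ht
  exact (memLp_congr_ae ht.2).1 (Lp.memLp _)

/-- At a.e. time W = (u₁ − u₂) − (v₁ − v₂). Neither difference need lie in `V_0`, but the formula
for the norm still obeys the triangle inequality. -/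
theorem eLpNorm_V0_le_normLpV0 {u₁ u₂ v₁ v₂ : ℝ → L2 N Ω} {Du₁ Du₂ Dv₁ Dv₂ : ℝ → Pt n → Mat N n}
    {u₁' u₂' v₁' v₂' : ℝ → V0' N p Ω} (hu₁ : MemXC p Ω T u₁ Du₁ u₁')
    (hu₂ : MemXC p Ω T u₂ Du₂ u₂') (hv₁ : MemXC p Ω T v₁ Dv₁ v₁') (hv₂ : MemXC p Ω T v₂ Dv₂ v₂')
    {W : ℝ → V0 N p Ω} (hW : ∀ᵐ t ∂(timeMeas T),
      (W t).fn =ᵐ[spaceMeas Ω] (u₁ t - v₁ t - (u₂ t - v₂ t) : L2 N Ω) ∧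
      (W t).grad =ᵐ[spaceMeas Ω] fun x => Du₁ t x - Dv₁ t x - (Du₂ t x - Dv₂ t x))
    {τ : ℝ} (hτ : τ ≤ T) :
    (eLpNorm W (ENNReal.ofReal p) (timeMeas τ)).toReal
      ≤ normLpV0 p Ω T (fun t => u₁ t - u₂ t) (fun t x => Du₁ t x - Du₂ t x)
        + normLpV0 p Ω T (fun t => v₁ t - v₂ t) (fun t x => Dv₁ t x - Dv₂ t x) := by
  have m1 := memLp_v0Norm_sub hu₁ hu₂
  have m2 := memLp_v0Norm_sub hv₁ hv₂
  refine le_trans ?_ (toReal_eLpNorm_add_le (fact_one_le_ofReal p).out m1 m2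
    (Filter.EventuallyEq.refl _ _))
  refine ENNReal.toReal_mono (m1.add m2).eLpNorm_ne_top ?_
  refine (eLpNorm_mono_measure _ (timeMeas_mono hτ)).trans (eLpNorm_mono_ae ?_)
  filter_upwards [hW, hu₁.ae_memLp_grad, hu₂.ae_memLp_grad, hv₁.ae_memLp_grad,
    hv₂.ae_memLp_grad] with t h1 k1 k2 k3 k4
  rw [V0.norm_def, v0Norm_congr h1.1 h1.2, Pi.add_apply]
  refine (v0Norm_sub_le (k1.sub k2) (k3.sub k4) (w₁ := u₁ t - u₂ t) (w₂ := v₁ t - v₂ t)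
    (by abel) (by ext1 x; simp only [Pi.sub_apply]; abel)).trans (le_abs_self _)

/-- The gradient part of the norm is an L^p norm on the cylinder by Tonelli. The L² part, present
for p ≤ p_c, is bounded by a constant in time, whose L^p norm produces T^(1/p). -/
theorem eLpNorm_V0_le_normCyl {w : ℝ → L2 N Ω} {G : ℝ → Pt n → Mat N n} (hT : 0 < T)
    (hw : ContinuousOn w (Icc 0 T))
    (hG : MemLp (Function.uncurry G) (ENNReal.ofReal p) (cylMeas Ω T))
    {W : ℝ → V0 N p Ω} (hWm : MemLp W (ENNReal.ofReal p) (timeMeas T))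
    (hW : ∀ᵐ t ∂(timeMeas T), (W t).fn =ᵐ[spaceMeas Ω] w t ∧ (W t).grad =ᵐ[spaceMeas Ω] G t)
    {τ : ℝ} (hτ : τ ≤ T) :
    (eLpNorm W (ENNReal.ofReal p) (timeMeas τ)).toReal
      ≤ normCyl Ω τ p G + if p ≤ pCrit n then T ^ (1 / p) * √(supSq T w) else 0 := by
  have hp0 : 0 < p := one_pos.trans hp.out
  have hle := timeMeas_mono hτ
  have hGτ := hG.mono_measure (cylMeas_mono Ω hτ)
  obtain ⟨K, hK⟩ : ∃ K : ℝ, K = if p ≤ pCrit n then √(supSq T w) else 0 := ⟨_, rfl⟩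
  have hK0 : 0 ≤ K := by
    rw [hK]
    split_ifs
    · exact Real.sqrt_nonneg _
    · exact le_rfl
  have hgm : AEStronglyMeasurable (fun t => (W t).grad) (timeMeas τ) :=
    continuous_V0_grad.comp_aestronglyMeasurable (hWm.1.mono_measure hle)
  have e1 : eLpNorm (fun t => (W t).grad) (ENNReal.ofReal p) (timeMeas τ)
      = eLpNorm (Function.uncurry G) (ENNReal.ofReal p) (cylMeas Ω τ) := by
    refine (ENNReal.rpow_left_injective hp0.ne') ?_
    simp only
    rw [← lintegral_enorm_rpow hp0, ← lintegral_enorm_rpow hp0,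
      lintegral_prod _ (hGτ.1.enorm.pow_const p)]
    refine lintegral_congr_ae ?_
    filter_upwards [ae_mono hle hW] with t ht
    rw [Lp.enorm_def, eLpNorm_congr_ae ht.2, ← lintegral_enorm_rpow hp0]
    rfl
  have hgM : MemLp (fun t => (W t).grad) (ENNReal.ofReal p) (timeMeas τ) :=
    ⟨hgm, by rw [e1]; exact hGτ.2⟩
  have : IsFiniteMeasure (timeMeas T) :=
    ⟨by rw [Measure.restrict_apply_univ]; exact measure_Ioo_lt_top⟩
  have : IsFiniteMeasure (timeMeas τ) :=
    ⟨by rw [Measure.restrict_apply_univ]; exact measure_Ioo_lt_top⟩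
  have hcM : MemLp (fun _ : ℝ => K) (ENNReal.ofReal p) (timeMeas τ) := memLp_const K
  have h2 := toReal_eLpNorm_add_le (fact_one_le_ofReal p).out hgM.norm hcM
    (Filter.EventuallyEq.refl _ _)
  have h1 : (eLpNorm W (ENNReal.ofReal p) (timeMeas τ)).toReal
      ≤ (eLpNorm ((fun t => ‖(W t).grad‖) + fun _ => K) (ENNReal.ofReal p)
        (timeMeas τ)).toReal := by
    refine ENNReal.toReal_mono (hgM.norm.add hcM).eLpNorm_ne_top (eLpNorm_mono_ae ?_)
    filter_upwards [ae_mono hle hW, ae_restrict_mem measurableSet_Ioo] with t ht htτ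
    refine le_trans ?_ (le_abs_self _)
    rw [V0.norm_def, v0Norm, Pi.add_apply, Lp.norm_def, eLpNorm_congr_ae ht.1, hK]
    refine add_le_add le_rfl ?_
    split_ifs
    · exact norm_le_sqrt_supSq hw (Ioo_subset_Ioo_right hτ htτ)
    · exact le_rfl
  refine h1.trans (h2.trans ?_)
  rw [eLpNorm_norm, e1]
  refine add_le_add le_rfl ?_
  rw [eLpNorm_const' _ (by simpa using hp0) ENNReal.ofReal_ne_top, ENNReal.toReal_mul,
    toReal_enorm, Real.norm_of_nonneg hK0, ENNReal.toReal_ofReal hp0.le, ← ENNReal.toReal_rpow]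
  have hmeas : (timeMeas τ univ).toReal ≤ T := by
    rw [Measure.restrict_apply_univ, Real.volume_Ioo, sub_zero, ENNReal.toReal_ofReal']
    exact max_le hτ hT.le
  rw [hK]
  split_ifs
  · rw [mul_comm]
    gcongr
  · simp

end normsV0

/-! ### The energy estimate and the stability estimate -/

/-- Since p_c ≤ 2, also p ≤ 2, and the conjugate exponent is at least 2. -/
theorem two_le_pConj {n : ℕ} {p : ℝ} [hp : Fact (1 < p)] (h : p ≤ pCrit n) : 2 ≤ pConj p := by
  have h1 : p ≤ 2 := by
    refine h.trans ?_
    rw [pCrit, div_le_iff₀ (by positivity)]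
    linarith
  have hp1 := hp.out
  rw [pConj, le_div_iff₀ (by linarith)]
  linarith

theorem eLpNorm_sub_self {α E : Type*} [MeasurableSpace α] [NormedAddCommGroup E] (F : α → E)
    (q : ℝ≥0∞) (μ : Measure α) : eLpNorm (fun t => F t - F t) q μ = 0 := by
  simp

section estimates

variable {n N : ℕ} [hn : Fact (2 ≤ n)] {p : ℝ} [hp : Fact (1 < p)] {Ω : Set (Pt n)}
  [hΩ : IsBoundedLipschitzDomain Ω] {T : ℝ} {c : Coeffs n} {γ₀ κ₀ Γ₀ : ℝ}

/-- The equation on `(0, τ)` is tested with u − v, and the energy identity is applied to u − v,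
whose time derivative is u' − v'. Coercivity handles ⟨A(Du) | Du⟩; the remaining terms are bounded
by Hölder. -/
theorem IsDirichletSol.energy_inequality (hT : 0 < T) (hγ₀ : 0 < γ₀) (hκ₀ : 0 < κ₀) (hΓ₀ : 1 < Γ₀)
    (hc : c.Admissible p Ω T γ₀ κ₀ Γ₀) {f v u : ℝ → L2 N Ω} {Dv Du Z : ℝ → Pt n → Mat N n}
    {v' : ℝ → V0' N p Ω} (hv : MemXC p Ω T v Dv v') (hu : IsDirichletSol p Ω T c f v u Du Z)
    {τ : ℝ} (hτ : τ ∈ Ioc 0 T) :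
    1 / 2 * ‖u τ - v τ‖ ^ 2 + Γ₀⁻¹ * κ₀ * (√γ₀) ^ p * normCyl Ω τ p Du ^ p
      ≤ γ₀⁻¹ * (normCyl Ω τ (pConj p) (fun t x => c.flux t x (Du t x) (Z t x))
          * normCyl Ω T p Dv) + √(supSq T fun t => u t - v t) * normL21 Ω T f
        + normDual p Ω T v' * (normCyl Ω τ p Du + normCyl Ω T p Dv
          + if p ≤ pCrit n then T ^ (1 / p) * √(supSq T fun t => u t - v t) else 0) := by
  obtain ⟨u', hu', hweak⟩ := hu.sol.weak_cutoff hγ₀ hΓ₀ hc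
  obtain ⟨W, hWm, hW⟩ := exists_V0_valued hu' hv hu.lateral
  have hle := cylMeas_mono Ω hτ.2
  have hDu := hu'.memLp_grad
  have hDv := hv.memLp_grad
  have hG : MemLp (Function.uncurry fun t x => Du t x - Dv t x) (ENNReal.ofReal p)
      (cylMeas Ω T) := hDu.sub hDv
  have hw := (hu'.hasDualDeriv hT).sub (hv.hasDualDeriv hT)
  have hen := hw.energy hT hWm (hW.mono fun _ h => h.1) ⟨hτ.1.le, hτ.2⟩
  have htest := hweak W (fun t => u t - v t) (fun t x => Du t x - Dv t x) hWm hG hW τ hτ.2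
  simp only [hu.initial, sub_self, norm_zero, ne_eq, OfNat.ofNat_ne_zero, not_false_eq_true,
    zero_pow, sub_zero] at hen
  have hWτ := hWm.mono_measure (timeMeas_mono hτ.2)
  have hsplit : ∫ t, (u' t - v' t) (W t) ∂(timeMeas τ)
      = (∫ t, u' t (W t) ∂(timeMeas τ)) - ∫ t, v' t (W t) ∂(timeMeas τ) :=
    integral_sub
      (integrable_dual_apply (hu'.deriv_memLp.mono_measure (timeMeas_mono hτ.2)) hWτ)
      (integrable_dual_apply (hv.deriv_memLp.mono_measure (timeMeas_mono hτ.2)) hWτ)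
  rw [hsplit] at hen
  obtain ⟨hiu, -⟩ := hu.sol.integrable_flux hγ₀ hΓ₀ hc hDu hτ.2
  obtain ⟨hiv, hbv⟩ := hu.sol.integrable_flux hγ₀ hΓ₀ hc hDv hτ.2
  have hflux : ∫ z, gInner (c.γ z.1 z.2) (c.flux z.1 z.2 (Du z.1 z.2) (Z z.1 z.2))
        (Du z.1 z.2 - Dv z.1 z.2) ∂(cylMeas Ω τ)
      = (∫ z, gInner (c.γ z.1 z.2) (c.flux z.1 z.2 (Du z.1 z.2) (Z z.1 z.2))
          (Du z.1 z.2) ∂(cylMeas Ω τ))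
        - ∫ z, gInner (c.γ z.1 z.2) (c.flux z.1 z.2 (Du z.1 z.2) (Z z.1 z.2))
          (Dv z.1 z.2) ∂(cylMeas Ω τ) := by
    rw [← integral_sub hiu hiv]
    simp only [gInner_sub_right]
  rw [hflux] at htest
  have hp0 : 0 < p := one_pos.trans hp.out
  have hDuτ := hDu.mono_measure hle
  have hcoer : Γ₀⁻¹ * κ₀ * (√γ₀) ^ p * normCyl Ω τ p Du ^ p
      ≤ ∫ z, gInner (c.γ z.1 z.2) (c.flux z.1 z.2 (Du z.1 z.2) (Z z.1 z.2))
          (Du z.1 z.2) ∂(cylMeas Ω τ) := by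
    have hi : Integrable (fun z => ‖Function.uncurry Du z‖ ^ p) (cylMeas Ω τ) := by
      have := hDuτ.integrable_norm_rpow (by simpa using hp0) ENNReal.ofReal_ne_top
      rwa [ENNReal.toReal_ofReal hp0.le] at this
    rw [normCyl, ← integral_norm_rpow hp0 hDuτ.1, ← integral_const_mul]
    refine integral_mono_ae (hi.const_mul _) hiu (ae_mono hle ?_)
    filter_upwards [hc.ae_pointBounds hΩ.isOpen.measurableSet, hu.sol.Z_mem] with z h1 h2
    exact h1.flux_coercive hp.out hκ₀ hγ₀ hΓ₀ hc h2
  have hforce := abs_integral_inner_le hu.sol.force.1 hw.continuousOn hτ.2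
  have hdual := abs_integral_dual_le hv.deriv_memLp hWm hτ.2
  have hWn := eLpNorm_V0_le_normCyl hT hw.continuousOn hG hWm hW hτ.2
  have hGn : normCyl Ω τ p (fun t x => Du t x - Dv t x)
      ≤ normCyl Ω τ p Du + normCyl Ω T p Dv := by
    have h1 := toReal_eLpNorm_add_le (fact_one_le_ofReal p).out hDuτ (hDv.mono_measure hle).neg
      (h := Function.uncurry fun t x => Du t x - Dv t x)
      (Filter.Eventually.of_forall fun z => by
        simp [Function.uncurry, sub_eq_add_neg])
    rw [eLpNorm_neg] at h1
    exact h1.trans (add_le_add le_rfl (normCyl_mono hDv hτ.2))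
  have hdual' : |∫ t, v' t (W t) ∂(timeMeas τ)|
      ≤ normDual p Ω T v' * (normCyl Ω τ p Du + normCyl Ω T p Dv
          + if p ≤ pCrit n then T ^ (1 / p) * √(supSq T fun t => u t - v t) else 0) := by
    refine hdual.trans (mul_le_mul_of_nonneg_left ?_ ENNReal.toReal_nonneg)
    linarith
  have hbv' : |∫ z, gInner (c.γ z.1 z.2) (c.flux z.1 z.2 (Du z.1 z.2) (Z z.1 z.2))
        (Dv z.1 z.2) ∂(cylMeas Ω τ)|
      ≤ γ₀⁻¹ * (normCyl Ω τ (pConj p) (fun t x => c.flux t x (Du t x) (Z t x))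
          * normCyl Ω T p Dv) := by
    refine hbv.trans ?_
    gcongr
    · exact ENNReal.toReal_nonneg
    · exact normCyl_mono hDv hτ.2
  have k1 := (abs_le.1 hbv').2
  have k2 := (abs_le.1 hforce).2
  have k3 := (abs_le.1 hdual').1
  linarith

variable (N p Ω) in
theorem exists_energy_estimate (hT : 0 < T) (hγ₀ : 0 < γ₀) (hκ₀ : 0 < κ₀) (hΓ₀ : 1 < Γ₀) :
    ∃ C : ℝ, 0 < C ∧ ∀ c : Coeffs n, c.Admissible p Ω T γ₀ κ₀ Γ₀ →
      ∀ (f v u : ℝ → L2 N Ω) (Dv Du Z : ℝ → Pt n → Mat N n) (v' : ℝ → V0' N p Ω),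
        MemXC p Ω T v Dv v' → IsDirichletSol p Ω T c f v u Du Z →
        supSq T (fun t => u t - v t) + ∫ z, ‖Du z.1 z.2‖ ^ p ∂(cylMeas Ω T)
          ≤ C * (normDual p Ω T v' ^ pConj p + normCyl Ω T p Dv ^ p + normL21 Ω T f ^ 2 + 1) := by
  have hp0 : 0 < p := one_pos.trans hp.out
  obtain ⟨c₀, hc₀⟩ : ∃ c₀, c₀ = Γ₀⁻¹ * κ₀ * (√γ₀) ^ p := ⟨_, rfl⟩
  have hc₀pos : 0 < c₀ := by
    have := Real.sqrt_pos.2 hγ₀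
    rw [hc₀]
    positivity
  obtain ⟨K₀, hK₀⟩ : ∃ K₀, K₀ = (√γ₀)⁻¹ * Γ₀ * ((cylMeas Ω T univ).toReal ^ (1 / pConj p)) :=
    ⟨_, rfl⟩
  obtain ⟨K₁, hK₁⟩ : ∃ K₁, K₁ = (√γ₀)⁻¹ * Γ₀ ^ 2 * (√γ₀⁻¹) ^ (p - 1) := ⟨_, rfl⟩
  have hK₀0 : 0 ≤ K₀ := by rw [hK₀]; positivity
  have hK₁0 : 0 ≤ K₁ := by rw [hK₁]; positivity
  obtain ⟨C, hC, habs⟩ := energy_absorption (holderConjugate_pConj p).symm hc₀pos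
    (K := γ₀⁻¹ * (K₀ + K₁)) (L := T ^ (1 / p)) (by positivity) (p ≤ pCrit n) two_le_pConj
  -- Taking the supremum in `hmain` gives S ≤ S/4 + 2CR, so S ≤ (8/3)CR. Inserting this at τ = T
  -- gives (c₀/2)X^p ≤ (4/3)CR.
  refine ⟨(8 / 3 + 8 / (3 * c₀)) * C, by positivity, fun c hc f v u Dv Du Z v' hv hu => ?_⟩
  obtain ⟨R, hR⟩ : ∃ R, R = normDual p Ω T v' ^ pConj p + normCyl Ω T p Dv ^ p
    + normL21 Ω T f ^ 2 + 1 := ⟨_, rfl⟩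
  obtain ⟨u', hu', -⟩ := hu.sol.weak
  have hDu := hu'.memLp_grad
  have hDv0 : 0 ≤ normCyl Ω T p Dv := ENNReal.toReal_nonneg
  have hmain : ∀ τ ∈ Ioc 0 T, 1 / 2 * ‖u τ - v τ‖ ^ 2 + c₀ / 2 * normCyl Ω τ p Du ^ p
      ≤ 1 / 8 * supSq T (fun t => u t - v t) + C * R := by
    intro τ hτ
    have hX0 : 0 ≤ normCyl Ω τ p Du := ENNReal.toReal_nonneg
    have h1 := hu.energy_inequality hT hγ₀ hκ₀ hΓ₀ hc hv hτ
    have h2 := (hc.memLp_flux hγ₀ hΓ₀ hΩ.isOpen.measurableSet hDu hu.sol.Z_memLp.1 hu.sol.Z_mem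
      hτ.2).2
    rw [← hK₀, ← hK₁] at h2
    have h3 : normCyl Ω τ (pConj p) (fun t x => c.flux t x (Du t x) (Z t x))
        ≤ (K₀ + K₁) * (1 + normCyl Ω τ p Du ^ (p - 1)) := by
      have : 0 ≤ K₀ * normCyl Ω τ p Du ^ (p - 1) := by positivity
      linarith
    have h4 : γ₀⁻¹ * (normCyl Ω τ (pConj p) (fun t x => c.flux t x (Du t x) (Z t x))
          * normCyl Ω T p Dv)
        ≤ γ₀⁻¹ * (K₀ + K₁) * (1 + normCyl Ω τ p Du ^ (p - 1)) * normCyl Ω T p Dv := by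
      calc _ ≤ γ₀⁻¹ * (((K₀ + K₁) * (1 + normCyl Ω τ p Du ^ (p - 1))) * normCyl Ω T p Dv) := by
            gcongr
        _ = _ := by ring
    have h5 := habs ‖u τ - v τ‖ (normCyl Ω τ p Du) (normCyl Ω T p Dv) (normL21 Ω T f)
      (normDual p Ω T v') (√(supSq T fun t => u t - v t)) hX0 hDv0 ENNReal.toReal_nonneg
      (by rw [← hc₀] at h1; linarith)
    rwa [Real.sq_sqrt (supSq_nonneg _), ← hR] at h5
  have hR0 : 0 ≤ C * R := by
    have h1 : 0 ≤ normDual p Ω T v' ^ pConj p := Real.rpow_nonneg ENNReal.toReal_nonneg _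
    have h2 : 0 ≤ normCyl Ω T p Dv ^ p := Real.rpow_nonneg ENNReal.toReal_nonneg _
    rw [hR]
    positivity
  have hS : supSq T (fun t => u t - v t) ≤ 8 / 3 * (C * R) := by
    have : supSq T (fun t => u t - v t)
        ≤ 1 / 4 * supSq T (fun t => u t - v t) + 2 * (C * R) := by
      refine supSq_le hT fun τ hτ => ?_
      have h1 := hmain τ ⟨hτ.1, hτ.2.le⟩
      have h2 : 0 ≤ c₀ / 2 * normCyl Ω τ p Du ^ p :=
        mul_nonneg (by positivity) (Real.rpow_nonneg ENNReal.toReal_nonneg _)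
      linarith
    linarith
  have hX : normCyl Ω T p Du ^ p ≤ 8 / (3 * c₀) * (C * R) := by
    have h1 := hmain T ⟨hT, le_rfl⟩
    have h2 : 0 ≤ ‖u T - v T‖ ^ 2 := by positivity
    have h3 : c₀ / 2 * normCyl Ω T p Du ^ p ≤ 4 / 3 * (C * R) := by linarith
    calc normCyl Ω T p Du ^ p = 2 / c₀ * (c₀ / 2 * normCyl Ω T p Du ^ p) := by field_simp
      _ ≤ 2 / c₀ * (4 / 3 * (C * R)) := by gcongr
      _ = _ := by field_simp; ring
  have e : ∫ z, ‖Du z.1 z.2‖ ^ p ∂(cylMeas Ω T) = normCyl Ω T p Du ^ p :=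
    integral_norm_rpow hp0 hDu.1
  rw [e, ← hR]
  linarith

/-- The difference of the equations is tested with (u₁ − v₁) − (u₂ − v₂), which vanishes at t = 0.
The flux term splits into the monotone integral J and an error paired with Dv₁ − Dv₂. Nonnegativity
of J is part of the conclusion because uniqueness needs it to discard the integral. -/
theorem stability_estimate (hT : 0 < T) (hγ₀ : 0 < γ₀) (hκ₀ : 0 < κ₀) (hΓ₀ : 1 < Γ₀)
    (hc : c.Admissible p Ω T γ₀ κ₀ Γ₀) {f₁ f₂ v₁ v₂ u₁ u₂ : ℝ → L2 N Ω}
    {Dv₁ Dv₂ Du₁ Du₂ Z₁ Z₂ : ℝ → Pt n → Mat N n} {v₁' v₂' : ℝ → V0' N p Ω}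
    (hv₁ : MemXC p Ω T v₁ Dv₁ v₁') (hv₂ : MemXC p Ω T v₂ Dv₂ v₂')
    (hu₁ : IsDirichletSol p Ω T c f₁ v₁ u₁ Du₁ Z₁)
    (hu₂ : IsDirichletSol p Ω T c f₂ v₂ u₂ Du₂ Z₂) {C : ℝ} (hC : 10 ≤ C) (hC' : 10 * γ₀⁻¹ ≤ C) :
    0 ≤ ∫ z, gInner (c.γ z.1 z.2)
          (c.flux z.1 z.2 (Du₁ z.1 z.2) (Z₁ z.1 z.2) - c.flux z.1 z.2 (Du₂ z.1 z.2) (Z₂ z.1 z.2))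
          (Du₁ z.1 z.2 - Du₂ z.1 z.2) ∂(cylMeas Ω T) ∧
    supSq T (fun t => u₁ t - u₂ t)
      + ∫ z, gInner (c.γ z.1 z.2)
          (c.flux z.1 z.2 (Du₁ z.1 z.2) (Z₁ z.1 z.2) - c.flux z.1 z.2 (Du₂ z.1 z.2) (Z₂ z.1 z.2))
          (Du₁ z.1 z.2 - Du₂ z.1 z.2) ∂(cylMeas Ω T)
      ≤ C * normL21 Ω T (fun t => f₁ t - f₂ t) ^ 2
        + C * (normCyl Ω T (pConj p) (fun t x => c.flux t x (Du₁ t x) (Z₁ t x))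
            + normCyl Ω T (pConj p) (fun t x => c.flux t x (Du₂ t x) (Z₂ t x)))
            * normCyl Ω T p (fun t x => Dv₁ t x - Dv₂ t x)
        + C * normDual p Ω T (fun t => v₁' t - v₂' t)
            * (normLpV0 p Ω T (fun t => u₁ t - u₂ t) (fun t x => Du₁ t x - Du₂ t x)
              + normLpV0 p Ω T (fun t => v₁ t - v₂ t) (fun t x => Dv₁ t x - Dv₂ t x))
        + C * supSq T (fun t => v₁ t - v₂ t) := by
  obtain ⟨u₁', hu₁', hweak₁⟩ := hu₁.sol.weak_cutoff hγ₀ hΓ₀ hc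
  obtain ⟨u₂', hu₂', hweak₂⟩ := hu₂.sol.weak_cutoff hγ₀ hΓ₀ hc
  obtain ⟨W₁, hWm₁, hW₁⟩ := exists_V0_valued hu₁' hv₁ hu₁.lateral
  obtain ⟨W₂, hWm₂, hW₂⟩ := exists_V0_valued hu₂' hv₂ hu₂.lateral
  have hWm : MemLp (fun t => W₁ t - W₂ t) (ENNReal.ofReal p) (timeMeas T) := hWm₁.sub hWm₂
  have hW : ∀ᵐ t ∂(timeMeas T),
      (W₁ t - W₂ t).fn =ᵐ[spaceMeas Ω] (u₁ t - v₁ t - (u₂ t - v₂ t) : L2 N Ω) ∧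
      (W₁ t - W₂ t).grad =ᵐ[spaceMeas Ω] fun x => Du₁ t x - Dv₁ t x - (Du₂ t x - Dv₂ t x) := by
    filter_upwards [hW₁, hW₂] with t h1 h2
    constructor
    · filter_upwards [Lp.coeFn_sub (W₁ t).fn (W₂ t).fn, Lp.coeFn_sub (u₁ t - v₁ t) (u₂ t - v₂ t),
        h1.1, h2.1] with x e1 e2 e3 e4
      rw [e2, Pi.sub_apply, ← e3, ← e4]
      exact e1
    · filter_upwards [Lp.coeFn_sub (W₁ t).grad (W₂ t).grad, h1.2, h2.2] with x e1 e3 e4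
      rw [← e3, ← e4]
      exact e1
  have hDu₁ := hu₁'.memLp_grad
  have hDu₂ := hu₂'.memLp_grad
  have hDv : MemLp (Function.uncurry fun t x => Dv₁ t x - Dv₂ t x) (ENNReal.ofReal p)
      (cylMeas Ω T) := hv₁.memLp_grad.sub hv₂.memLp_grad
  have hG : MemLp (Function.uncurry fun t x => Du₁ t x - Dv₁ t x - (Du₂ t x - Dv₂ t x))
      (ENNReal.ofReal p) (cylMeas Ω T) :=
    (hDu₁.sub hv₁.memLp_grad).sub (hDu₂.sub hv₂.memLp_grad)
  have hw := ((hu₁'.hasDualDeriv hT).sub (hv₁.hasDualDeriv hT)).sub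
    ((hu₂'.hasDualDeriv hT).sub (hv₂.hasDualDeriv hT))
  have hv := (hv₁.hasDualDeriv hT).sub (hv₂.hasDualDeriv hT)
  have hf : MemLp (fun t => f₁ t - f₂ t) 1 (timeMeas T) :=
    hu₁.sol.force.1.sub hu₂.sol.force.1
  obtain ⟨S, hS⟩ : ∃ S, S = supSq T (fun t => u₁ t - v₁ t - (u₂ t - v₂ t)) := ⟨_, rfl⟩
  obtain ⟨A, hA⟩ : ∃ A, A = normCyl Ω T (pConj p) (fun t x => c.flux t x (Du₁ t x) (Z₁ t x))
      + normCyl Ω T (pConj p) (fun t x => c.flux t x (Du₂ t x) (Z₂ t x)) := ⟨_, rfl⟩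
  obtain ⟨D, hD⟩ : ∃ D, D = normCyl Ω T p (fun t x => Dv₁ t x - Dv₂ t x) := ⟨_, rfl⟩
  obtain ⟨F, hF⟩ : ∃ F, F = normL21 Ω T (fun t => f₁ t - f₂ t) := ⟨_, rfl⟩
  obtain ⟨B, hB⟩ : ∃ B, B = normDual p Ω T (fun t => v₁' t - v₂' t) := ⟨_, rfl⟩
  obtain ⟨L, hL⟩ : ∃ L, L = normLpV0 p Ω T (fun t => u₁ t - u₂ t) (fun t x => Du₁ t x - Du₂ t x)
      + normLpV0 p Ω T (fun t => v₁ t - v₂ t) (fun t x => Dv₁ t x - Dv₂ t x) := ⟨_, rfl⟩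
  obtain ⟨H, hH⟩ : ∃ H, H = supSq T (fun t => v₁ t - v₂ t) := ⟨_, rfl⟩
  have hS0 : 0 ≤ S := hS ▸ supSq_nonneg _
  have hH0 : 0 ≤ H := hH ▸ supSq_nonneg _
  have hAD0 : 0 ≤ A * D := by
    rw [hA, hD]
    exact mul_nonneg (add_nonneg ENNReal.toReal_nonneg ENNReal.toReal_nonneg)
      ENNReal.toReal_nonneg
  have hBL0 : 0 ≤ B * L := by
    rw [hB, hL]
    exact mul_nonneg ENNReal.toReal_nonneg
      (add_nonneg ENNReal.toReal_nonneg ENNReal.toReal_nonneg)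
  obtain ⟨J, hJ⟩ : ∃ J : ℝ → ℝ, J = fun τ => ∫ z, gInner (c.γ z.1 z.2)
      (c.flux z.1 z.2 (Du₁ z.1 z.2) (Z₁ z.1 z.2) - c.flux z.1 z.2 (Du₂ z.1 z.2) (Z₂ z.1 z.2))
      (Du₁ z.1 z.2 - Du₂ z.1 z.2) ∂(cylMeas Ω τ) := ⟨_, rfl⟩
  have hJ0 : ∀ τ ≤ T, 0 ≤ J τ := by
    intro τ hτ
    rw [hJ]
    refine integral_nonneg_of_ae (ae_mono (cylMeas_mono Ω hτ) ?_)
    filter_upwards [hc.ae_pointBounds hΩ.isOpen.measurableSet, hu₁.sol.Z_mem, hu₂.sol.Z_mem]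
      with z h1 h2 h3
    exact h1.flux_mono hκ₀ hγ₀ hΓ₀ hc h2 h3
  have hmain : ∀ τ ∈ Ioc 0 T, 1 / 2 * ‖u₁ τ - v₁ τ - (u₂ τ - v₂ τ)‖ ^ 2 + J τ
      ≤ √S * F + γ₀⁻¹ * (A * D) + B * L := by
    intro τ hτ
    have hle := timeMeas_mono hτ.2
    have hen := hw.energy hT hWm (hW.mono fun _ h => h.1) ⟨hτ.1.le, hτ.2⟩
    simp only [hu₁.initial, hu₂.initial, sub_self, norm_zero, ne_eq, OfNat.ofNat_ne_zero,
      not_false_eq_true, zero_pow, sub_zero] at hen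
    have t1 := hweak₁ _ (fun t => u₁ t - v₁ t - (u₂ t - v₂ t)) _ hWm hG hW τ hτ.2
    have t2 := hweak₂ _ (fun t => u₁ t - v₁ t - (u₂ t - v₂ t)) _ hWm hG hW τ hτ.2
    have hWτ := hWm.mono_measure hle
    have id₁ := integrable_dual_apply (hu₁'.deriv_memLp.mono_measure hle) hWτ
    have id₂ := integrable_dual_apply (hu₂'.deriv_memLp.mono_measure hle) hWτ
    have hdv : MemLp (fun t => v₁' t - v₂' t) (ENNReal.ofReal (pConj p)) (timeMeas T) :=
      hv₁.deriv_memLp.sub hv₂.deriv_memLp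
    have id₃ := integrable_dual_apply (hdv.mono_measure hle) hWτ
    have hsplit : ∫ t, (u₁' t - v₁' t - (u₂' t - v₂' t)) (W₁ t - W₂ t) ∂(timeMeas τ)
        = (∫ t, u₁' t (W₁ t - W₂ t) ∂(timeMeas τ)) - (∫ t, u₂' t (W₁ t - W₂ t) ∂(timeMeas τ))
          - ∫ t, (v₁' t - v₂' t) (W₁ t - W₂ t) ∂(timeMeas τ) := by
      have id₁₂ : Integrable (fun t => u₁' t (W₁ t - W₂ t) - u₂' t (W₁ t - W₂ t))
          (timeMeas τ) := id₁.sub id₂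
      rw [← integral_sub id₁ id₂, ← integral_sub id₁₂ id₃]
      refine integral_congr_ae (Filter.Eventually.of_forall fun t => ?_)
      simp only [sub_apply]
      ring
    rw [hsplit] at hen
    obtain ⟨i₁, -⟩ := hu₁.sol.integrable_flux hγ₀ hΓ₀ hc hG hτ.2
    obtain ⟨i₂, -⟩ := hu₂.sol.integrable_flux hγ₀ hΓ₀ hc hG hτ.2
    obtain ⟨i₁v, b₁v⟩ := hu₁.sol.integrable_flux hγ₀ hΓ₀ hc hDv hτ.2
    obtain ⟨i₂v, b₂v⟩ := hu₂.sol.integrable_flux hγ₀ hΓ₀ hc hDv hτ.2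
    have hflux : (∫ z, gInner (c.γ z.1 z.2) (c.flux z.1 z.2 (Du₁ z.1 z.2) (Z₁ z.1 z.2))
          (Du₁ z.1 z.2 - Dv₁ z.1 z.2 - (Du₂ z.1 z.2 - Dv₂ z.1 z.2)) ∂(cylMeas Ω τ))
        - (∫ z, gInner (c.γ z.1 z.2) (c.flux z.1 z.2 (Du₂ z.1 z.2) (Z₂ z.1 z.2))
          (Du₁ z.1 z.2 - Dv₁ z.1 z.2 - (Du₂ z.1 z.2 - Dv₂ z.1 z.2)) ∂(cylMeas Ω τ))
        = J τ - (∫ z, gInner (c.γ z.1 z.2) (c.flux z.1 z.2 (Du₁ z.1 z.2) (Z₁ z.1 z.2))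
          (Dv₁ z.1 z.2 - Dv₂ z.1 z.2) ∂(cylMeas Ω τ))
        + ∫ z, gInner (c.γ z.1 z.2) (c.flux z.1 z.2 (Du₂ z.1 z.2) (Z₂ z.1 z.2))
          (Dv₁ z.1 z.2 - Dv₂ z.1 z.2) ∂(cylMeas Ω τ) := by
      -- Bilinearity, with Du₁ − Du₂ written as the gradient of the test function plus Dv₁ − Dv₂.
      have e : J τ = ∫ z, ((gInner (c.γ z.1 z.2) (c.flux z.1 z.2 (Du₁ z.1 z.2) (Z₁ z.1 z.2))
            (Du₁ z.1 z.2 - Dv₁ z.1 z.2 - (Du₂ z.1 z.2 - Dv₂ z.1 z.2))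
          - gInner (c.γ z.1 z.2) (c.flux z.1 z.2 (Du₂ z.1 z.2) (Z₂ z.1 z.2))
            (Du₁ z.1 z.2 - Dv₁ z.1 z.2 - (Du₂ z.1 z.2 - Dv₂ z.1 z.2)))
          + (gInner (c.γ z.1 z.2) (c.flux z.1 z.2 (Du₁ z.1 z.2) (Z₁ z.1 z.2))
              (Dv₁ z.1 z.2 - Dv₂ z.1 z.2)
            - gInner (c.γ z.1 z.2) (c.flux z.1 z.2 (Du₂ z.1 z.2) (Z₂ z.1 z.2))
              (Dv₁ z.1 z.2 - Dv₂ z.1 z.2))) ∂(cylMeas Ω τ) := by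
        rw [hJ]
        refine integral_congr_ae (Filter.Eventually.of_forall fun z => ?_)
        simp only [gInner_sub_left, gInner_sub_right]
        ring
      have i₁₂ : Integrable (fun z => gInner (c.γ z.1 z.2)
            (c.flux z.1 z.2 (Du₁ z.1 z.2) (Z₁ z.1 z.2))
            (Du₁ z.1 z.2 - Dv₁ z.1 z.2 - (Du₂ z.1 z.2 - Dv₂ z.1 z.2))
          - gInner (c.γ z.1 z.2) (c.flux z.1 z.2 (Du₂ z.1 z.2) (Z₂ z.1 z.2))
            (Du₁ z.1 z.2 - Dv₁ z.1 z.2 - (Du₂ z.1 z.2 - Dv₂ z.1 z.2))) (cylMeas Ω τ) :=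
        i₁.sub i₂
      have i₁₂v : Integrable (fun z => gInner (c.γ z.1 z.2)
            (c.flux z.1 z.2 (Du₁ z.1 z.2) (Z₁ z.1 z.2)) (Dv₁ z.1 z.2 - Dv₂ z.1 z.2)
          - gInner (c.γ z.1 z.2) (c.flux z.1 z.2 (Du₂ z.1 z.2) (Z₂ z.1 z.2))
            (Dv₁ z.1 z.2 - Dv₂ z.1 z.2)) (cylMeas Ω τ) :=
        i₁v.sub i₂v
      rw [e, integral_add i₁₂ i₁₂v, integral_sub i₁ i₂, integral_sub i₁v i₂v]
      ring
    have if₁ : Integrable (fun t => (inner ℝ (f₁ t) (u₁ t - v₁ t - (u₂ t - v₂ t)) : ℝ))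
        (timeMeas τ) := integrable_inner_of_continuousOn hu₁.sol.force.1 hw.continuousOn hτ.2
    have if₂ : Integrable (fun t => (inner ℝ (f₂ t) (u₁ t - v₁ t - (u₂ t - v₂ t)) : ℝ))
        (timeMeas τ) := integrable_inner_of_continuousOn hu₂.sol.force.1 hw.continuousOn hτ.2
    have hfs : ∫ t, inner ℝ (f₁ t - f₂ t) (u₁ t - v₁ t - (u₂ t - v₂ t)) ∂(timeMeas τ)
        = (∫ t, inner ℝ (f₁ t) (u₁ t - v₁ t - (u₂ t - v₂ t)) ∂(timeMeas τ))
          - ∫ t, inner ℝ (f₂ t) (u₁ t - v₁ t - (u₂ t - v₂ t)) ∂(timeMeas τ) := by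
      rw [← integral_sub if₁ if₂]
      simp only [inner_sub_left]
    have hforce := abs_integral_inner_le hf hw.continuousOn hτ.2
    have hdual := (abs_integral_dual_le hdv hWm hτ.2).trans (mul_le_mul_of_nonneg_left
      (eLpNorm_V0_le_normLpV0 hu₁' hu₂' hv₁ hv₂ hW hτ.2) ENNReal.toReal_nonneg)
    have mono_flux : ∀ {f u : ℝ → L2 N Ω} {Du Z : ℝ → Pt n → Mat N n},
        IsWeakSol p Ω T c f u Du Z → γ₀⁻¹ * (normCyl Ω τ (pConj p)
          (fun t x => c.flux t x (Du t x) (Z t x))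
            * normCyl Ω τ p (fun t x => Dv₁ t x - Dv₂ t x))
        ≤ γ₀⁻¹ * (normCyl Ω T (pConj p) (fun t x => c.flux t x (Du t x) (Z t x)) * D) := by
      intro f u Du Z h
      rw [hD]
      gcongr
      · exact ENNReal.toReal_nonneg
      · exact ENNReal.toReal_nonneg
      · exact normCyl_mono (h.memLp_flux hγ₀ hΓ₀ hc) hτ.2
      · exact normCyl_mono hDv hτ.2
    have k1 := (abs_le.1 (b₁v.trans (mono_flux hu₁.sol))).2
    have k2 := (abs_le.1 (b₂v.trans (mono_flux hu₂.sol))).1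
    have k3 := (abs_le.1 hforce).2
    have k4 := (abs_le.1 hdual).1
    rw [← hS, ← hF] at k3
    rw [← hB, ← hL] at k4
    have e5 : γ₀⁻¹ * (A * D)
        = γ₀⁻¹ * (normCyl Ω T (pConj p) (fun t x => c.flux t x (Du₁ t x) (Z₁ t x)) * D)
          + γ₀⁻¹ * (normCyl Ω T (pConj p) (fun t x => c.flux t x (Du₂ t x) (Z₂ t x)) * D) := by
      rw [hA]
      ring
    rw [e5]
    linarith
  have hSF : √S * F ≤ 1 / 4 * S + F ^ 2 := by
    nlinarith [sq_nonneg (√S / 2 - F), Real.sq_sqrt hS0]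
  -- The supremum of `hmain`, with J ≥ 0 dropped and √S·F bounded by S/4 + F², leaves S/2 on the
  -- right, which is absorbed.
  have hSle : S ≤ 4 * F ^ 2 + 4 * (γ₀⁻¹ * (A * D) + B * L) := by
    have : S ≤ 1 / 2 * S + 2 * F ^ 2 + 2 * (γ₀⁻¹ * (A * D) + B * L) := by
      nth_rewrite 1 [hS]
      refine supSq_le hT fun τ hτ => ?_
      have h1 := hmain τ ⟨hτ.1, hτ.2.le⟩
      have h2 := hJ0 τ hτ.2.le
      linarith
    linarith
  have hJT : J T ≤ 2 * F ^ 2 + 2 * (γ₀⁻¹ * (A * D) + B * L) := by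
    have h1 := hmain T ⟨hT, le_rfl⟩
    have h2 : 0 ≤ ‖u₁ T - v₁ T - (u₂ T - v₂ T)‖ ^ 2 := by positivity
    linarith
  have hsup : supSq T (fun t => u₁ t - u₂ t) ≤ 2 * S + 2 * H := by
    refine supSq_le hT fun τ hτ => ?_
    have h1 := norm_sq_le_supSq hw.continuousOn hτ
    have h2 := norm_sq_le_supSq hv.continuousOn hτ
    rw [← hS] at h1
    rw [← hH] at h2
    have h3 : ‖u₁ τ - u₂ τ‖ ≤ ‖u₁ τ - v₁ τ - (u₂ τ - v₂ τ)‖ + ‖v₁ τ - v₂ τ‖ := by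
      have e : u₁ τ - u₂ τ = (u₁ τ - v₁ τ - (u₂ τ - v₂ τ)) + (v₁ τ - v₂ τ) := by abel
      rw [e]
      exact norm_add_le _ _
    calc ‖u₁ τ - u₂ τ‖ ^ 2 ≤ (‖u₁ τ - v₁ τ - (u₂ τ - v₂ τ)‖ + ‖v₁ τ - v₂ τ‖) ^ 2 := by gcongr
      _ ≤ 2 * ‖u₁ τ - v₁ τ - (u₂ τ - v₂ τ)‖ ^ 2 + 2 * ‖v₁ τ - v₂ τ‖ ^ 2 := by
          nlinarith [sq_nonneg (‖u₁ τ - v₁ τ - (u₂ τ - v₂ τ)‖ - ‖v₁ τ - v₂ τ‖)]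
      _ ≤ 2 * S + 2 * H := by linarith
  have hJT' : J T = ∫ z, gInner (c.γ z.1 z.2)
      (c.flux z.1 z.2 (Du₁ z.1 z.2) (Z₁ z.1 z.2) - c.flux z.1 z.2 (Du₂ z.1 z.2) (Z₂ z.1 z.2))
      (Du₁ z.1 z.2 - Du₂ z.1 z.2) ∂(cylMeas Ω T) := by rw [hJ]
  rw [← hJT', ← hF, ← hA, ← hD, ← hB, ← hL, ← hH]
  refine ⟨hJ0 T le_rfl, ?_⟩
  -- Altogether 2S + 2H + J(T) has coefficient 8 + 2 = 10 on F², on γ₀⁻¹AD and on BL, and 2 on H;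
  -- hence the two lower bounds on C.
  have f1 : 10 * F ^ 2 ≤ C * F ^ 2 := by gcongr
  have f2 : 10 * γ₀⁻¹ * (A * D) ≤ C * (A * D) := by gcongr
  have f3 : 10 * (B * L) ≤ C * (B * L) := by gcongr
  have f4 : 10 * H ≤ C * H := by gcongr
  have f5 : C * A * D = C * (A * D) := by ring
  have f6 : C * B * L = C * (B * L) := by ring
  rw [f5, f6]
  linarith

theorem IsDirichletSol.eqOn (hT : 0 < T) (hγ₀ : 0 < γ₀) (hκ₀ : 0 < κ₀) (hΓ₀ : 1 < Γ₀)
    (hc : c.Admissible p Ω T γ₀ κ₀ Γ₀) {f v u₁ u₂ : ℝ → L2 N Ω}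
    {Dv Du₁ Du₂ Z₁ Z₂ : ℝ → Pt n → Mat N n} {v' : ℝ → V0' N p Ω} (hv : MemXC p Ω T v Dv v')
    (hu₁ : IsDirichletSol p Ω T c f v u₁ Du₁ Z₁) (hu₂ : IsDirichletSol p Ω T c f v u₂ Du₂ Z₂) :
    EqOn u₁ u₂ (Icc 0 T) := by
  obtain ⟨h0, h⟩ := stability_estimate hT hγ₀ hκ₀ hΓ₀ hc hv hv hu₁ hu₂ (le_max_left _ _)
    (le_max_right 10 (10 * γ₀⁻¹))
  have hF : normL21 Ω T (fun t => f t - f t) = 0 := by simp [normL21]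
  have hD : normCyl Ω T p (fun t x => Dv t x - Dv t x) = 0 := by
    simp [normCyl, Function.uncurry_def]
  have hB : normDual p Ω T (fun t => v' t - v' t) = 0 := by
    rw [normDual, eLpNorm_sub_self v', ENNReal.toReal_zero]
  have hH : supSq T (fun t => v t - v t) = 0 := by simp [supSq]
  rw [hF, hD, hB, hH] at h
  have hS : supSq T (fun t => u₁ t - u₂ t) ≤ 0 := by
    simp only [ne_eq, OfNat.ofNat_ne_zero, not_false_eq_true, zero_pow, mul_zero, zero_mul,
      add_zero] at h
    linarith
  obtain ⟨_, hu₁', -⟩ := hu₁.sol.weak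
  obtain ⟨_, hu₂', -⟩ := hu₂.sol.weak
  have hIoo : EqOn u₁ u₂ (Ioo 0 T) := fun τ hτ => by
    have h1 := (norm_sq_le_supSq (hu₁'.continuousOn.sub hu₂'.continuousOn) hτ).trans hS
    have h2 : ‖u₁ τ - u₂ τ‖ = 0 := by
      have := sq_nonneg ‖u₁ τ - u₂ τ‖
      exact pow_eq_zero_iff two_ne_zero |>.1 (le_antisymm h1 this)
    exact sub_eq_zero.1 (norm_eq_zero.1 h2)
  -- The supremum only sees the open interval; continuity in L² extends equality to t = 0 and t = T.
  exact hIoo.of_subset_closure hu₁'.continuousOn hu₂'.continuousOn Ioo_subset_Icc_self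
    (closure_Ioo hT.ne).ge

end estimates

end OnePLaplace

end

/-! ### The theorem: one constant for both estimates, and uniqueness. -/

theorem lemma8p2 (n N : ℕ) [Fact (2 ≤ n)] (hN : 1 ≤ N) (p : ℝ) [Fact (1 < p)]
    (Ω : Set (OnePLaplace.Pt n)) [OnePLaplace.IsBoundedLipschitzDomain Ω]
    (T : ℝ) (hT : 0 < T) (γ₀ κ₀ Γ₀ : ℝ) (hγ₀ : 0 < γ₀) (hγ₀' : γ₀ < 1) (hκ₀ : 0 < κ₀)
    (hΓ₀ : 1 < Γ₀) :
    (∃ C : ℝ, 0 < C ∧ ∀ c : OnePLaplace.Coeffs n, c.Admissible p Ω T γ₀ κ₀ Γ₀ →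
      -- the energy estimate
      (∀ (f v u : ℝ → OnePLaplace.L2 N Ω)
          (Dv Du Z : ℝ → OnePLaplace.Pt n → OnePLaplace.Mat N n)
          (v' : ℝ → OnePLaplace.V0' N p Ω),
        OnePLaplace.MemXC p Ω T v Dv v' →
        OnePLaplace.IsDirichletSol p Ω T c f v u Du Z →
        OnePLaplace.supSq T (fun t => u t - v t)
            + ∫ z, ‖Du z.1 z.2‖ ^ p ∂(OnePLaplace.cylMeas Ω T)
          ≤ C * (OnePLaplace.normDual p Ω T v' ^ OnePLaplace.pConj p
              + OnePLaplace.normCyl Ω T p Dv ^ p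
              + OnePLaplace.normL21 Ω T f ^ 2 + 1)) ∧
      -- the stability estimate
      (∀ (f₁ f₂ v₁ v₂ u₁ u₂ : ℝ → OnePLaplace.L2 N Ω)
          (Dv₁ Dv₂ Du₁ Du₂ Z₁ Z₂ : ℝ → OnePLaplace.Pt n → OnePLaplace.Mat N n)
          (v₁' v₂' : ℝ → OnePLaplace.V0' N p Ω),
        OnePLaplace.MemXC p Ω T v₁ Dv₁ v₁' →
        OnePLaplace.MemXC p Ω T v₂ Dv₂ v₂' →
        OnePLaplace.IsDirichletSol p Ω T c f₁ v₁ u₁ Du₁ Z₁ →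
        OnePLaplace.IsDirichletSol p Ω T c f₂ v₂ u₂ Du₂ Z₂ →
        OnePLaplace.supSq T (fun t => u₁ t - u₂ t)
            + ∫ z, OnePLaplace.gInner (c.γ z.1 z.2)
                (c.flux z.1 z.2 (Du₁ z.1 z.2) (Z₁ z.1 z.2)
                  - c.flux z.1 z.2 (Du₂ z.1 z.2) (Z₂ z.1 z.2))
                (Du₁ z.1 z.2 - Du₂ z.1 z.2) ∂(OnePLaplace.cylMeas Ω T)
          ≤ C * OnePLaplace.normL21 Ω T (fun t => f₁ t - f₂ t) ^ 2
            + C * (OnePLaplace.normCyl Ω T (OnePLaplace.pConj p)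
                    (fun t x => c.flux t x (Du₁ t x) (Z₁ t x))
                  + OnePLaplace.normCyl Ω T (OnePLaplace.pConj p)
                    (fun t x => c.flux t x (Du₂ t x) (Z₂ t x)))
                * OnePLaplace.normCyl Ω T p (fun t x => Dv₁ t x - Dv₂ t x)
            + C * OnePLaplace.normDual p Ω T (fun t => v₁' t - v₂' t)
                * (OnePLaplace.normLpV0 p Ω T (fun t => u₁ t - u₂ t)
                      (fun t x => Du₁ t x - Du₂ t x)
                  + OnePLaplace.normLpV0 p Ω T (fun t => v₁ t - v₂ t)
                      (fun t x => Dv₁ t x - Dv₂ t x))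
            + C * OnePLaplace.supSq T (fun t => v₁ t - v₂ t))) ∧
    -- uniqueness of the weak solution
    (∀ c : OnePLaplace.Coeffs n, c.Admissible p Ω T γ₀ κ₀ Γ₀ →
      ∀ (f v u₁ u₂ : ℝ → OnePLaplace.L2 N Ω)
        (Dv Du₁ Du₂ Z₁ Z₂ : ℝ → OnePLaplace.Pt n → OnePLaplace.Mat N n)
        (v' : ℝ → OnePLaplace.V0' N p Ω),
        OnePLaplace.MemXC p Ω T v Dv v' →
        OnePLaplace.IsDirichletSol p Ω T c f v u₁ Du₁ Z₁ →
        OnePLaplace.IsDirichletSol p Ω T c f v u₂ Du₂ Z₂ →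
        Set.EqOn u₁ u₂ (Set.Icc 0 T)) := by
  obtain ⟨C₁, hC₁, hE⟩ := OnePLaplace.exists_energy_estimate N p Ω hT hγ₀ hκ₀ hΓ₀
  have hγ : 0 < γ₀⁻¹ := inv_pos.2 hγ₀
  -- The sum exceeds the energy constant C₁ and both lower bounds, 10 and 10γ₀⁻¹, required for
  -- stability.
  refine ⟨⟨C₁ + 10 + 10 * γ₀⁻¹, by positivity, fun c hc => ⟨?_, ?_⟩⟩, ?_⟩
  · intro f v u Dv Du Z v' hv hu
    have h1 : 0 ≤ OnePLaplace.normDual p Ω T v' ^ OnePLaplace.pConj p :=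
      Real.rpow_nonneg ENNReal.toReal_nonneg _
    have h2 : 0 ≤ OnePLaplace.normCyl Ω T p Dv ^ p := Real.rpow_nonneg ENNReal.toReal_nonneg _
    refine (hE c hc f v u Dv Du Z v' hv hu).trans (mul_le_mul_of_nonneg_right ?_ (by positivity))
    linarith
  · intro f₁ f₂ v₁ v₂ u₁ u₂ Dv₁ Dv₂ Du₁ Du₂ Z₁ Z₂ v₁' v₂' hv₁ hv₂ hu₁ hu₂
    exact (OnePLaplace.stability_estimate hT hγ₀ hκ₀ hΓ₀ hc hv₁ hv₂ hu₁ hu₂ (by linarith)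
      (by linarith)).2
  · intro c hc f v u₁ u₂ Dv Du₁ Du₂ Z₁ Z₂ v' hv hu₁ hu₂
    exact hu₁.eqOn hT hγ₀ hκ₀ hΓ₀ hc hv hu₂
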